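/- Let $1<p_1,p_2<\infty$ and let $p$ be given by $\frac1p=\frac1{p_1}+\frac1{p_2}$ (so $\frac12<p<\infty$). By a dynamical system $(X,\Sigma,m,S)$ we mean a probability space $(X,\Sigma,m)$ together with an invertible bimeasurable transformation $S:X\to X$ such that $m(S^{-1}A)=m(A)$ for all $A\in\Sigma$. For $f,g:X\to\mathbb C$ and $L\in\mathbb N=\{0,1,2,\dots\}$ put $$\mathfrak Q_L(f,g)(x)=\frac1{(2L+1)^2}\sum_{|l_1|,|l_2|\le L}f(S^{l_1}x)\,g(S^{l_2}x),$$ and for $\rho\ge 1$ and a sequence $(a_L)_{L\in\mathbb N}$ of complex numbers put $$\|(a_L)\|_{V_\rho}=\sup_{n_1<n_2<\cdots}\Big(\sum_{i\ge1}|a_{n_i}-a_{n_{i+1}}|^\rho\Big)^{1/\rho}\in[0,\infty],$$ the supremum being over all strictly increasing sequences of indices. Let $V_\rho(\mathscr Q(f,g))(x)=\|(\mathfrak Q_L(f,g)(x))_{L}\|_{V_\rho}$. (i) For every $\rho>2$ there is a finite constant $C$, depending only on $\rho,p_1,p_2$, such that for every dynamical system $(X,\Sigma,m,S)$ and all $f\in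 L^{p_1}(X)$, $g\in L^{p_2}(X)$, the function $V_\rho(\mathscr Q(f,g))$ is $m$-a.e. equal to a measurable function and $$\|V_\rho(\mathscr Q(f,g))\|_{L^p(X)}\le C\,\|f\|_{L^{p_1}(X)}\|g\|_{L^{p_2}(X)},\qquad\text{where } \|h\|_{L^p(X)}=\Big(\int_X|h|^p\,dm\Big)^{1/p}.$$ (ii) For every dynamical system $(X,\Sigma,m,S)$ and all $f\in L^{p_1}(X)$, $g\in L^{p_2}(X)$, the averages $\mathfrak Q_N(f,g)(x)$ converge, as $N\to\infty$, to a finite limit for $m$-a.e. $x\in X$. -/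

import Mathlib

open MeasureTheory Filter Topology
open scoped ENNReal NNReal

universe u

/-- The `ρ`-variation norm of a sequence of complex numbers, with values in `[0, ∞]`: the supremum
over all strictly increasing sequences of indices `n 0 < n 1 < n 2 < ⋯` of
`(∑ i, |a (n i) - a (n (i + 1))| ^ ρ) ^ (1 / ρ)`. -/
noncomputable def seqVariation (ρ : ℝ) (a : ℕ → ℂ) : ℝ≥0∞ :=
  ⨆ (n : ℕ → ℕ) (_ : StrictMono n), (∑' i : ℕ, ‖a (n i) - a (n (i + 1))‖ₑ ^ ρ) ^ (1 / ρ)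

/-- The ergodic average over the square `{(l₁, l₂) : |l₁| ≤ L, |l₂| ≤ L}`, namely
`(2 L + 1)⁻² ∑ f (S ^ l₁ x) g (S ^ l₂ x)`.  The powers are taken in the group of
permutations of `X`, so that negative powers are iterates of the inverse of `S`. -/
noncomputable def squareAverage {X : Type u} [MeasurableSpace X] (S : X ≃ᵐ X)
    (f g : X → ℂ) (L : ℕ) (x : X) : ℂ :=
  (1 / (2 * (L : ℂ) + 1) ^ 2) *
    ∑ l₁ ∈ Finset.Icc (-(L : ℤ)) (L : ℤ), ∑ l₂ ∈ Finset.Icc (-(L : ℤ)) (L : ℤ),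
      f (((S.toEquiv : Equiv.Perm X) ^ l₁) x) * g (((S.toEquiv : Equiv.Perm X) ^ l₂) x)

/-! The sum over a square factors: the average of `f`, `g` over it is A_L f · A_L g, where A_L is
the mean over the 2L+1 orbit points S^l x with |l| ≤ L (`squareAverage_eq`). A sequence is bounded
by its first term plus its variation, and A_0 f = f, so a Leibniz rule gives the pointwise bound V(A
f · A g) ≤ 2 (|f| + V(A f)) (|g| + V(A g)). Hölder's inequality then reduces (i) to a linear
statement: V(A f) is bounded on L^q for every 1 < q < ∞. Part (ii) follows because a sequence of
finite variation is Cauchy.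

The linear bound is transferred from ℤ to a dynamical system by applying it along long finite pieces
of orbits (`exists_lintegral_zVar_orbitValues_le`). On ℤ it is proved in three ranges of exponents.

In ℓ² (`tsum_zVar_sq_le`) the averages with 2^k ≤ L < 2^(k+1) are compared with the dyadic
expectation of level k. The dyadic martingale obeys Lépingle's inequality: an increment is charged
to a jump of a greedily chosen "anchor" at a threshold θ comparable to its relative size. For each θ
the jumps are square summable with a constant independent of θ, and the weights θ^(ρ-2) sum over θ =
2^(-m) because ρ > 2. The difference between averages and martingale is decomposed into martingale
differences: the one of level j contributes to scale block k only with a factor 2^(-|j-k|), by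
smoothness when j ≥ k and by cancellation when j < k.

For 1 < p < 2 a Calderón–Zygmund decomposition is used (`sq_mul_distr_zVar_le`). The good part goes
to ℓ². The mean-zero atoms are seen by a distant window only while an end of the window lies inside
them, so their contributions are almost orthogonal and decay like length/distance².

For p > 2 the variation oscillates little on dyadic blocks, in mean square and relative to a bound
for the window averages of |φ|² (`exists_zVar_osc_le`). A good-λ inequality turns this into an ℓ^p
bound, provided the maximal averages of |φ|² are controlled in ℓ^(p/2). They are bounded by |φ|²
plus the variation for |φ|², so exponent p follows from exponent p/2, and repeated halving ends at 2
or below (`tsum_zVar_rpow_le`). -/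

/-! ### Variation functionals of sequences -/

/-- The square of the `2`-variation of a sequence, written with natural powers. -/
noncomputable def sqVar (a : ℕ → ℂ) : ℝ≥0∞ :=
  ⨆ (n : ℕ → ℕ) (_ : StrictMono n), ∑' i : ℕ, ‖a (n i) - a (n (i + 1))‖ₑ ^ 2

lemma le_seqVariation (ρ : ℝ) (a : ℕ → ℂ) {n : ℕ → ℕ} (hn : StrictMono n) :
    (∑' i : ℕ, ‖a (n i) - a (n (i + 1))‖ₑ ^ ρ) ^ (1 / ρ) ≤ seqVariation ρ a :=
  le_iSup₂ (f := fun (n : ℕ → ℕ) (_ : StrictMono n) =>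
    (∑' i : ℕ, ‖a (n i) - a (n (i + 1))‖ₑ ^ ρ) ^ (1 / ρ)) n hn

lemma le_sqVar (a : ℕ → ℂ) {n : ℕ → ℕ} (hn : StrictMono n) :
    ∑' i : ℕ, ‖a (n i) - a (n (i + 1))‖ₑ ^ 2 ≤ sqVar a :=
  le_iSup₂ (f := fun (n : ℕ → ℕ) (_ : StrictMono n) =>
    ∑' i : ℕ, ‖a (n i) - a (n (i + 1))‖ₑ ^ 2) n hn

lemma tsum_rpow_le_seqVariation_rpow {ρ : ℝ} (hρ : 0 < ρ) (a : ℕ → ℂ) {n : ℕ → ℕ}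
    (hn : StrictMono n) :
    ∑' i : ℕ, ‖a (n i) - a (n (i + 1))‖ₑ ^ ρ ≤ seqVariation ρ a ^ ρ := by
  have h := ENNReal.rpow_le_rpow (le_seqVariation ρ a hn) hρ.le
  rwa [← ENNReal.rpow_mul, one_div_mul_cancel hρ.ne', ENNReal.rpow_one] at h

lemma seqVariation_le_of_tsum_le {ρ : ℝ} (hρ : 0 < ρ) {a : ℕ → ℂ} {B : ℝ≥0∞}
    (h : ∀ n : ℕ → ℕ, StrictMono n → ∑' i : ℕ, ‖a (n i) - a (n (i + 1))‖ₑ ^ ρ ≤ B ^ ρ) :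
    seqVariation ρ a ≤ B := by
  refine iSup₂_le fun n hn => ?_
  have h' := ENNReal.rpow_le_rpow (h n hn) (one_div_nonneg.2 hρ.le)
  rwa [← ENNReal.rpow_mul, mul_one_div_cancel hρ.ne', ENNReal.rpow_one] at h'

lemma tsum_Lp_add_le {p : ℝ} (hp : 1 ≤ p) (f g : ℕ → ℝ≥0∞) :
    (∑' i, (f i + g i) ^ p) ^ (1 / p) ≤ (∑' i, f i ^ p) ^ (1 / p) + (∑' i, g i ^ p) ^ (1 / p) := by
  have h := ENNReal.lintegral_Lp_add_le (μ := (Measure.count : Measure ℕ)) (f := f) (g := g)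
    (measurable_of_countable f).aemeasurable (measurable_of_countable g).aemeasurable hp
  simpa [lintegral_count] using h

lemma seqVariation_add_le {ρ : ℝ} (hρ : 1 ≤ ρ) (a b : ℕ → ℂ) :
    seqVariation ρ (fun L => a L + b L) ≤ seqVariation ρ a + seqVariation ρ b := by
  refine iSup₂_le fun n hn => ?_
  calc _ ≤ (∑' i : ℕ, (‖a (n i) - a (n (i + 1))‖ₑ + ‖b (n i) - b (n (i + 1))‖ₑ) ^ ρ) ^ (1 / ρ) := by
        refine ENNReal.rpow_le_rpow (ENNReal.tsum_le_tsum fun i =>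
          ENNReal.rpow_le_rpow ?_ (by linarith)) (one_div_nonneg.2 (by linarith))
        rw [add_sub_add_comm]
        exact enorm_add_le _ _
    _ ≤ _ := tsum_Lp_add_le hρ _ _
    _ ≤ _ := add_le_add (le_seqVariation ρ a hn) (le_seqVariation ρ b hn)

/-- Each term is at most the square root of the sum of squares, so the factor `x i ^ (ρ - 2)` can be
pulled out. -/
lemma tsum_rpow_le_tsum_sq_rpow {ι : Type*} {ρ : ℝ} (hρ : 2 ≤ ρ) (x : ι → ℝ≥0∞) :
    ∑' i, x i ^ ρ ≤ (∑' i, x i ^ 2) ^ (ρ / 2) := by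
  set T := ∑' i, x i ^ 2 with hT
  have hx : ∀ i, x i ≤ T ^ (1 / 2 : ℝ) := fun i => by
    have h : x i ^ 2 ≤ T := ENNReal.le_tsum i
    have h' := ENNReal.rpow_le_rpow h (by norm_num : (0 : ℝ) ≤ 1 / 2)
    rwa [← ENNReal.rpow_natCast, ← ENNReal.rpow_mul, show ((2 : ℕ) : ℝ) * (1 / 2) = 1 by norm_num,
      ENNReal.rpow_one] at h'
  calc ∑' i, x i ^ ρ ≤ ∑' i, T ^ ((ρ - 2) / 2) * x i ^ 2 := by
        refine ENNReal.tsum_le_tsum fun i => ?_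
        have : x i ^ ρ = x i ^ (ρ - 2) * x i ^ 2 := by
          rw [← ENNReal.rpow_natCast, ← ENNReal.rpow_add_of_nonneg _ _ (by linarith) (by norm_num)]
          congr 1; push_cast; ring
        rw [this]
        gcongr
        calc x i ^ (ρ - 2) ≤ (T ^ (1 / 2 : ℝ)) ^ (ρ - 2) :=
              ENNReal.rpow_le_rpow (hx i) (by linarith)
          _ = _ := by rw [← ENNReal.rpow_mul]; congr 1; ring
    _ = T ^ ((ρ - 2) / 2) * T ^ (1 : ℝ) := by rw [ENNReal.tsum_mul_left, ENNReal.rpow_one]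
    _ = T ^ (ρ / 2) := by
        rw [← ENNReal.rpow_add_of_nonneg _ _ (by linarith) (by norm_num)]; congr 1; ring

lemma seqVariation_sq_le_sqVar {ρ : ℝ} (hρ : 2 ≤ ρ) (a : ℕ → ℂ) :
    seqVariation ρ a ^ 2 ≤ sqVar a := by
  have h : seqVariation ρ a ≤ sqVar a ^ (1 / 2 : ℝ) := by
    refine seqVariation_le_of_tsum_le (by linarith) fun n hn => ?_
    refine (tsum_rpow_le_tsum_sq_rpow hρ _).trans ?_
    rw [← ENNReal.rpow_mul, show 1 / 2 * ρ = ρ / 2 by ring]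
    exact ENNReal.rpow_le_rpow (le_sqVar a hn) (by linarith)
  calc seqVariation ρ a ^ 2 ≤ (sqVar a ^ (1 / 2 : ℝ)) ^ 2 := by gcongr
    _ = sqVar a := by
      rw [← ENNReal.rpow_natCast, ← ENNReal.rpow_mul]; norm_num

lemma tsum_sq_le_sq_tsum {ι : Type*} (x : ι → ℝ≥0∞) : ∑' i, x i ^ 2 ≤ (∑' i, x i) ^ 2 := by
  calc ∑' i, x i ^ 2 ≤ ∑' i, x i * ∑' j, x j := by
        refine ENNReal.tsum_le_tsum fun i => ?_
        rw [sq]; gcongr; exact ENNReal.le_tsum i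
    _ = _ := by rw [ENNReal.tsum_mul_right, sq]

/-- Increments along a subsequence split into unit increments over disjoint intervals, and ℓ¹ sums
dominate ℓ² sums. -/
lemma sqVar_le_sq_tsum (a : ℕ → ℂ) : sqVar a ≤ (∑' L, ‖a L - a (L + 1)‖ₑ) ^ 2 := by
  refine iSup₂_le fun n hn => (tsum_sq_le_sq_tsum _).trans (pow_le_pow_left' ?_ 2)
  rw [ENNReal.tsum_eq_iSup_nat]
  refine iSup_le fun K => ?_
  refine le_trans ?_ (ENNReal.sum_le_tsum (Finset.Ico (n 0) (n K)))
  simp only [← edist_eq_enorm_sub]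
  induction K with
  | zero => simp
  | succ K ih =>
    rw [Finset.sum_range_succ, ← Finset.sum_Ico_consecutive _ (hn.monotone (Nat.zero_le K))
      (hn.monotone (Nat.le_succ K))]
    exact add_le_add ih (edist_le_Ico_sum_edist a (hn.monotone (Nat.le_succ K)))

/-! ### Almost orthogonality for the 2-variation of sums. -/

lemma enorm_sum_sq_le_weighted {ι : Type*} (s : Finset ι) (w : ι → ℝ≥0) (hw : ∀ r ∈ s, w r ≠ 0)
    (z : ι → ℂ) :
    ‖∑ r ∈ s, z r‖ₑ ^ 2 ≤ (∑ r ∈ s, (w r : ℝ≥0∞)) * ∑ r ∈ s, ((w r)⁻¹ : ℝ≥0) * ‖z r‖ₑ ^ 2 := by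
  have h1 : ‖∑ r ∈ s, z r‖₊ ^ 2 ≤ (∑ r ∈ s, w r) * ∑ r ∈ s, (w r)⁻¹ * ‖z r‖₊ ^ 2 := by
    calc ‖∑ r ∈ s, z r‖₊ ^ 2 ≤ (∑ r ∈ s, ‖z r‖₊) ^ 2 := by gcongr; exact nnnorm_sum_le _ _
      _ ≤ _ := Finset.sum_sq_le_sum_mul_sum_of_sq_le_mul s (by simp) (by simp) fun r hr => by
        rw [← mul_assoc, mul_inv_cancel₀ (hw r hr), one_mul]
  have h2 := ENNReal.coe_le_coe.2 h1
  simpa [enorm_eq_nnnorm] using h2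

lemma enorm_sum_sq_le_card {ι : Type*} (s : Finset ι) (z : ι → ℂ) :
    ‖∑ r ∈ s, z r‖ₑ ^ 2 ≤ s.card * ∑ r ∈ s, ‖z r‖ₑ ^ 2 := by
  simpa using enorm_sum_sq_le_weighted s (fun _ => 1) (by simp) z

lemma enorm_add_sq_le (z w : ℂ) : ‖z + w‖ₑ ^ 2 ≤ 2 * (‖z‖ₑ ^ 2 + ‖w‖ₑ ^ 2) := by
  simpa using enorm_sum_sq_le_card Finset.univ ![z, w]

/-- If at each index at most `m` of the sequences `a r` are nonzero, they are almost orthogonal for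
the `2`-variation. -/
lemma sqVar_sum_le_of_overlap {ι : Type*} (s : Finset ι) (a : ι → ℕ → ℂ) (m : ℕ)
    (h : ∀ L, (s.filter fun r => a r L ≠ 0).card ≤ m) :
    sqVar (fun L => ∑ r ∈ s, a r L) ≤ 2 * m * ∑ r ∈ s, sqVar (a r) := by
  classical
  refine iSup₂_le fun n hn => ?_
  calc ∑' i, ‖∑ r ∈ s, a r (n i) - ∑ r ∈ s, a r (n (i + 1))‖ₑ ^ 2
      ≤ ∑' i, (2 * m : ℝ≥0∞) * ∑ r ∈ s, ‖a r (n i) - a r (n (i + 1))‖ₑ ^ 2 := by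
        refine ENNReal.tsum_le_tsum fun i => ?_
        rw [← Finset.sum_sub_distrib]
        set t := s.filter fun r => a r (n i) - a r (n (i + 1)) ≠ 0
        have ht : ∑ r ∈ t, (a r (n i) - a r (n (i + 1))) = ∑ r ∈ s, (a r (n i) - a r (n (i + 1))) :=
          Finset.sum_filter_ne_zero s
        -- An increment has two end points, and at each of them at most `m` terms are nonzero.
        have hc : t.card ≤ 2 * m := by
          have hsub : t ⊆ (s.filter fun r => a r (n i) ≠ 0) ∪
              (s.filter fun r => a r (n (i + 1)) ≠ 0) := by
            intro r hr
            simp only [t, Finset.mem_filter, Finset.mem_union] at hr ⊢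
            by_contra hcon
            push Not at hcon
            apply hr.2
            rw [hcon.1 hr.1, hcon.2 hr.1, sub_zero]
          have := (Finset.card_le_card hsub).trans (Finset.card_union_le _ _)
          have h1 := h (n i)
          have h2 := h (n (i + 1))
          omega
        rw [← ht]
        refine (enorm_sum_sq_le_card t _).trans ?_
        gcongr
        · exact_mod_cast hc
        · exact Finset.filter_subset _ _
    _ = (2 * m : ℝ≥0∞) * ∑ r ∈ s, ∑' i, ‖a r (n i) - a r (n (i + 1))‖ₑ ^ 2 := by
        rw [ENNReal.tsum_mul_left, Summable.tsum_finsetSum fun _ _ => ENNReal.summable]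
    _ ≤ _ := by gcongr with r hr; exact le_sqVar (a r) hn

/-- Serves when all terms overlap: Cauchy–Schwarz is applied to each increment, and geometric
weights will keep the first factor bounded. -/
lemma sqVar_sum_le_weighted {ι : Type*} (s : Finset ι) (w : ι → ℝ≥0) (hw : ∀ r ∈ s, w r ≠ 0)
    (a : ι → ℕ → ℂ) :
    sqVar (fun L => ∑ r ∈ s, a r L) ≤
      (∑ r ∈ s, (w r : ℝ≥0∞)) * ∑ r ∈ s, ((w r)⁻¹ : ℝ≥0) * sqVar (a r) := by
  refine iSup₂_le fun n hn => ?_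
  calc ∑' i, ‖∑ r ∈ s, a r (n i) - ∑ r ∈ s, a r (n (i + 1))‖ₑ ^ 2
      ≤ ∑' i, (∑ r ∈ s, (w r : ℝ≥0∞)) *
          ∑ r ∈ s, ((w r)⁻¹ : ℝ≥0) * ‖a r (n i) - a r (n (i + 1))‖ₑ ^ 2 := by
        refine ENNReal.tsum_le_tsum fun i => ?_
        rw [← Finset.sum_sub_distrib]
        exact enorm_sum_sq_le_weighted s w hw _
    _ = (∑ r ∈ s, (w r : ℝ≥0∞)) *
          ∑ r ∈ s, ((w r)⁻¹ : ℝ≥0) * ∑' i, ‖a r (n i) - a r (n (i + 1))‖ₑ ^ 2 := by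
        rw [ENNReal.tsum_mul_left, Summable.tsum_finsetSum fun _ _ => ENNReal.summable]
        simp_rw [ENNReal.tsum_mul_left]
    _ ≤ _ := by gcongr with r hr; exact le_sqVar (a r) hn

/-! ### Pointwise bounds, reparametrisation and truncation of the index set. -/

lemma enorm_sub_le_seqVariation {ρ : ℝ} (hρ : 0 < ρ) (a : ℕ → ℂ) {k l : ℕ} (hkl : k < l) :
    ‖a k - a l‖ₑ ≤ seqVariation ρ a := by
  -- The pair is completed to the strictly increasing sequence k, l, l + 1, l + 2, ….
  have hn : StrictMono (fun i : ℕ => if i = 0 then k else l + i - 1) := by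
    intro i j hij
    dsimp only
    split_ifs <;> omega
  have h := tsum_rpow_le_seqVariation_rpow hρ a hn
  have h0 := (ENNReal.le_tsum 0).trans h
  simp only [if_pos, zero_add, one_ne_zero, if_false, Nat.add_sub_cancel] at h0
  exact (ENNReal.rpow_le_rpow_iff hρ).1 h0

lemma enorm_le_add_seqVariation {ρ : ℝ} (hρ : 0 < ρ) (a : ℕ → ℂ) (L : ℕ) :
    ‖a L‖ₑ ≤ ‖a 0‖ₑ + seqVariation ρ a := by
  rcases Nat.eq_zero_or_pos L with rfl | hL
  · exact le_self_add
  · calc ‖a L‖ₑ = ‖a 0 - (a 0 - a L)‖ₑ := by rw [sub_sub_cancel]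
      _ ≤ ‖a 0‖ₑ + ‖a 0 - a L‖ₑ := enorm_sub_le
      _ ≤ _ := by gcongr; exact enorm_sub_le_seqVariation hρ a hL

/-- Repetitions contribute `F i i = 0` and can be deleted; beyond the last retained index the
sequence continues by unit steps. This makes the variation stable under monotone, not only strictly
monotone, changes of index. -/
lemma exists_strictMono_sum_le (F : ℕ → ℕ → ℝ≥0∞) (hF : ∀ i, F i i = 0) {t : ℕ → ℕ}
    (ht : Monotone t) (K : ℕ) :
    ∃ (n : ℕ → ℕ) (K' : ℕ), StrictMono n ∧ n K' = t K ∧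
      ∑ i ∈ Finset.range K, F (t i) (t (i + 1)) = ∑ i ∈ Finset.range K', F (n i) (n (i + 1)) := by
  induction K with
  | zero => exact ⟨fun i => t 0 + i, 0, fun i j h => by simpa using h, by simp, by simp⟩
  | succ K ih =>
    obtain ⟨n, K', hn, hK, hs⟩ := ih
    rcases (ht (Nat.le_succ K)).eq_or_lt with h | h
    · refine ⟨n, K', hn, hK.trans h, ?_⟩
      rw [Finset.sum_range_succ, hs, ← Nat.succ_eq_add_one K, ← h, hF, add_zero]
    · refine ⟨fun i => if i ≤ K' then n i else t (K + 1) + (i - K' - 1), K' + 1, ?_, by simp, ?_⟩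
      · intro i j hij
        dsimp only
        split_ifs with h1 h2 h2
        · exact hn hij
        · have := hn.monotone h1
          simp only [Nat.succ_eq_add_one] at h
          omega
        · omega
        · omega
      · rw [Finset.sum_range_succ, Finset.sum_range_succ, hs]
        congr 1
        · refine Finset.sum_congr rfl fun i hi => ?_
          have := Finset.mem_range.1 hi
          dsimp only
          rw [if_pos (by omega), if_pos (by omega)]
        · simp [hK]

lemma sum_rpow_le_seqVariation_of_monotone {ρ : ℝ} (hρ : 0 < ρ) (a : ℕ → ℂ) {t : ℕ → ℕ}
    (ht : Monotone t) (K : ℕ) :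
    ∑ i ∈ Finset.range K, ‖a (t i) - a (t (i + 1))‖ₑ ^ ρ ≤ seqVariation ρ a ^ ρ := by
  obtain ⟨n, K', hn, -, hs⟩ := exists_strictMono_sum_le (fun i j => ‖a i - a j‖ₑ ^ ρ)
    (fun i => by simp [hρ]) ht K
  rw [hs]
  exact (ENNReal.sum_le_tsum _).trans (tsum_rpow_le_seqVariation_rpow hρ a hn)

lemma seqVariation_comp_le {ρ : ℝ} (hρ : 0 < ρ) (a : ℕ → ℂ) {g : ℕ → ℕ} (hg : Monotone g) :
    seqVariation ρ (fun L => a (g L)) ≤ seqVariation ρ a := by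
  refine seqVariation_le_of_tsum_le hρ fun n hn => ?_
  rw [ENNReal.tsum_eq_iSup_nat]
  exact iSup_le fun K => sum_rpow_le_seqVariation_of_monotone hρ a (hg.comp hn.monotone) K

lemma seqVariation_min_mono {ρ : ℝ} (hρ : 0 < ρ) (a : ℕ → ℂ) :
    Monotone fun N => seqVariation ρ (fun L => a (min L N)) := by
  intro N N' h
  have := seqVariation_comp_le hρ (fun L => a (min L N')) (g := fun L => min L N)
    (fun i j hij => min_le_min_right _ hij)
  simpa [min_assoc, min_eq_left h] using this

/-- Every partial sum sees finitely many indices, so freezing the sequence after index `N` loses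
nothing in the limit. The martingale estimate and the transference both work with finitely many
scales and then pass to the limit by monotone convergence. -/
lemma iSup_seqVariation_min {ρ : ℝ} (hρ : 0 < ρ) (a : ℕ → ℂ) :
    ⨆ N, seqVariation ρ (fun L => a (min L N)) = seqVariation ρ a := by
  apply le_antisymm
  · exact iSup_le fun N => seqVariation_comp_le hρ a fun i j hij => min_le_min_right _ hij
  · refine seqVariation_le_of_tsum_le hρ fun n hn => ?_
    rw [ENNReal.tsum_eq_iSup_nat]
    refine iSup_le fun K => ?_
    calc ∑ i ∈ Finset.range K, ‖a (n i) - a (n (i + 1))‖ₑ ^ ρ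
        = ∑ i ∈ Finset.range K, ‖a (min (n i) (n K)) - a (min (n (i + 1)) (n K))‖ₑ ^ ρ := by
          refine Finset.sum_congr rfl fun i hi => ?_
          have := Finset.mem_range.1 hi
          rw [min_eq_left (hn.monotone (by omega)), min_eq_left (hn.monotone (by omega))]
      _ ≤ seqVariation ρ (fun L => a (min L (n K))) ^ ρ :=
          (ENNReal.sum_le_tsum _).trans
            (tsum_rpow_le_seqVariation_rpow hρ (fun L => a (min L (n K))) hn)
      _ ≤ _ := by
          gcongr
          exact le_iSup (fun N => seqVariation ρ (fun L => a (min L N))) (n K)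

/-! ### Dyadic averages on the integers -/

/-- The dyadic block of length `2 ^ k` containing `x`. -/
noncomputable def dyBlock (k : ℕ) (x : ℤ) : Finset ℤ := Finset.Ico (2 ^ k * (x / 2 ^ k)) (2 ^ k * (x / 2 ^ k) + 2 ^ k)

/-- Dyadic conditional expectation. -/
noncomputable def dyE (k : ℕ) (φ : ℤ → ℂ) (x : ℤ) : ℂ := (2 ^ k)⁻¹ * ∑ y ∈ dyBlock k x, φ y

/-- Dyadic average of a function with values in `[0, ∞]`. -/
noncomputable def dyA (k : ℕ) (h : ℤ → ℝ≥0∞) (x : ℤ) : ℝ≥0∞ := (2 ^ k)⁻¹ * ∑ y ∈ dyBlock k x, h y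

/-- The dyadic maximal function. -/
noncomputable def dyMax (h : ℤ → ℝ≥0∞) (x : ℤ) : ℝ≥0∞ := ⨆ k, dyA k h x

lemma mem_dyBlock {k : ℕ} {x y : ℤ} : y ∈ dyBlock k x ↔ y / 2 ^ k = x / 2 ^ k := by
  have h2 : (0 : ℤ) < 2 ^ k := by positivity
  rw [dyBlock, Finset.mem_Ico, Int.ediv_eq_iff_of_pos h2]
  constructor <;> rintro ⟨h1, h3⟩ <;> constructor <;> linarith

lemma card_dyBlock (k : ℕ) (x : ℤ) : (dyBlock k x).card = 2 ^ k := by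
  rw [dyBlock, Int.card_Ico, add_sub_cancel_left]
  exact_mod_cast Int.toNat_natCast (2 ^ k)

lemma dyBlock_zero (x : ℤ) : dyBlock 0 x = {x} := by
  ext y
  rw [mem_dyBlock]
  simp

lemma dyBlock_congr {k : ℕ} {x y : ℤ} (h : y / 2 ^ k = x / 2 ^ k) : dyBlock k y = dyBlock k x := by
  rw [dyBlock, dyBlock, h]

lemma ediv_two_pow_congr {k l : ℕ} (hkl : k ≤ l) {x y : ℤ} (h : y / 2 ^ k = x / 2 ^ k) :
    y / 2 ^ l = x / 2 ^ l := by
  obtain ⟨m, rfl⟩ := Nat.exists_eq_add_of_le hkl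
  have h2 : (0 : ℤ) ≤ 2 ^ k := by positivity
  rw [pow_add, ← Int.ediv_ediv_of_nonneg h2, ← Int.ediv_ediv_of_nonneg h2, h]

lemma dyE_congr {k : ℕ} {x y : ℤ} (h : y / 2 ^ k = x / 2 ^ k) (φ : ℤ → ℂ) :
    dyE k φ y = dyE k φ x := by
  rw [dyE, dyE, dyBlock_congr h]

lemma dyA_congr {k : ℕ} {x y : ℤ} (h : y / 2 ^ k = x / 2 ^ k) (φ : ℤ → ℝ≥0∞) :
    dyA k φ y = dyA k φ x := by
  rw [dyA, dyA, dyBlock_congr h]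

lemma dyE_zero (φ : ℤ → ℂ) (x : ℤ) : dyE 0 φ x = φ x := by
  simp [dyE, dyBlock_zero]

lemma dyA_zero (h : ℤ → ℝ≥0∞) (x : ℤ) : dyA 0 h x = h x := by
  simp [dyA, dyBlock_zero]

lemma enorm_dyE_le (k : ℕ) (φ : ℤ → ℂ) (x : ℤ) :
    ‖dyE k φ x‖ₑ ≤ dyA k (fun y => ‖φ y‖ₑ) x := by
  rw [dyE, dyA, enorm_mul]
  gcongr
  · rw [enorm_inv (pow_ne_zero _ two_ne_zero), enorm_pow]
    simp [enorm_eq_nnnorm]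
  · exact enorm_sum_le _ _

lemma two_pow_mul_inv (k : ℕ) : (2 ^ k : ℝ≥0∞) * (2 ^ k)⁻¹ = 1 :=
  ENNReal.mul_inv_cancel (by simp) (by simp)

lemma two_pow_mul_dyA (k : ℕ) (h : ℤ → ℝ≥0∞) (x : ℤ) :
    2 ^ k * dyA k h x = ∑ y ∈ dyBlock k x, h y := by
  rw [dyA, ← mul_assoc, two_pow_mul_inv, one_mul]

lemma dyA_mono {k : ℕ} {h h' : ℤ → ℝ≥0∞} {x : ℤ} (H : ∀ y ∈ dyBlock k x, h y ≤ h' y) :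
    dyA k h x ≤ dyA k h' x := by
  unfold dyA
  gcongr with y hy
  exact H y hy

lemma dyA_add (k : ℕ) (h h' : ℤ → ℝ≥0∞) (x : ℤ) :
    dyA k (fun y => h y + h' y) x = dyA k h x + dyA k h' x := by
  simp [dyA, Finset.sum_add_distrib, mul_add]

lemma dyA_const (k : ℕ) (c : ℝ≥0∞) (x : ℤ) : dyA k (fun _ => c) x = c := by
  rw [dyA, Finset.sum_const, card_dyBlock, nsmul_eq_mul, ← mul_assoc]
  push_cast
  rw [mul_comm ((2 : ℝ≥0∞) ^ k)⁻¹, two_pow_mul_inv, one_mul]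

lemma le_dyMax (k : ℕ) (h : ℤ → ℝ≥0∞) (x : ℤ) : dyA k h x ≤ dyMax h x :=
  le_iSup (fun k => dyA k h x) k

lemma self_le_dyMax (h : ℤ → ℝ≥0∞) (x : ℤ) : h x ≤ dyMax h x := by
  simpa [dyA_zero] using le_dyMax 0 h x

lemma dyA_le_two_mul_succ (k : ℕ) (h : ℤ → ℝ≥0∞) (x : ℤ) : dyA k h x ≤ 2 * dyA (k + 1) h x := by
  have hsub : dyBlock k x ⊆ dyBlock (k + 1) x := fun y hy =>
    mem_dyBlock.2 (ediv_two_pow_congr (Nat.le_succ k) (mem_dyBlock.1 hy))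
  have : 2 ^ k * dyA k h x ≤ 2 ^ k * (2 * dyA (k + 1) h x) := by
    rw [two_pow_mul_dyA, ← mul_assoc, ← pow_succ, two_pow_mul_dyA]
    exact Finset.sum_le_sum_of_subset hsub
  exact (ENNReal.mul_le_mul_iff_right (by simp) (by simp)).1 this

/-! #### The martingale structure -/

/-- The sibling of `x` in the passage from blocks of length `2 ^ k` to blocks of length
`2 ^ (k + 1)`. -/
def dySwap (k : ℕ) (x : ℤ) : ℤ := if (x / 2 ^ k) % 2 = 0 then x + 2 ^ k else x - 2 ^ k

lemma dySwap_ediv (k : ℕ) (x : ℤ) :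
    dySwap k x / 2 ^ k = if (x / 2 ^ k) % 2 = 0 then x / 2 ^ k + 1 else x / 2 ^ k - 1 := by
  have h2 : (2 : ℤ) ^ k ≠ 0 := by positivity
  unfold dySwap
  split_ifs with h
  · simpa using Int.add_mul_ediv_right x 1 h2
  · simpa [sub_eq_add_neg] using Int.add_mul_ediv_right x (-1) h2

lemma dySwap_dySwap (k : ℕ) (x : ℤ) : dySwap k (dySwap k x) = x := by
  have h := dySwap_ediv k x
  conv_lhs => rw [dySwap]
  rw [h]
  split_ifs with h1 h2 h2
  · omega
  · simp [dySwap, h1]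
  · simp [dySwap, h1]
  · omega

lemma dySwap_ediv_succ (k : ℕ) (x : ℤ) : dySwap k x / 2 ^ (k + 1) = x / 2 ^ (k + 1) := by
  have h2 : (0 : ℤ) ≤ 2 ^ k := by positivity
  rw [pow_succ, ← Int.ediv_ediv_of_nonneg h2, ← Int.ediv_ediv_of_nonneg h2, dySwap_ediv]
  split_ifs with h <;> omega

/-- The sibling map as a permutation. -/
def dySwapEquiv (k : ℕ) : ℤ ≃ ℤ := ⟨dySwap k, dySwap k, dySwap_dySwap k, dySwap_dySwap k⟩

lemma dyBlock_succ (k : ℕ) (x : ℤ) :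
    dyBlock (k + 1) x = dyBlock k x ∪ dyBlock k (dySwap k x) := by
  have h2 : (0 : ℤ) ≤ 2 ^ k := by positivity
  ext y
  rw [Finset.mem_union, mem_dyBlock, mem_dyBlock, mem_dyBlock, pow_succ,
    ← Int.ediv_ediv_of_nonneg h2, ← Int.ediv_ediv_of_nonneg h2, dySwap_ediv]
  split_ifs with h <;> omega

lemma disjoint_dyBlock (k : ℕ) (x : ℤ) : Disjoint (dyBlock k x) (dyBlock k (dySwap k x)) := by
  rw [Finset.disjoint_left]
  intro y h1 h2
  rw [mem_dyBlock] at h1 h2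
  rw [dySwap_ediv] at h2
  split_ifs at h2 <;> omega

lemma dyE_succ (k : ℕ) (φ : ℤ → ℂ) (x : ℤ) :
    dyE (k + 1) φ x = (dyE k φ x + dyE k φ (dySwap k x)) / 2 := by
  have : (2 : ℂ) ^ k ≠ 0 := pow_ne_zero _ two_ne_zero
  rw [dyE, dyE, dyE, dyBlock_succ, Finset.sum_union (disjoint_dyBlock k x), pow_succ]
  field_simp

lemma tsum_dySwap (k : ℕ) (h : ℤ → ℝ≥0∞) : ∑' x, h (dySwap k x) = ∑' x, h x :=
  (dySwapEquiv k).tsum_eq h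

lemma enorm_sq_add_enorm_sq (z w : ℂ) :
    ‖z‖ₑ ^ 2 + ‖w‖ₑ ^ 2 = 2 * ‖(z + w) / 2‖ₑ ^ 2 + (‖z - (z + w) / 2‖ₑ ^ 2 + ‖w - (z + w) / 2‖ₑ ^ 2) := by
  have h : ‖z‖ ^ 2 + ‖w‖ ^ 2 = 2 * ‖(z + w) / 2‖ ^ 2 +
      (‖z - (z + w) / 2‖ ^ 2 + ‖w - (z + w) / 2‖ ^ 2) := by
    simp only [← Complex.normSq_eq_norm_sq, Complex.normSq_apply, Complex.add_re, Complex.sub_re,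
      Complex.add_im, Complex.sub_im, Complex.div_ofNat_re, Complex.div_ofNat_im]
    ring
  have h' : ‖z‖₊ ^ 2 + ‖w‖₊ ^ 2 = 2 * ‖(z + w) / 2‖₊ ^ 2 +
      (‖z - (z + w) / 2‖₊ ^ 2 + ‖w - (z + w) / 2‖₊ ^ 2) := by
    apply NNReal.coe_injective
    push_cast
    exact h
  simp only [enorm_eq_nnnorm]
  exact_mod_cast h'

/-- Pythagoras for one step of the dyadic martingale. -/
lemma tsum_dyE_sub_sq (k : ℕ) (φ c : ℤ → ℂ) (hc : ∀ x, c (dySwap k x) = c x) :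
    ∑' x, ‖dyE k φ x - c x‖ₑ ^ 2 =
      ∑' x, ‖dyE (k + 1) φ x - c x‖ₑ ^ 2 + ∑' x, ‖dyE k φ x - dyE (k + 1) φ x‖ₑ ^ 2 := by
  have hE : ∀ x, dyE (k + 1) φ (dySwap k x) = dyE (k + 1) φ x := fun x =>
    dyE_congr (dySwap_ediv_succ k x) φ
  -- Summing over `x` and over its sibling counts everything twice. On each pair the parallelogram
  -- identity applies, since `c` takes one value there and the mean of the two values of `dyE k φ`
  -- is `dyE (k + 1) φ`.
  have h2 : 2 * ∑' x, ‖dyE k φ x - c x‖ₑ ^ 2 =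
      2 * (∑' x, ‖dyE (k + 1) φ x - c x‖ₑ ^ 2 + ∑' x, ‖dyE k φ x - dyE (k + 1) φ x‖ₑ ^ 2) := by
    calc 2 * ∑' x, ‖dyE k φ x - c x‖ₑ ^ 2
        = ∑' x, ‖dyE k φ x - c x‖ₑ ^ 2 + ∑' x, ‖dyE k φ (dySwap k x) - c (dySwap k x)‖ₑ ^ 2 := by
          rw [tsum_dySwap k fun x => ‖dyE k φ x - c x‖ₑ ^ 2, two_mul]
      _ = ∑' x, (2 * ‖dyE (k + 1) φ x - c x‖ₑ ^ 2 + (‖dyE k φ x - dyE (k + 1) φ x‖ₑ ^ 2 +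
            ‖dyE k φ (dySwap k x) - dyE (k + 1) φ (dySwap k x)‖ₑ ^ 2)) := by
          rw [← ENNReal.tsum_add]
          refine tsum_congr fun x => ?_
          rw [enorm_sq_add_enorm_sq, hc, hE]
          have : (dyE k φ x - c x + (dyE k φ (dySwap k x) - c x)) / 2 = dyE (k + 1) φ x - c x := by
            rw [dyE_succ]; ring
          rw [this, sub_sub_sub_cancel_right, sub_sub_sub_cancel_right]
      _ = _ := by
          rw [ENNReal.tsum_add, ENNReal.tsum_add, ENNReal.tsum_mul_left,
            tsum_dySwap k fun x => ‖dyE k φ x - dyE (k + 1) φ x‖ₑ ^ 2]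
          ring
  exact (ENNReal.mul_right_inj (by simp) (by simp)).1 h2

/-- Orthogonality of martingale differences, obtained by iterating the one-step Pythagoras identity
with `c = 0`. -/
lemma sum_tsum_dyE_sub_sq (φ : ℤ → ℂ) (J : ℕ) :
    ∑ k ∈ Finset.range J, ∑' x, ‖dyE k φ x - dyE (k + 1) φ x‖ₑ ^ 2 + ∑' x, ‖dyE J φ x‖ₑ ^ 2 =
      ∑' x, ‖φ x‖ₑ ^ 2 := by
  induction J with
  | zero => simp [dyE_zero]
  | succ J ih =>
    have h := tsum_dyE_sub_sq J φ (fun _ => 0) (fun _ => rfl)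
    simp only [sub_zero] at h
    rw [← ih, h, Finset.sum_range_succ]
    ring

/-! #### Stopping times and the dyadic maximal function -/

/-- Take for `κ x` the largest level whose average exceeds `t`. Averages at that level and above are
shared by all points of the block, so these maximal blocks partition the level set of `dyMax h`. -/
lemma exists_stopping (h : ℤ → ℝ≥0∞) (t : ℝ≥0∞)
    (hfin : ∀ x, ∃ K, ∀ k, K ≤ k → dyA k h x ≤ t) :
    ∃ κ : ℤ → ℕ, ∀ x, t < dyMax h x → t < dyA (κ x) h x ∧ (∀ k, κ x < k → dyA k h x ≤ t) ∧
      ∀ y ∈ dyBlock (κ x) x, t < dyMax h y ∧ κ y = κ x := by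
  classical
  choose K hK using hfin
  let κ : ℤ → ℕ := fun x => Nat.findGreatest (fun k => t < dyA k h x) (K x)
  have h1 : ∀ x, t < dyMax h x → t < dyA (κ x) h x ∧ ∀ k, κ x < k → dyA k h x ≤ t := by
    intro x hx
    obtain ⟨k, hk⟩ := lt_iSup_iff.1 hx
    have hkK : k ≤ K x := by
      by_contra hcon
      exact absurd (hK x k (by omega)) (not_le.2 hk)
    refine ⟨Nat.findGreatest_spec (P := fun k => t < dyA k h x) hkK hk, fun l hl => ?_⟩
    by_contra hcon
    push Not at hcon
    have hlK : l ≤ K x := by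
      by_contra hcon'
      exact absurd (hK x l (by omega)) (not_le.2 hcon)
    exact absurd (Nat.le_findGreatest (P := fun k => t < dyA k h x) hlK hcon) (not_le.2 hl)
  refine ⟨κ, fun x hx => ⟨(h1 x hx).1, (h1 x hx).2, fun y hy => ?_⟩⟩
  rw [mem_dyBlock] at hy
  have hy1 : t < dyA (κ x) h y := by rw [dyA_congr hy]; exact (h1 x hx).1
  have hyt : t < dyMax h y := hy1.trans_le (le_dyMax _ _ _)
  refine ⟨hyt, le_antisymm ?_ ?_⟩
  · by_contra hcon
    push Not at hcon
    have := (h1 x hx).2 _ hcon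
    rw [← dyA_congr (ediv_two_pow_congr hcon.le hy)] at this
    exact absurd (h1 y hyt).1 (not_lt.2 this)
  · by_contra hcon
    push Not at hcon
    exact absurd hy1 (not_lt.2 ((h1 y hyt).2 _ hcon))

/-- Averaging over the blocks of a partition of `Ω` preserves sums over `Ω`. -/
lemma tsum_indicator_dyA (Ω : Set ℤ) (κ : ℤ → ℕ)
    (hκ : ∀ x ∈ Ω, ∀ y ∈ dyBlock (κ x) x, y ∈ Ω ∧ κ y = κ x) (h : ℤ → ℝ≥0∞) :
    ∑' x, Ω.indicator (fun x => dyA (κ x) h x) x = ∑' x, Ω.indicator h x := by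
  classical
  -- Lying in the same block of the partition is a symmetric relation, which allows the two
  -- summations to be exchanged.
  have hsymm : ∀ x y, (x ∈ Ω ∧ y ∈ dyBlock (κ x) x) ↔ (y ∈ Ω ∧ x ∈ dyBlock (κ y) y) := by
    have : ∀ x y, (x ∈ Ω ∧ y ∈ dyBlock (κ x) x) → (y ∈ Ω ∧ x ∈ dyBlock (κ y) y) := by
      rintro x y ⟨hx, hy⟩
      obtain ⟨h1, h2⟩ := hκ x hx y hy
      refine ⟨h1, ?_⟩
      rw [mem_dyBlock] at hy ⊢
      rw [h2, hy]
    exact fun x y => ⟨this x y, this y x⟩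
  calc ∑' x, Ω.indicator (fun x => dyA (κ x) h x) x
      = ∑' x, ∑' y, if x ∈ Ω ∧ y ∈ dyBlock (κ x) x then (2 ^ κ x)⁻¹ * h y else 0 := by
        refine tsum_congr fun x => ?_
        by_cases hx : x ∈ Ω
        · simp only [Set.indicator_of_mem hx, hx, true_and, dyA, Finset.mul_sum]
          rw [tsum_eq_sum (s := dyBlock (κ x) x) (fun y hy => by simp [hy])]
          exact Finset.sum_congr rfl fun y hy => by simp [hy]
        · simp [hx]
    _ = ∑' y, ∑' x, if x ∈ Ω ∧ y ∈ dyBlock (κ x) x then (2 ^ κ x)⁻¹ * h y else 0 :=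
        ENNReal.tsum_comm
    _ = ∑' y, Ω.indicator h y := by
        refine tsum_congr fun y => ?_
        by_cases hy : y ∈ Ω
        · simp only [hsymm _ y, hy, true_and, Set.indicator_of_mem hy]
          rw [tsum_eq_sum (s := dyBlock (κ y) y) (fun y hy => by simp [hy])]
          rw [Finset.sum_congr rfl (g := fun _ => (2 ^ κ y)⁻¹ * h y) fun x hx => by
            rw [if_pos hx, (hκ y hy x hx).2]]
          rw [Finset.sum_const, card_dyBlock, nsmul_eq_mul, ← mul_assoc]
          push_cast
          rw [two_pow_mul_inv, one_mul]
        · simp [hsymm _ y, hy]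

lemma tsum_mul_dyA (k : ℕ) (u v : ℤ → ℝ≥0∞) (hu : ∀ x y, y / 2 ^ k = x / 2 ^ k → u y = u x) :
    ∑' x, u x * v x = ∑' x, u x * dyA k v x := by
  have h := tsum_indicator_dyA Set.univ (fun _ => k) (by simp) (fun x => u x * v x)
  simp only [Set.indicator_univ] at h
  rw [← h]
  refine tsum_congr fun x => ?_
  rw [dyA, dyA, Finset.sum_congr rfl (g := fun y => u x * v y) fun y hy => by
    rw [hu x y (mem_dyBlock.1 hy)], ← Finset.mul_sum]
  ring

/-- The distribution function with respect to counting measure. -/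
noncomputable def distr (F : ℤ → ℝ≥0∞) (t : ℝ≥0∞) : ℝ≥0∞ := ∑' x, {x | t < F x}.indicator 1 x

lemma dyA_le_tsum (k : ℕ) (h : ℤ → ℝ≥0∞) (x : ℤ) : dyA k h x ≤ (2 ^ k)⁻¹ * ∑' y, h y := by
  unfold dyA
  gcongr
  exact ENNReal.sum_le_tsum _

lemma dyA_eventually_le {h : ℤ → ℝ≥0∞} (hh : ∑' y, h y ≠ ∞) {t : ℝ≥0∞} (ht : t ≠ 0) :
    ∃ K, ∀ x k, K ≤ k → dyA k h x ≤ t := by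
  have hlim : Tendsto (fun k : ℕ => (2⁻¹ : ℝ≥0∞) ^ k * ∑' y, h y) atTop (𝓝 (0 * ∑' y, h y)) :=
    ENNReal.Tendsto.mul_const
      (ENNReal.tendsto_pow_atTop_nhds_zero_of_lt_one (by norm_num)) (Or.inr hh)
  rw [zero_mul] at hlim
  obtain ⟨K, hK⟩ := eventually_atTop.1 (hlim.eventually (gt_mem_nhds (pos_iff_ne_zero.2 ht)))
  refine ⟨K, fun x k hk => (dyA_le_tsum k h x).trans ?_⟩
  rw [ENNReal.inv_pow]
  exact (hK k hk).le

/-- Weak type (1,1) with constant one: on each maximal block `t` is below the average, and averaging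
over the blocks preserves the sum. -/
lemma mul_distr_dyMax_le (h : ℤ → ℝ≥0∞) (t : ℝ≥0∞) : t * distr (dyMax h) t ≤ ∑' x, h x := by
  rcases eq_or_ne t 0 with rfl | ht
  · simp
  by_cases hh : ∑' y, h y = ∞
  · simp [hh]
  obtain ⟨K, hK⟩ := dyA_eventually_le hh ht
  obtain ⟨κ, hκ⟩ := exists_stopping h t fun x => ⟨K, hK x⟩
  calc t * distr (dyMax h) t = ∑' x, {x | t < dyMax h x}.indicator (fun _ => t) x := by
        rw [distr, ← ENNReal.tsum_mul_left]
        refine tsum_congr fun x => ?_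
        by_cases hx : t < dyMax h x <;> simp [hx]
    _ ≤ ∑' x, {x | t < dyMax h x}.indicator (fun x => dyA (κ x) h x) x := by
        refine ENNReal.tsum_le_tsum fun x => ?_
        by_cases hx : t < dyMax h x
        · simpa [hx] using (hκ x hx).1.le
        · simp [hx]
    _ = ∑' x, {x | t < dyMax h x}.indicator h x :=
        tsum_indicator_dyA _ κ (fun x hx => (hκ x hx).2.2) h
    _ ≤ _ := ENNReal.tsum_le_tsum fun x => Set.indicator_le_self' (fun _ _ => zero_le) x

/-- The part of `h` below `t` adds at most `t` to any average, so the weak type bound need only be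
applied to the part above `t`. This is the form suited to interpolation. -/
lemma mul_distr_dyMax_two_mul_le (h : ℤ → ℝ≥0∞) (t : ℝ≥0∞) :
    t * distr (dyMax h) (2 * t) ≤ ∑' x, {x | t < h x}.indicator h x := by
  refine le_trans (mul_le_mul_right (ENNReal.tsum_le_tsum fun x => ?_) _) (mul_distr_dyMax_le _ t)
  refine Set.indicator_le_indicator_of_subset (fun x hx => ?_) (fun _ => by simp) x
  obtain ⟨k, hk⟩ := lt_iSup_iff.1 (show 2 * t < dyMax h x from hx)
  refine lt_of_lt_of_le ?_ (le_dyMax k _ x)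
  have h1 : dyA k h x ≤ dyA k ({x | t < h x}.indicator h) x + t := by
    refine le_of_le_of_eq (b := dyA k (fun y => {x | t < h x}.indicator h y + t) x)
      (dyA_mono fun y _ => ?_) (by rw [dyA_add, dyA_const])
    by_cases hy : t < h y
    · simp [hy]
    · simpa [hy] using not_lt.1 hy
  rw [two_mul] at hk
  exact lt_of_add_lt_add_right (hk.trans_le h1)

/-! #### Layer cake formulas -/

lemma lintegral_layer_of_ne_top {p : ℝ} (hp : 0 < p) {a : ℝ≥0∞} (ha : a ≠ ∞) :
    ∫⁻ t in Set.Ioi (0 : ℝ), ENNReal.ofReal (p * t ^ (p - 1)) *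
      (if ENNReal.ofReal t < a then 1 else 0) = a ^ p := by
  lift a to ℝ≥0 using ha
  -- A single number is treated as a constant function on a one-point probability space.
  have h := lintegral_rpow_eq_lintegral_meas_lt_mul (Measure.dirac ()) (f := fun _ => (a : ℝ))
    (Filter.Eventually.of_forall fun _ => a.2) measurable_const.aemeasurable hp
  rw [lintegral_dirac, ← ENNReal.ofReal_rpow_of_nonneg (NNReal.coe_nonneg a) hp.le, ENNReal.ofReal_coe_nnreal] at h
  rw [h, ← lintegral_const_mul' _ _ (by simp)]
  refine setLIntegral_congr_fun measurableSet_Ioi fun t ht => ?_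
  have ht' : (0 : ℝ) < t := ht
  rw [ENNReal.ofReal_mul hp.le, mul_assoc]
  congr 1
  have : ENNReal.ofReal t < a ↔ t < a := by
    rw [← ENNReal.ofReal_coe_nnreal, ENNReal.ofReal_lt_ofReal_iff_of_nonneg ht'.le]
  by_cases hta : t < a <;> simp [this, hta]

lemma lintegral_layer {p : ℝ} (hp : 0 < p) (a : ℝ≥0∞) :
    ∫⁻ t in Set.Ioi (0 : ℝ), ENNReal.ofReal (p * t ^ (p - 1)) *
      (if ENNReal.ofReal t < a then 1 else 0) = a ^ p := by
  rcases eq_or_ne a ∞ with rfl | ha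
  · rw [ENNReal.top_rpow_of_pos hp]
    refine ENNReal.eq_top_of_forall_nnreal_le fun r => ?_
    have h := lintegral_layer_of_ne_top hp (a := (r : ℝ≥0∞) ^ p⁻¹) (by simp [hp.le])
    rw [← ENNReal.rpow_mul, inv_mul_cancel₀ hp.ne', ENNReal.rpow_one] at h
    rw [← h]
    gcongr with t
    split_ifs <;> simp_all
  · exact lintegral_layer_of_ne_top hp ha

lemma measurable_layer (p : ℝ) (a : ℝ≥0∞) : Measurable fun t : ℝ =>
    ENNReal.ofReal (p * t ^ (p - 1)) * (if ENNReal.ofReal t < a then 1 else 0) := by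
  refine Measurable.mul (by fun_prop) (Measurable.ite ?_ measurable_const measurable_const)
  exact measurableSet_lt (by fun_prop) measurable_const

lemma tsum_rpow_eq_lintegral {p : ℝ} (hp : 0 < p) (F : ℤ → ℝ≥0∞) :
    ∑' x, F x ^ p = ∫⁻ t in Set.Ioi (0 : ℝ), ENNReal.ofReal (p * t ^ (p - 1)) *
      distr F (ENNReal.ofReal t) := by
  simp_rw [← lintegral_layer hp (F _)]
  rw [← lintegral_tsum fun x => (measurable_layer p (F x)).aemeasurable]
  refine lintegral_congr fun t => ?_
  rw [ENNReal.tsum_mul_left, distr]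
  simp [Set.indicator_apply]

lemma distr_mul_of_le {c : ℝ≥0} (hc : c ≠ 0) (F : ℤ → ℝ≥0∞) (t : ℝ≥0∞) :
    distr (fun x => (c : ℝ≥0∞) * F x) (c * t) = distr F t := by
  unfold distr
  refine tsum_congr fun x => ?_
  have : c * t < c * F x ↔ t < F x :=
    ENNReal.mul_lt_mul_iff_right (by simpa using hc) (by simp)
  simp [Set.indicator_apply, this]

/-- The layer cake formula after rescaling the level by a constant. -/
lemma tsum_rpow_eq_lintegral_mul {p : ℝ} (hp : 0 < p) {c : ℝ≥0} (hc : c ≠ 0) (F : ℤ → ℝ≥0∞) :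
    ∑' x, F x ^ p = (c : ℝ≥0∞) ^ p * ∫⁻ t in Set.Ioi (0 : ℝ), ENNReal.ofReal (p * t ^ (p - 1)) *
      distr F (c * ENNReal.ofReal t) := by
  have hc' : (c : ℝ≥0∞) ≠ 0 := by simpa using hc
  have h := tsum_rpow_eq_lintegral hp (fun x => ((c⁻¹ : ℝ≥0) : ℝ≥0∞) * F x)
  have h2 : ∀ t, distr (fun x => ((c⁻¹ : ℝ≥0) : ℝ≥0∞) * F x) t = distr F (c * t) := fun t => by
    conv_lhs => rw [show t = ((c⁻¹ : ℝ≥0) : ℝ≥0∞) * (c * t) by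
      rw [← mul_assoc, ← ENNReal.coe_mul, inv_mul_cancel₀ hc, ENNReal.coe_one, one_mul]]
    exact distr_mul_of_le (inv_ne_zero hc) F _
  simp_rw [h2] at h
  rw [← h, ← ENNReal.tsum_mul_left]
  refine tsum_congr fun x => ?_
  rw [← ENNReal.mul_rpow_of_nonneg _ _ hp.le, ← mul_assoc, ← ENNReal.coe_mul, mul_inv_cancel₀ hc,
    ENNReal.coe_one, one_mul]

/-- The integral form of the inequality behind the strong type estimates above the diagonal. -/
lemma lintegral_layer_inv_mul {p : ℝ} (hp : 1 < p) (h : ℤ → ℝ≥0∞) :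
    ∫⁻ t in Set.Ioi (0 : ℝ), ENNReal.ofReal (p * t ^ (p - 1)) *
      ((ENNReal.ofReal t)⁻¹ * ∑' x, {x | ENNReal.ofReal t < h x}.indicator h x) =
      ENNReal.ofReal (p / (p - 1)) * ∑' x, h x ^ p := by
  have hp' : 0 < p - 1 := by linarith
  calc _ = ∫⁻ t in Set.Ioi (0 : ℝ), ∑' x, ENNReal.ofReal (p / (p - 1)) * (h x *
        (ENNReal.ofReal ((p - 1) * t ^ (p - 1 - 1)) * (if ENNReal.ofReal t < h x then 1 else 0))) := by
        refine setLIntegral_congr_fun measurableSet_Ioi fun t ht => ?_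
        have ht' : (0 : ℝ) < t := ht
        rw [← ENNReal.ofReal_inv_of_pos ht', ← mul_assoc, ← ENNReal.ofReal_mul (by positivity),
          ← ENNReal.tsum_mul_left]
        refine tsum_congr fun x => ?_
        -- Dividing by `t` leaves the layer cake density of exponent `p - 1`, which is positive.
        have h1 : p * t ^ (p - 1) * t⁻¹ = p / (p - 1) * ((p - 1) * t ^ (p - 1 - 1)) := by
          rw [Real.rpow_sub_one ht'.ne' (p - 1)]
          field_simp
        rw [h1, ENNReal.ofReal_mul (by positivity), Set.indicator_apply]
        simp only [Set.mem_ofPred_eq]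
        split_ifs <;> ring
    _ = ∑' x, ENNReal.ofReal (p / (p - 1)) * (h x * h x ^ (p - 1)) := by
        rw [lintegral_tsum fun x =>
          (((measurable_layer (p - 1) (h x)).const_mul _).const_mul _).aemeasurable]
        refine tsum_congr fun x => ?_
        rw [lintegral_const_mul _ ((measurable_layer (p - 1) (h x)).const_mul _),
          lintegral_const_mul _ (measurable_layer (p - 1) (h x)), lintegral_layer hp']
    _ = _ := by
        rw [ENNReal.tsum_mul_left]
        congr 1
        refine tsum_congr fun x => ?_
        nth_rewrite 1 [← ENNReal.rpow_one (h x)]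
        rw [← ENNReal.rpow_add_of_nonneg _ _ zero_le_one hp'.le]
        congr 1; ring

/-- The strong type inequality for the dyadic maximal function. -/
lemma tsum_dyMax_rpow_le {p : ℝ} (hp : 1 < p) (h : ℤ → ℝ≥0∞) :
    ∑' x, dyMax h x ^ p ≤ 2 ^ p * ENNReal.ofReal (p / (p - 1)) * ∑' x, h x ^ p := by
  rw [tsum_rpow_eq_lintegral_mul (by linarith) (two_ne_zero : (2 : ℝ≥0) ≠ 0), mul_assoc,
    ← lintegral_layer_inv_mul hp]
  push_cast
  refine mul_le_mul_right (setLIntegral_mono_ae' measurableSet_Ioi (ae_of_all _ fun t ht => ?_)) _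
  have ht' : (0 : ℝ) < t := ht
  gcongr
  rw [← ENNReal.div_eq_inv_mul]
  refine (ENNReal.le_div_iff_mul_le (Or.inl (by simpa using ht')) (Or.inl (by simp))).2 ?_
  rw [mul_comm]
  exact mul_distr_dyMax_two_mul_le h _

lemma tsum_dyMax_sq_le (h : ℤ → ℝ≥0∞) : ∑' x, dyMax h x ^ 2 ≤ 8 * ∑' x, h x ^ 2 := by
  have h1 := tsum_dyMax_rpow_le (p := 2) (by norm_num) h
  have h2 : (2 : ℝ≥0∞) ^ (2 : ℝ) * ENNReal.ofReal (2 / (2 - 1)) = 8 := by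
    rw [ENNReal.rpow_two, show (2 : ℝ) / (2 - 1) = 2 by norm_num, ENNReal.ofReal_ofNat]
    norm_num
  rw [h2] at h1
  simpa only [ENNReal.rpow_two] using h1

/-! ### Variation of dyadic martingales -/

/-- Running maximum of the norms. -/
noncomputable def runMax (M : ℕ → ℂ) : ℕ → ℝ
  | 0 => ‖M 0‖
  | i + 1 => max (runMax M i) ‖M (i + 1)‖

/-- The last value of `M` that differs from the preceding anchor by at least `θ` times the running
maximum. -/
noncomputable def anchor (θ : ℝ) (M : ℕ → ℂ) : ℕ → ℂ
  | 0 => M 0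
  | i + 1 => if θ * runMax M (i + 1) ≤ ‖M (i + 1) - anchor θ M i‖ then M (i + 1) else anchor θ M i

lemma norm_le_runMax (M : ℕ → ℂ) (i : ℕ) : ‖M i‖ ≤ runMax M i := by
  cases i with
  | zero => exact le_rfl
  | succ i => exact le_max_right _ _

lemma runMax_nonneg (M : ℕ → ℂ) (i : ℕ) : 0 ≤ runMax M i :=
  (norm_nonneg _).trans (norm_le_runMax M i)

lemma runMax_mono (M : ℕ → ℂ) : Monotone (runMax M) :=
  monotone_nat_of_le_succ fun _ => le_max_left _ _

lemma runMax_congr {M M' : ℕ → ℂ} {i : ℕ} (h : ∀ l ≤ i, M l = M' l) : runMax M i = runMax M' i := by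
  induction i with
  | zero => simp [runMax, h 0]
  | succ i ih => rw [runMax, runMax, ih fun l hl => h l (by omega), h _ le_rfl]

/-- Anchors are adapted: only the past enters. This is what allows them as the function `c` in
`tsum_dyE_sub_sq`. -/
lemma anchor_congr (θ : ℝ) {M M' : ℕ → ℂ} {i : ℕ} (h : ∀ l ≤ i, M l = M' l) :
    anchor θ M i = anchor θ M' i := by
  induction i with
  | zero => simp [anchor, h 0]
  | succ i ih =>
    rw [anchor, anchor, ih fun l hl => h l (by omega), h _ le_rfl, runMax_congr h]

lemma norm_sub_anchor_le {θ : ℝ} (hθ : 0 ≤ θ) (M : ℕ → ℂ) (i : ℕ) :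
    ‖M i - anchor θ M i‖ ≤ θ * runMax M i := by
  cases i with
  | zero => simpa [anchor] using mul_nonneg hθ (runMax_nonneg M 0)
  | succ i =>
    rw [anchor]
    split_ifs with h
    · simpa using mul_nonneg hθ (runMax_nonneg M (i + 1))
    · exact (not_le.1 h).le

lemma le_norm_anchor_sub (θ : ℝ) (M : ℕ → ℂ) (i : ℕ) (h : anchor θ M (i + 1) ≠ anchor θ M i) :
    θ * runMax M (i + 1) ≤ ‖anchor θ M (i + 1) - anchor θ M i‖ := by
  rw [anchor] at h ⊢
  split_ifs at h ⊢ with h1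
  · exact h1
  · exact absurd rfl h

/-- Either the anchor moves onto the new value and the second term vanishes, or it stays and the
first one does. -/
lemma enorm_anchor_step_sq (θ : ℝ) (M : ℕ → ℂ) (i : ℕ) :
    ‖anchor θ M (i + 1) - anchor θ M i‖ₑ ^ 2 + ‖M (i + 1) - anchor θ M (i + 1)‖ₑ ^ 2 =
      ‖M (i + 1) - anchor θ M i‖ₑ ^ 2 := by
  rw [anchor]
  split_ifs with h <;> simp

/-- The pathwise weights controlling the variation. -/
noncomputable def jumpWeight (δ : ℝ) (M : ℕ → ℂ) (k : ℕ) : ℝ≥0∞ :=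
  ENNReal.ofReal (runMax M (k + 1) ^ 2 - runMax M k ^ 2) +
    ∑' m : ℕ, ENNReal.ofReal (((1 / 2 : ℝ) ^ m) ^ δ) *
      ‖anchor ((1 / 2) ^ m) M (k + 1) - anchor ((1 / 2) ^ m) M k‖ₑ ^ 2

lemma sum_ofReal_runMax_sq (M : ℕ → ℂ) {s t : ℕ} (hst : s ≤ t) :
    ∑ k ∈ Finset.Ico s t, ENNReal.ofReal (runMax M (k + 1) ^ 2 - runMax M k ^ 2) =
      ENNReal.ofReal (runMax M t ^ 2 - runMax M s ^ 2) := by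
  rw [← ENNReal.ofReal_sum_of_nonneg]
  · rw [Finset.sum_Ico_sub (fun k => runMax M k ^ 2) hst]
  · intro k _
    have := pow_le_pow_left₀ (runMax_nonneg M k) (runMax_mono M (Nat.le_succ k)) 2
    simpa using this

/-- Pathwise heart of Lépingle's inequality. If the running maximum more than doubles between `s`
and `t`, its squared increment pays for the difference. Otherwise the anchor whose threshold matches
the relative size of the difference must jump in between, by a comparable amount. The right side is
additive over disjoint intervals, so it can be summed along any subsequence. -/
lemma enorm_sub_rpow_le_jumpWeight {ρ : ℝ} (hρ : 2 < ρ) (M : ℕ → ℂ) {s t : ℕ} (hst : s ≤ t) :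
    ‖M t - M s‖ₑ ^ ρ ≤ ENNReal.ofReal (64 * 4 ^ (ρ - 2)) * ENNReal.ofReal (runMax M t ^ (ρ - 2)) *
      ∑ k ∈ Finset.Ico s t, jumpWeight (ρ - 2) M k := by
  set δ := ρ - 2 with hδ
  have hδ0 : 0 < δ := by linarith
  have hRs := runMax_nonneg M s
  have hRt := runMax_nonneg M t
  have hRst : runMax M s ≤ runMax M t := runMax_mono M hst
  set D := ‖M t - M s‖ with hD
  have hD2 : D ≤ 2 * runMax M t := by
    have h1 := norm_sub_le (M t) (M s)
    have h2 := norm_le_runMax M t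
    have h3 := norm_le_runMax M s
    linarith
  have hsplit : ∀ B : ℝ, D ≤ B → D ^ ρ ≤ B ^ δ * D ^ 2 := by
    intro B hB
    rcases (norm_nonneg (M t - M s)).eq_or_lt with h0 | h0
    · rw [hD, ← h0, Real.zero_rpow (by linarith)]; simp
    · rw [show ρ = δ + 2 by rw [hδ]; ring, Real.rpow_add h0, Real.rpow_two]
      gcongr
  have hlhs : ‖M t - M s‖ₑ ^ ρ = ENNReal.ofReal (D ^ ρ) := by
    rw [← ofReal_norm, ENNReal.ofReal_rpow_of_nonneg (norm_nonneg _) (by linarith)]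
  rw [hlhs]
  rcases lt_or_ge (2 * runMax M s) (runMax M t) with hcase | hcase
  · calc ENNReal.ofReal (D ^ ρ)
        ≤ ENNReal.ofReal (64 * 4 ^ δ * runMax M t ^ δ * (runMax M t ^ 2 - runMax M s ^ 2)) := by
          apply ENNReal.ofReal_le_ofReal
          calc D ^ ρ ≤ (4 * runMax M t) ^ δ * D ^ 2 := hsplit _ (by linarith)
            _ = 4 ^ δ * runMax M t ^ δ * D ^ 2 := by rw [Real.mul_rpow (by norm_num) hRt]
            _ ≤ 4 ^ δ * runMax M t ^ δ * (64 * (runMax M t ^ 2 - runMax M s ^ 2)) := by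
                gcongr
                nlinarith [norm_nonneg (M t - M s)]
            _ = _ := by ring
      _ = ENNReal.ofReal (64 * 4 ^ δ) * ENNReal.ofReal (runMax M t ^ δ) *
            ENNReal.ofReal (runMax M t ^ 2 - runMax M s ^ 2) := by
          rw [ENNReal.ofReal_mul (by positivity), ENNReal.ofReal_mul (by positivity)]
      _ ≤ _ := by
          rw [← sum_ofReal_runMax_sq M hst]
          gcongr
          exact le_self_add
  · rcases (norm_nonneg (M t - M s)).eq_or_lt with h0 | h0
    · rw [hD, ← h0, Real.zero_rpow (by linarith)]; simp
    have hRt0 : 0 < runMax M t := by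
      change 0 < D at h0
      linarith
    -- The choice gives 2θR < D ≤ 4θR with R the running maximum at `t`. The lower bound forces the
    -- anchor to move, since both values lie within θR of their anchors; the upper bound produces
    -- the factor θ^(ρ-2).
    obtain ⟨m, hm1, hm2⟩ := exists_nat_pow_near_of_lt_one (x := D / (4 * runMax M t))
      (y := (1 / 2 : ℝ)) (by positivity) (by rw [div_le_one (by positivity)]; linarith)
      (by norm_num) (by norm_num)
    set θ : ℝ := (1 / 2) ^ m with hθ
    have hθ0 : 0 < θ := by positivity
    rw [pow_succ, ← hθ, lt_div_iff₀ (by positivity)] at hm1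
    rw [div_le_iff₀ (by positivity)] at hm2
    have hne : anchor θ M s ≠ anchor θ M t := by
      intro heq
      have h1 := norm_sub_anchor_le hθ0.le M s
      have h2 := norm_sub_anchor_le hθ0.le M t
      rw [heq] at h1
      have h3 : D ≤ ‖M t - anchor θ M t‖ + ‖M s - anchor θ M t‖ := by
        rw [hD, ← sub_sub_sub_cancel_right _ _ (anchor θ M t)]
        exact norm_sub_le _ _
      nlinarith
    obtain ⟨k, hk, hkne⟩ : ∃ k ∈ Finset.Ico s t, anchor θ M (k + 1) ≠ anchor θ M k := by
      by_contra hcon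
      push Not at hcon
      apply hne
      have : ∀ j, s ≤ j → j ≤ t → anchor θ M j = anchor θ M s := by
        intro j hj
        induction j, hj using Nat.le_induction with
        | base => simp
        | succ j hj ih =>
          intro hjt
          rw [hcon j (Finset.mem_Ico.2 ⟨hj, hjt⟩), ih (by omega)]
      exact (this t hst le_rfl).symm
    have hjump := le_norm_anchor_sub θ M k hkne
    have hRk : runMax M s ≤ runMax M (k + 1) := runMax_mono M (by
      have := (Finset.mem_Ico.1 hk).1; omega)
    -- The jump is at least θ times the running maximum at `s`, which is at least half the one at
    -- `t` in this case.
    have hDle : D ≤ 8 * ‖anchor θ M (k + 1) - anchor θ M k‖ := by nlinarith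
    calc ENNReal.ofReal (D ^ ρ)
        ≤ ENNReal.ofReal (64 * 4 ^ δ * runMax M t ^ δ *
            (θ ^ δ * ‖anchor θ M (k + 1) - anchor θ M k‖ ^ 2)) := by
          apply ENNReal.ofReal_le_ofReal
          calc D ^ ρ ≤ (θ * (4 * runMax M t)) ^ δ * D ^ 2 := hsplit _ hm2
            _ = θ ^ δ * (4 ^ δ * runMax M t ^ δ) * D ^ 2 := by
                rw [Real.mul_rpow hθ0.le (by positivity), Real.mul_rpow (by norm_num) hRt]
            _ ≤ θ ^ δ * (4 ^ δ * runMax M t ^ δ) *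
                  (8 * ‖anchor θ M (k + 1) - anchor θ M k‖) ^ 2 := by gcongr
            _ = _ := by ring
      _ = ENNReal.ofReal (64 * 4 ^ δ) * ENNReal.ofReal (runMax M t ^ δ) *
            (ENNReal.ofReal (θ ^ δ) * ‖anchor θ M (k + 1) - anchor θ M k‖ₑ ^ 2) := by
          rw [ENNReal.ofReal_mul (p := 64 * 4 ^ δ * runMax M t ^ δ) (by positivity),
            ENNReal.ofReal_mul (p := 64 * 4 ^ δ) (by positivity),
            ENNReal.ofReal_mul (p := θ ^ δ) (by positivity), ENNReal.ofReal_pow (norm_nonneg _),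
            ofReal_norm]
      _ ≤ ENNReal.ofReal (64 * 4 ^ δ) * ENNReal.ofReal (runMax M t ^ δ) * jumpWeight δ M k := by
          gcongr
          exact le_add_of_nonneg_of_le zero_le (ENNReal.le_tsum (f := fun m : ℕ =>
            ENNReal.ofReal (((1 / 2 : ℝ) ^ m) ^ δ) *
            ‖anchor ((1 / 2) ^ m) M (k + 1) - anchor ((1 / 2) ^ m) M k‖ₑ ^ 2) m)
      _ ≤ _ := by
          gcongr
          exact Finset.single_le_sum (f := fun k => jumpWeight δ M k) (fun _ _ => zero_le) hk

/-- With W the bracket on the right, the increments sum to at most a constant times W^((ρ-2)/2) · W,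
whose power 2/ρ is linear in W. The map `g` is antitone because martingale time runs from coarse to
fine while the radius grows. -/
lemma seqVariation_sq_le_jumps {ρ : ℝ} (hρ : 2 < ρ) : ∃ C : ℝ≥0, ∀ (M : ℕ → ℂ) (J : ℕ)
    (g : ℕ → ℕ), Antitone g → (∀ L, g L ≤ J) →
    seqVariation ρ (fun L => M (g L)) ^ 2 ≤ C * (2 * ENNReal.ofReal (runMax M J) ^ 2 +
      ∑' m : ℕ, ENNReal.ofReal (((1 / 2 : ℝ) ^ m) ^ (ρ - 2)) * ∑ k ∈ Finset.range J,
        ‖anchor ((1 / 2) ^ m) M (k + 1) - anchor ((1 / 2) ^ m) M k‖ₑ ^ 2) := by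
  refine ⟨(64 * (4 : ℝ) ^ (ρ - 2)).toNNReal ^ (2 / ρ), fun M J g hg hgJ => ?_⟩
  have hδ0 : 0 < ρ - 2 := by linarith
  set K : ℝ≥0∞ := ENNReal.ofReal (64 * 4 ^ (ρ - 2)) with hK
  set W : ℝ≥0∞ := 2 * ENNReal.ofReal (runMax M J) ^ 2 +
      ∑' m : ℕ, ENNReal.ofReal (((1 / 2 : ℝ) ^ m) ^ (ρ - 2)) * ∑ k ∈ Finset.range J,
        ‖anchor ((1 / 2) ^ m) M (k + 1) - anchor ((1 / 2) ^ m) M k‖ₑ ^ 2 with hW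
  have hR : ENNReal.ofReal (runMax M J) ^ 2 ≤ W := by
    rw [hW, two_mul, add_assoc]; exact le_self_add
  have hsumW : ∑ k ∈ Finset.range J, jumpWeight (ρ - 2) M k ≤ W := by
    unfold jumpWeight
    rw [Finset.sum_add_distrib, hW, ← Summable.tsum_finsetSum fun _ _ => ENNReal.summable]
    simp_rw [Finset.mul_sum]
    gcongr
    rw [Finset.range_eq_Ico, sum_ofReal_runMax_sq M (Nat.zero_le J),
      ← ENNReal.ofReal_pow (runMax_nonneg M J)]
    refine (ENNReal.ofReal_le_ofReal (sub_le_self _ (by positivity))).trans ?_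
    rw [two_mul]; exact le_self_add
  have hRW : ENNReal.ofReal (runMax M J ^ (ρ - 2)) ≤ W ^ ((ρ - 2) / 2) := by
    calc ENNReal.ofReal (runMax M J ^ (ρ - 2))
        = (ENNReal.ofReal (runMax M J) ^ 2) ^ ((ρ - 2) / 2) := by
          rw [← ENNReal.ofReal_rpow_of_nonneg (runMax_nonneg M J) hδ0.le, ← ENNReal.rpow_natCast,
            ← ENNReal.rpow_mul]
          congr 1; push_cast; ring
      _ ≤ _ := by gcongr
  have hmain : seqVariation ρ (fun L => M (g L)) ≤ (K * W ^ (ρ / 2)) ^ (1 / ρ) := by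
    refine seqVariation_le_of_tsum_le (by linarith) fun n hn => ?_
    rw [← ENNReal.rpow_mul, one_div_mul_cancel (by linarith), ENNReal.rpow_one,
      ENNReal.tsum_eq_iSup_nat]
    refine iSup_le fun N => ?_
    have hgn : ∀ {i j}, i ≤ j → g (n j) ≤ g (n i) := fun h => hg (hn.monotone h)
    calc ∑ i ∈ Finset.range N, ‖M (g (n i)) - M (g (n (i + 1)))‖ₑ ^ ρ
        ≤ ∑ i ∈ Finset.range N, K * W ^ ((ρ - 2) / 2) *
            ∑ k ∈ Finset.Ico (g (n (i + 1))) (g (n i)), jumpWeight (ρ - 2) M k := by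
          refine Finset.sum_le_sum fun i _ => ?_
          refine (enorm_sub_rpow_le_jumpWeight hρ M (hgn (Nat.le_succ i))).trans ?_
          gcongr
          refine le_trans (ENNReal.ofReal_le_ofReal ?_) hRW
          exact Real.rpow_le_rpow (runMax_nonneg _ _) (runMax_mono M (hgJ _)) hδ0.le
      _ = K * W ^ ((ρ - 2) / 2) * ∑ k ∈ Finset.Ico (g (n N)) (g (n 0)), jumpWeight (ρ - 2) M k := by
          rw [← Finset.mul_sum]
          congr 1
          clear_value W K
          induction N with
          | zero => simp
          | succ N ih =>
            rw [Finset.sum_range_succ, ih, add_comm,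
              Finset.sum_Ico_consecutive _ (hgn (Nat.le_succ N)) (hgn (Nat.zero_le N))]
      _ ≤ K * W ^ ((ρ - 2) / 2) * W := by
          gcongr
          refine le_trans (Finset.sum_le_sum_of_subset fun k hk => ?_) hsumW
          have h1 := (Finset.mem_Ico.1 hk).2
          have h2 := hgJ (n 0)
          exact Finset.mem_range.2 (by omega)
      _ = K * W ^ (ρ / 2) := by
          rw [mul_assoc]
          congr 1
          nth_rewrite 2 [← ENNReal.rpow_one W]
          rw [← ENNReal.rpow_add_of_nonneg _ _ (by linarith) zero_le_one]
          congr 1; ring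
  calc seqVariation ρ (fun L => M (g L)) ^ 2 ≤ ((K * W ^ (ρ / 2)) ^ (1 / ρ)) ^ 2 := by gcongr
    _ = K ^ (2 / ρ) * W := by
        rw [← ENNReal.rpow_natCast, ← ENNReal.rpow_mul, ENNReal.mul_rpow_of_nonneg _ _ (by positivity),
          ← ENNReal.rpow_mul]
        have h1 : 1 / ρ * ((2 : ℕ) : ℝ) = 2 / ρ := by push_cast; ring
        have h2 : ρ / 2 * (2 / ρ) = 1 := by field_simp
        rw [h1, h2, ENNReal.rpow_one]
    _ = _ := by
        rw [ENNReal.coe_rpow_of_nonneg _ (by positivity)]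
        rfl

/-- The squared jumps together with the squared distance to the current anchor grow, at each step,
exactly by the squared martingale difference: Pythagoras is applied around the old anchor. Hence the
bound is uniform in `θ`. -/
lemma sum_tsum_anchor_sq_le (θ : ℝ) (φ : ℤ → ℂ) (J : ℕ) :
    ∑' x, ∑ k ∈ Finset.range J, ‖anchor θ (fun i => dyE (J - i) φ x) (k + 1) -
      anchor θ (fun i => dyE (J - i) φ x) k‖ₑ ^ 2 ≤ ∑' x, ‖φ x‖ₑ ^ 2 := by
  set c : ℤ → ℕ → ℂ := fun x => anchor θ (fun i => dyE (J - i) φ x) with hc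
  have key : ∀ i ≤ J, ∑' x, (∑ k ∈ Finset.range i, ‖c x (k + 1) - c x k‖ₑ ^ 2 +
      ‖dyE (J - i) φ x - c x i‖ₑ ^ 2) =
      ∑ k ∈ Finset.range i, ∑' x, ‖dyE (J - (k + 1)) φ x - dyE (J - k) φ x‖ₑ ^ 2 := by
    intro i
    induction i with
    | zero => simp [hc, anchor]
    | succ i ih =>
      intro hi
      have hlev : J - (i + 1) + 1 = J - i := by omega
      -- Siblings at level J - (i + 1) share all coarser averages, hence the whole past of the
      -- martingale.
      have hinv : ∀ x, c (dySwap (J - (i + 1)) x) i = c x i := by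
        intro x
        refine anchor_congr θ fun l hl => dyE_congr ?_ φ
        exact ediv_two_pow_congr (by omega) (dySwap_ediv_succ (J - (i + 1)) x)
      have hpyth := tsum_dyE_sub_sq (J - (i + 1)) φ (fun x => c x i) hinv
      rw [hlev] at hpyth
      rw [Finset.sum_range_succ, ← ih (by omega), ENNReal.tsum_add (g := fun x => ‖dyE (J - i) φ x - c x i‖ₑ ^ 2),
        add_assoc, ← hpyth, ← ENNReal.tsum_add]
      refine tsum_congr fun x => ?_
      rw [Finset.sum_range_succ, add_assoc]
      congr 1
      exact enorm_anchor_step_sq θ (fun i => dyE (J - i) φ x) i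
  calc _ ≤ ∑' x, (∑ k ∈ Finset.range J, ‖c x (k + 1) - c x k‖ₑ ^ 2 +
      ‖dyE (J - J) φ x - c x J‖ₑ ^ 2) := ENNReal.tsum_le_tsum fun x => le_self_add
    _ = _ := key J le_rfl
    _ = ∑ k ∈ Finset.range J, ∑' x, ‖dyE k φ x - dyE (k + 1) φ x‖ₑ ^ 2 := by
        rw [← Finset.sum_range_reflect]
        refine Finset.sum_congr rfl fun k hk => ?_
        have := Finset.mem_range.1 hk
        rw [show J - (J - 1 - k + 1) = k by omega, show J - (J - 1 - k) = k + 1 by omega]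
    _ ≤ _ := by
        rw [← sum_tsum_dyE_sub_sq φ J]
        exact le_self_add

lemma ofReal_runMax_le (φ : ℤ → ℂ) (J i : ℕ) (x : ℤ) :
    ENNReal.ofReal (runMax (fun i => dyE (J - i) φ x) i) ≤ dyMax (fun y => ‖φ y‖ₑ) x := by
  have h : ∀ k, ENNReal.ofReal ‖dyE k φ x‖ ≤ dyMax (fun y => ‖φ y‖ₑ) x := fun k => by
    rw [ofReal_norm]
    exact (enorm_dyE_le k φ x).trans (le_dyMax k _ x)
  induction i with
  | zero => exact h _
  | succ i ih =>
    rw [runMax, ENNReal.ofReal_max]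
    exact max_le ih (h _)

/-- Lépingle's inequality in `ℓ²` for the dyadic martingale on the integers. -/
lemma tsum_seqVariation_dyE_sq_le {ρ : ℝ} (hρ : 2 < ρ) : ∃ C : ℝ≥0, ∀ (φ : ℤ → ℂ) (J : ℕ)
    (κ : ℕ → ℕ), Monotone κ → (∀ L, κ L ≤ J) →
    ∑' x, seqVariation ρ (fun L => dyE (κ L) φ x) ^ 2 ≤ C * ∑' x, ‖φ x‖ₑ ^ 2 := by
  obtain ⟨C, hC⟩ := seqVariation_sq_le_jumps hρ
  have hδ0 : 0 < ρ - 2 := by linarith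
  -- The weight of the threshold 2^(-m) is `q ^ m`; the series converges because ρ > 2.
  set q : ℝ≥0∞ := ENNReal.ofReal ((1 / 2 : ℝ) ^ (ρ - 2)) with hq
  have hq1 : q < 1 := by
    rw [hq, ENNReal.ofReal_lt_one]
    exact Real.rpow_lt_one (by norm_num) (by norm_num) hδ0
  have hqm : ∀ m : ℕ, ENNReal.ofReal (((1 / 2 : ℝ) ^ m) ^ (ρ - 2)) = q ^ m := fun m => by
    rw [hq, ← ENNReal.ofReal_pow (by positivity), ← Real.rpow_natCast, ← Real.rpow_natCast,
      ← Real.rpow_mul (by norm_num), ← Real.rpow_mul (by norm_num), mul_comm]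
  have hS : (1 - q)⁻¹ ≠ ∞ := ENNReal.inv_ne_top.2 (tsub_pos_of_lt hq1).ne'
  refine ⟨C * (2 * 8 + (1 - q)⁻¹.toNNReal), fun φ J κ hκ hκJ => ?_⟩
  set T := ∑' x, ‖φ x‖ₑ ^ 2 with hT
  calc ∑' x, seqVariation ρ (fun L => dyE (κ L) φ x) ^ 2
      = ∑' x, seqVariation ρ (fun L => (fun i => dyE (J - i) φ x) (J - κ L)) ^ 2 := by
        refine tsum_congr fun x => ?_
        congr 3 with L
        have := hκJ L
        dsimp only
        rw [show J - (J - κ L) = κ L by omega]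
    _ ≤ ∑' x, C * (2 * dyMax (fun y => ‖φ y‖ₑ) x ^ 2 + ∑' m : ℕ, q ^ m *
          ∑ k ∈ Finset.range J, ‖anchor ((1 / 2) ^ m) (fun i => dyE (J - i) φ x) (k + 1) -
            anchor ((1 / 2) ^ m) (fun i => dyE (J - i) φ x) k‖ₑ ^ 2) := by
        refine ENNReal.tsum_le_tsum fun x => ?_
        refine (hC (fun i => dyE (J - i) φ x) J (fun L => J - κ L)
          (fun i j h => Nat.sub_le_sub_left (hκ h) J) (fun L => Nat.sub_le _ _)).trans ?_
        simp_rw [hqm]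
        gcongr
        exact ofReal_runMax_le φ J J x
    _ = C * (2 * ∑' x, dyMax (fun y => ‖φ y‖ₑ) x ^ 2 + ∑' m : ℕ, q ^ m * ∑' x,
          ∑ k ∈ Finset.range J, ‖anchor ((1 / 2) ^ m) (fun i => dyE (J - i) φ x) (k + 1) -
            anchor ((1 / 2) ^ m) (fun i => dyE (J - i) φ x) k‖ₑ ^ 2) := by
        rw [ENNReal.tsum_mul_left, ENNReal.tsum_add, ENNReal.tsum_mul_left, ENNReal.tsum_comm]
        simp_rw [ENNReal.tsum_mul_left]
    _ ≤ C * (2 * (8 * T) + ∑' m : ℕ, q ^ m * T) := by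
        gcongr with m
        · exact tsum_dyMax_sq_le _
        · exact sum_tsum_anchor_sq_le _ φ J
    _ = _ := by
        rw [ENNReal.tsum_mul_right, ENNReal.tsum_geometric]
        push_cast
        rw [ENNReal.coe_toNNReal hS]
        ring

/-! ### Averages over symmetric windows of integers -/

/-- The average of `φ` over the window of radius `L` centred at `x`. -/
noncomputable def zAvg (L : ℕ) (φ : ℤ → ℂ) (x : ℤ) : ℂ :=
  (2 * (L : ℂ) + 1)⁻¹ * ∑ y ∈ Finset.Icc (x - L) (x + L), φ y

lemma zAvg_sum {ι : Type*} (s : Finset ι) (L : ℕ) (φ : ι → ℤ → ℂ) (x : ℤ) :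
    zAvg L (fun y => ∑ i ∈ s, φ i y) x = ∑ i ∈ s, zAvg L (φ i) x := by
  simp only [zAvg]
  rw [Finset.sum_comm, Finset.mul_sum]

lemma zAvg_add (L : ℕ) (φ ψ : ℤ → ℂ) (x : ℤ) :
    zAvg L (fun y => φ y + ψ y) x = zAvg L φ x + zAvg L ψ x := by
  simp only [zAvg, Finset.sum_add_distrib, mul_add]

lemma zAvg_congr {L : ℕ} {φ ψ : ℤ → ℂ} {x : ℤ} (h : ∀ y, x - L ≤ y → y ≤ x + L → φ y = ψ y) :
    zAvg L φ x = zAvg L ψ x := by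
  unfold zAvg
  congr 1
  exact Finset.sum_congr rfl fun y hy => h y (Finset.mem_Icc.1 hy).1 (Finset.mem_Icc.1 hy).2

lemma zAvg_const (L : ℕ) (c : ℂ) (x : ℤ) : zAvg L (fun _ => c) x = c := by
  have h : ((x + L + 1 - (x - L)).toNat : ℂ) = 2 * L + 1 := by
    have : (x + L + 1 - (x - L)).toNat = 2 * L + 1 := by omega
    rw [this]; push_cast; ring
  have h0 : (2 * (L : ℂ) + 1) ≠ 0 := by exact_mod_cast Nat.succ_ne_zero (2 * L)
  rw [zAvg, Finset.sum_const, Int.card_Icc, nsmul_eq_mul, h, ← mul_assoc, inv_mul_cancel₀ h0, one_mul]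

lemma zAvg_zero_left (φ : ℤ → ℂ) (x : ℤ) : zAvg 0 φ x = φ x := by simp [zAvg]

lemma enorm_winv (L : ℕ) : ‖(2 * (L : ℂ) + 1)⁻¹‖ₑ = ENNReal.ofReal (2 * (L : ℝ) + 1)⁻¹ := by
  rw [← ofReal_norm, norm_inv]
  congr 2
  have : (2 * (L : ℂ) + 1) = ((2 * (L : ℝ) + 1 : ℝ) : ℂ) := by push_cast; ring
  rw [this, Complex.norm_real, Real.norm_of_nonneg (by positivity)]

lemma enorm_zAvg_le (L : ℕ) (ψ : ℤ → ℂ) (x : ℤ) :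
    ‖zAvg L ψ x‖ₑ ≤ ENNReal.ofReal (2 * (L : ℝ) + 1)⁻¹ * ∑' y, ‖ψ y‖ₑ := by
  rw [zAvg, enorm_mul, enorm_winv]
  gcongr
  exact (enorm_sum_le _ _).trans (ENNReal.sum_le_tsum _)

lemma winv_anti {L L' : ℕ} (h : L ≤ L') : (2 * (L' : ℝ) + 1)⁻¹ ≤ (2 * (L : ℝ) + 1)⁻¹ := by
  have : (L : ℝ) ≤ L' := by exact_mod_cast h
  gcongr

lemma sum_window_succ (ψ : ℤ → ℂ) (x : ℤ) (L : ℕ) :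
    ∑ y ∈ Finset.Icc (x - ((L + 1 : ℕ) : ℤ)) (x + ((L + 1 : ℕ) : ℤ)), ψ y =
      ∑ y ∈ Finset.Icc (x - L) (x + L), ψ y + (ψ (x + L + 1) + ψ (x - L - 1)) := by
  have h : Finset.Icc (x - ((L + 1 : ℕ) : ℤ)) (x + ((L + 1 : ℕ) : ℤ)) =
      insert (x + L + 1) (insert (x - L - 1) (Finset.Icc (x - L) (x + L))) := by
    ext y
    simp only [Finset.mem_Icc, Finset.mem_insert]
    push_cast
    omega
  rw [h, Finset.sum_insert, Finset.sum_insert]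
  · ring
  · simp
  · simp only [Finset.mem_insert, Finset.mem_Icc]
    omega

lemma enorm_zAvg_sub_succ_le (ψ : ℤ → ℂ) (x : ℤ) (L : ℕ) :
    ‖zAvg L ψ x - zAvg (L + 1) ψ x‖ₑ ≤
      ENNReal.ofReal ((2 * (L : ℝ) + 1)⁻¹ - (2 * ((L + 1 : ℕ) : ℝ) + 1)⁻¹) * ∑' y, ‖ψ y‖ₑ +
      ENNReal.ofReal (2 * (L : ℝ) + 1)⁻¹ * (‖ψ (x + L + 1)‖ₑ + ‖ψ (x - L - 1)‖ₑ) := by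
  have h : zAvg L ψ x - zAvg (L + 1) ψ x =
      (((2 * (L : ℝ) + 1)⁻¹ - (2 * ((L + 1 : ℕ) : ℝ) + 1)⁻¹ : ℝ) : ℂ) *
        ∑ y ∈ Finset.Icc (x - L) (x + L), ψ y -
      (2 * ((L + 1 : ℕ) : ℂ) + 1)⁻¹ * (ψ (x + L + 1) + ψ (x - L - 1)) := by
    rw [zAvg, zAvg, sum_window_succ]
    push_cast
    ring
  rw [h]
  refine (enorm_sub_le).trans ?_
  rw [enorm_mul, enorm_mul, enorm_winv]
  have hnn : 0 ≤ (2 * (L : ℝ) + 1)⁻¹ - (2 * ((L + 1 : ℕ) : ℝ) + 1)⁻¹ :=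
    sub_nonneg.2 (winv_anti (Nat.le_succ L))
  gcongr
  · rw [← ofReal_norm, Complex.norm_real, Real.norm_of_nonneg hnn]
  · exact (enorm_sum_le _ _).trans (ENNReal.sum_le_tsum _)
  · exact Nat.le_succ L
  · exact enorm_add_le _ _

/-- Enlarging a window by one changes its normalisation and adds two points. The normalisations
telescope, and each side meets every point at most once; these three contributions give the
constant. -/
lemma tsum_tail_enorm_zAvg_sub_succ_le (ψ : ℤ → ℂ) (x : ℤ) (L₀ : ℕ) :
    ∑' L, (if L₀ ≤ L then ‖zAvg L ψ x - zAvg (L + 1) ψ x‖ₑ else 0) ≤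
      3 * (ENNReal.ofReal (2 * (L₀ : ℝ) + 1)⁻¹ * ∑' y, ‖ψ y‖ₑ) := by
  set T := ∑' y, ‖ψ y‖ₑ with hT
  set B := ENNReal.ofReal (2 * (L₀ : ℝ) + 1)⁻¹ with hB
  calc ∑' L, (if L₀ ≤ L then ‖zAvg L ψ x - zAvg (L + 1) ψ x‖ₑ else 0)
      ≤ ∑' L : ℕ, ((if L₀ ≤ L then
          ENNReal.ofReal ((2 * (L : ℝ) + 1)⁻¹ - (2 * ((L + 1 : ℕ) : ℝ) + 1)⁻¹) else 0) * T +
          B * (‖ψ (x + L + 1)‖ₑ + ‖ψ (x - L - 1)‖ₑ)) := by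
        refine ENNReal.tsum_le_tsum fun L => ?_
        split_ifs with h
        · refine (enorm_zAvg_sub_succ_le ψ x L).trans ?_
          gcongr
          exact ENNReal.ofReal_le_ofReal (winv_anti h)
        · exact zero_le
    _ = (∑' L : ℕ, (if L₀ ≤ L then
          ENNReal.ofReal ((2 * (L : ℝ) + 1)⁻¹ - (2 * ((L + 1 : ℕ) : ℝ) + 1)⁻¹) else 0)) * T +
          B * (∑' L : ℕ, ‖ψ (x + L + 1)‖ₑ + ∑' L : ℕ, ‖ψ (x - L - 1)‖ₑ) := by
        rw [ENNReal.tsum_add, ENNReal.tsum_mul_right, ENNReal.tsum_mul_left, ENNReal.tsum_add]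
    _ ≤ B * T + B * (T + T) := by
        gcongr
        · rw [ENNReal.tsum_eq_iSup_nat]
          refine iSup_le fun K => ?_
          rw [← Finset.sum_filter]
          have hsub : (Finset.range K).filter (fun L => L₀ ≤ L) ⊆ Finset.Ico L₀ (L₀ + K) := by
            intro L hL
            simp only [Finset.mem_filter, Finset.mem_range, Finset.mem_Ico] at hL ⊢
            omega
          refine (Finset.sum_le_sum_of_subset hsub).trans ?_
          rw [← ENNReal.ofReal_sum_of_nonneg fun L _ => sub_nonneg.2 (winv_anti (Nat.le_succ L)),
            Finset.sum_congr rfl fun L _ => (neg_sub_neg (2 * ((L + 1 : ℕ) : ℝ) + 1)⁻¹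
              (2 * (L : ℝ) + 1)⁻¹).symm,
            Finset.sum_Ico_sub (fun L : ℕ => -(2 * (L : ℝ) + 1)⁻¹) (Nat.le_add_right _ _),
            neg_sub_neg]
          exact ENNReal.ofReal_le_ofReal (sub_le_self _ (by positivity))
        · exact ENNReal.tsum_comp_le_tsum_of_injective (f := fun L : ℕ => x + L + 1)
            (fun a b h => by simpa using h) (fun y => ‖ψ y‖ₑ)
        · exact ENNReal.tsum_comp_le_tsum_of_injective (f := fun L : ℕ => x - L - 1)
            (fun a b h => by simpa using h) (fun y => ‖ψ y‖ₑ)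
    _ = _ := by ring

/-- The variation of the averages of an integrable function over a range of scales. -/
lemma sqVar_restrict_zAvg_le (ψ : ℤ → ℂ) (x : ℤ) (L₀ L₁ : ℕ) :
    sqVar (fun L => if L₀ ≤ L ∧ L < L₁ then zAvg L ψ x else 0) ≤
      25 * (ENNReal.ofReal (2 * (L₀ : ℝ) + 1)⁻¹ * ∑' y, ‖ψ y‖ₑ) ^ 2 := by
  set B := ENNReal.ofReal (2 * (L₀ : ℝ) + 1)⁻¹ * ∑' y, ‖ψ y‖ₑ with hB
  have hsup : ∀ L, L₀ ≤ L → ‖zAvg L ψ x‖ₑ ≤ B := fun L hL => by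
    refine (enorm_zAvg_le L ψ x).trans ?_
    rw [hB]
    gcongr
  refine (sqVar_le_sq_tsum _).trans ?_
  calc _ ≤ (3 * B + (B + B)) ^ 2 := by
        refine pow_le_pow_left' ?_ 2
        -- Besides the variation inside the range there are the two cut-off jumps, on entering at
        -- `L₀ - 1` and on leaving at `L₁ - 1`; thus 3 + 1 + 1 = 5.
        calc _ ≤ ∑' L, ((if L₀ ≤ L then ‖zAvg L ψ x - zAvg (L + 1) ψ x‖ₑ else 0) +
              ((if L = L₀ - 1 then B else 0) + (if L = L₁ - 1 then B else 0))) := by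
              refine ENNReal.tsum_le_tsum fun L => ?_
              by_cases h1 : L₀ ≤ L ∧ L < L₁
              · by_cases h2 : L + 1 < L₁
                · rw [if_pos h1, if_pos ⟨by omega, h2⟩, if_pos h1.1]
                  exact le_self_add
                · rw [if_pos h1, if_neg (by omega), if_pos (show L = L₁ - 1 by omega), sub_zero]
                  exact (hsup L h1.1).trans (le_add_left le_add_self)
              · by_cases h2 : L₀ ≤ L + 1 ∧ L + 1 < L₁
                · rw [if_neg h1, if_pos h2, if_pos (show L = L₀ - 1 by omega), zero_sub, enorm_neg]
                  exact (hsup _ h2.1).trans (le_add_left le_self_add)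
                · rw [if_neg h1, if_neg h2]
                  simp
          _ ≤ _ := by
              rw [ENNReal.tsum_add, ENNReal.tsum_add, tsum_ite_eq, tsum_ite_eq]
              gcongr
              exact tsum_tail_enorm_zAvg_sub_succ_le ψ x L₀
    _ = _ := by ring

lemma sq_tsum_enorm_le_card (s : Finset ℤ) (ψ : ℤ → ℂ) (h : ∀ y ∉ s, ψ y = 0) :
    (∑' y, ‖ψ y‖ₑ) ^ 2 ≤ s.card * ∑' y, ‖ψ y‖ₑ ^ 2 := by
  rw [tsum_eq_sum (s := s) (fun y hy => by simp [h y hy]),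
    tsum_eq_sum (s := s) (fun y hy => by simp [h y hy])]
  have h1 : (∑ y ∈ s, ‖ψ y‖₊) ^ 2 ≤ s.card * ∑ y ∈ s, ‖ψ y‖₊ ^ 2 := sq_sum_le_card_mul_sum_sq
  simp only [enorm_eq_nnnorm]
  exact_mod_cast h1

lemma ofReal_winv_le {k L : ℕ} (h : 2 ^ k ≤ 2 * L + 1) :
    ENNReal.ofReal (2 * (L : ℝ) + 1)⁻¹ ≤ (2 ^ k)⁻¹ := by
  rw [ENNReal.ofReal_inv_of_pos (by positivity)]
  gcongr
  have : (2 * (L : ℝ) + 1) = ((2 * L + 1 : ℕ) : ℝ) := by push_cast; ring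
  rw [this, ENNReal.ofReal_natCast]
  exact_mod_cast h

/-- The first scale of the `k`-th dyadic block of scales. -/
def blockStart (k : ℕ) : ℕ := if k = 0 then 0 else 2 ^ k

/-- Since `Nat.log 2 0 = 0`, the block of scales number 0 is {0, 1}, which is why `blockStart 0` is
0 and not 1. -/
lemma log_two_eq_iff {k L : ℕ} : Nat.log 2 L = k ↔ blockStart k ≤ L ∧ L < 2 ^ (k + 1) := by
  unfold blockStart
  rcases Nat.eq_zero_or_pos k with rfl | hk
  · simp [Nat.log_eq_zero_iff]
  · rw [Nat.log_eq_iff (Or.inl hk.ne'), if_neg hk.ne']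

lemma sqVar_block_zAvg_le (ψ : ℤ → ℂ) (x : ℤ) (k : ℕ) :
    sqVar (fun L => if Nat.log 2 L = k then zAvg L ψ x else 0) ≤
      25 * ((2 ^ k)⁻¹ * ∑' y, ‖ψ y‖ₑ) ^ 2 := by
  simp only [log_two_eq_iff]
  refine (sqVar_restrict_zAvg_le ψ x _ _).trans ?_
  gcongr
  apply ofReal_winv_le
  unfold blockStart
  split_ifs with h
  · simp [h]
  · omega

/-! #### Functions that are constant on coarse dyadic blocks -/

/-- Only points within distance |l| of one end of a block are moved out of it by the translation. -/
lemma dyA_indicator_ne_le (j : ℕ) (l : ℤ) (x : ℤ) :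
    dyA j ({y | (y + l) / 2 ^ j ≠ y / 2 ^ j}.indicator 1) x ≤ (2 ^ j)⁻¹ * (l.natAbs : ℝ≥0∞) := by
  classical
  unfold dyA
  gcongr
  simp only [Set.indicator_apply, Pi.one_apply]
  rw [Finset.sum_boole]
  norm_cast
  have hsub : (dyBlock j x).filter (fun y => y ∈ {y : ℤ | (y + l) / 2 ^ j ≠ y / 2 ^ j}) ⊆
      if 0 ≤ l then Finset.Ico (2 ^ j * (x / 2 ^ j) + 2 ^ j - l) (2 ^ j * (x / 2 ^ j) + 2 ^ j)
      else Finset.Ico (2 ^ j * (x / 2 ^ j)) (2 ^ j * (x / 2 ^ j) - l) := by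
    intro y hy
    rw [Finset.mem_filter] at hy
    obtain ⟨hy1, hy2⟩ := hy
    have hy3 : (y + l) / 2 ^ j ≠ x / 2 ^ j := by
      rw [← mem_dyBlock.1 hy1]; exact hy2
    have hy4 : ¬ (y + l ∈ dyBlock j x) := fun h => hy3 (mem_dyBlock.1 h)
    rw [dyBlock, Finset.mem_Ico] at hy1 hy4
    split_ifs with hl <;> rw [Finset.mem_Ico] <;> omega
  refine (Finset.card_le_card hsub).trans ?_
  split_ifs with hl <;> rw [Int.card_Ico] <;> omega

lemma tsum_shift (l : ℤ) (h : ℤ → ℝ≥0∞) : ∑' x, h (x + l) = ∑' x, h x :=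
  (Equiv.addRight l).tsum_eq h

lemma tsum_indicator_ne_sq_le (j : ℕ) (h : ℤ → ℂ) (hh : ∀ x y, y / 2 ^ j = x / 2 ^ j → h y = h x)
    (l : ℤ) :
    ∑' x, ‖h x‖ₑ ^ 2 * {y | (y + l) / 2 ^ j ≠ y / 2 ^ j}.indicator 1 x ≤
      (2 ^ j)⁻¹ * (l.natAbs : ℝ≥0∞) * ∑' x, ‖h x‖ₑ ^ 2 := by
  rw [tsum_mul_dyA j (fun x => ‖h x‖ₑ ^ 2) _ (fun x y hxy => by simp only [hh x y hxy]), mul_comm,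
    ← ENNReal.tsum_mul_right]
  gcongr
  exact dyA_indicator_ne_le j l _

/-- The difference vanishes unless the shift crosses a block boundary, which happens for a
proportion |l| / 2^j of each block. -/
lemma tsum_shift_sub_sq_le (j : ℕ) (h : ℤ → ℂ) (hh : ∀ x y, y / 2 ^ j = x / 2 ^ j → h y = h x)
    (l : ℤ) :
    ∑' x, ‖h (x + l) - h x‖ₑ ^ 2 ≤ 4 * ((2 ^ j)⁻¹ * (l.natAbs : ℝ≥0∞) * ∑' x, ‖h x‖ₑ ^ 2) := by
  calc ∑' x, ‖h (x + l) - h x‖ₑ ^ 2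
      ≤ ∑' x, 2 * (‖h (x + l)‖ₑ ^ 2 * {y | (y + -l) / 2 ^ j ≠ y / 2 ^ j}.indicator 1 (x + l) +
          ‖h x‖ₑ ^ 2 * {y | (y + l) / 2 ^ j ≠ y / 2 ^ j}.indicator 1 x) := by
        refine ENNReal.tsum_le_tsum fun x => ?_
        by_cases hx : (x + l) / 2 ^ j = x / 2 ^ j
        · simp [hh _ _ hx]
        · have h1 : x + l ∈ {y : ℤ | (y + -l) / 2 ^ j ≠ y / 2 ^ j} := by
            simpa [eq_comm] using hx
          have h2 : x ∈ {y : ℤ | (y + l) / 2 ^ j ≠ y / 2 ^ j} := hx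
          rw [Set.indicator_of_mem h1, Set.indicator_of_mem h2]
          simpa [sub_eq_add_neg] using enorm_add_sq_le (h (x + l)) (-h x)
    _ ≤ 2 * ((2 ^ j)⁻¹ * ((-l).natAbs : ℝ≥0∞) * ∑' x, ‖h x‖ₑ ^ 2 +
          (2 ^ j)⁻¹ * (l.natAbs : ℝ≥0∞) * ∑' x, ‖h x‖ₑ ^ 2) := by
        rw [ENNReal.tsum_mul_left, ENNReal.tsum_add, tsum_shift l fun x =>
          ‖h x‖ₑ ^ 2 * {y | (y + -l) / 2 ^ j ≠ y / 2 ^ j}.indicator 1 x]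
        gcongr
        · exact tsum_indicator_ne_sq_le j h hh (-l)
        · exact tsum_indicator_ne_sq_le j h hh l
    _ = _ := by rw [Int.natAbs_neg]; ring

lemma tsum_window (x : ℤ) (R : ℕ) (F : ℤ → ℝ≥0∞) (hF : ∀ y, ¬(x - R ≤ y ∧ y ≤ x + R) → F y = 0) :
    ∑' y, F y = ∑ l ∈ Finset.Icc (-(R : ℤ)) R, F (x + l) := by
  rw [← tsum_shift x F, tsum_eq_sum (s := Finset.Icc (-(R : ℤ)) R)]
  · exact Finset.sum_congr rfl fun l _ => by rw [add_comm]
  · intro l hl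
    rw [Finset.mem_Icc] at hl
    exact hF _ (by omega)

lemma two_pow_inv_sq_mul (k : ℕ) : ((2 ^ k)⁻¹ : ℝ≥0∞) ^ 2 * 2 ^ k = (2 ^ k)⁻¹ := by
  rw [sq, mul_assoc, mul_comm _ ((2 : ℝ≥0∞) ^ k), two_pow_mul_inv, mul_one]

/-- Within one block of scales `h x` is a constant, so only the values of `h - h x` in the largest
window matter. Cauchy–Schwarz reduces to mean square translation differences by at most 2^(k+1),
which gain 2^(k-j). -/
lemma tsum_sqVar_block_coarse_le {j k : ℕ} (h : ℤ → ℂ)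
    (hh : ∀ x y, y / 2 ^ j = x / 2 ^ j → h y = h x) :
    ∑' x, sqVar (fun L => if Nat.log 2 L = k then zAvg L h x - h x else 0) ≤
      5000 * (2 ^ k * (2 ^ j)⁻¹ * ∑' x, ‖h x‖ₑ ^ 2) := by
  have hcard : ((Finset.Icc (-((2 ^ (k + 1) : ℕ) : ℤ)) ((2 ^ (k + 1) : ℕ) : ℤ)).card : ℝ≥0∞) ≤ 5 * 2 ^ k := by
    have : (Finset.Icc (-((2 ^ (k + 1) : ℕ) : ℤ)) ((2 ^ (k + 1) : ℕ) : ℤ)).card ≤ 5 * 2 ^ k := by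
      rw [Int.card_Icc]
      have : 0 < 2 ^ k := by positivity
      rw [pow_succ]
      omega
    exact_mod_cast this
  have hpt : ∀ x, sqVar (fun L => if Nat.log 2 L = k then zAvg L h x - h x else 0) ≤
      125 * ((2 ^ k)⁻¹ * ∑ l ∈ Finset.Icc (-((2 ^ (k + 1) : ℕ) : ℤ)) ((2 ^ (k + 1) : ℕ) : ℤ),
        ‖h (x + l) - h x‖ₑ ^ 2) := by
    intro x
    set ψ : ℤ → ℂ := fun y => if x - (2 ^ (k + 1) : ℕ) ≤ y ∧ y ≤ x + (2 ^ (k + 1) : ℕ) then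
      h y - h x else 0 with hψ
    have heq : (fun L => if Nat.log 2 L = k then zAvg L h x - h x else 0) =
        fun L => if Nat.log 2 L = k then zAvg L ψ x else 0 := by
      funext L
      split_ifs with hL
      · have hL2 : L < 2 ^ (k + 1) := (log_two_eq_iff.1 hL).2
        have h1 : zAvg L ψ x = zAvg L (fun y => h y + -h x) x := by
          refine zAvg_congr fun y h1 h2 => ?_
          rw [hψ]
          dsimp only
          rw [if_pos (by omega), sub_eq_add_neg]
        rw [h1, zAvg_add, zAvg_const, sub_eq_add_neg]
      · rfl
    rw [heq]
    refine (sqVar_block_zAvg_le ψ x k).trans ?_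
    have hψ0 : ∀ y, ¬(x - (2 ^ (k + 1) : ℕ) ≤ y ∧ y ≤ x + (2 ^ (k + 1) : ℕ)) → ψ y = 0 :=
      fun y hy => if_neg hy
    have hψs : ∀ y ∉ Finset.Icc (x - (2 ^ (k + 1) : ℕ)) (x + (2 ^ (k + 1) : ℕ)), ψ y = 0 :=
      fun y hy => hψ0 y (by simpa using hy)
    have hcard' : (Finset.Icc (x - ((2 ^ (k + 1) : ℕ) : ℤ)) (x + ((2 ^ (k + 1) : ℕ) : ℤ))).card =
        (Finset.Icc (-((2 ^ (k + 1) : ℕ) : ℤ)) ((2 ^ (k + 1) : ℕ) : ℤ)).card := by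
      rw [Int.card_Icc, Int.card_Icc]
      congr 1; ring
    calc 25 * ((2 ^ k)⁻¹ * ∑' y, ‖ψ y‖ₑ) ^ 2
        ≤ 25 * (((2 ^ k)⁻¹) ^ 2 * (5 * 2 ^ k * ∑' y, ‖ψ y‖ₑ ^ 2)) := by
          rw [mul_pow]
          gcongr
          refine (sq_tsum_enorm_le_card _ ψ hψs).trans ?_
          rw [hcard']
          gcongr
      _ = 125 * (((2 ^ k)⁻¹ ^ 2 * 2 ^ k) * ∑' y, ‖ψ y‖ₑ ^ 2) := by ring
      _ = 125 * ((2 ^ k)⁻¹ * ∑' y, ‖ψ y‖ₑ ^ 2) := by rw [two_pow_inv_sq_mul]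
      _ = _ := by
          rw [tsum_window x (2 ^ (k + 1)) (fun y => ‖ψ y‖ₑ ^ 2) fun y hy => by simp [hψ0 y hy]]
          congr 2
          refine Finset.sum_congr rfl fun l hl => ?_
          rw [Finset.mem_Icc] at hl
          rw [hψ]
          dsimp only
          rw [if_pos (by omega)]
  calc _ ≤ ∑' x, 125 * ((2 ^ k)⁻¹ * ∑ l ∈ Finset.Icc (-((2 ^ (k + 1) : ℕ) : ℤ)) ((2 ^ (k + 1) : ℕ) : ℤ),
        ‖h (x + l) - h x‖ₑ ^ 2) := ENNReal.tsum_le_tsum hpt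
    _ = 125 * ((2 ^ k)⁻¹ * ∑ l ∈ Finset.Icc (-((2 ^ (k + 1) : ℕ) : ℤ)) ((2 ^ (k + 1) : ℕ) : ℤ),
        ∑' x, ‖h (x + l) - h x‖ₑ ^ 2) := by
        rw [ENNReal.tsum_mul_left, ENNReal.tsum_mul_left,
          Summable.tsum_finsetSum fun _ _ => ENNReal.summable]
    _ ≤ 125 * ((2 ^ k)⁻¹ * ∑ l ∈ Finset.Icc (-((2 ^ (k + 1) : ℕ) : ℤ)) ((2 ^ (k + 1) : ℕ) : ℤ),
        4 * ((2 ^ j)⁻¹ * (2 * 2 ^ k) * ∑' x, ‖h x‖ₑ ^ 2)) := by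
        gcongr with l hl
        refine (tsum_shift_sub_sq_le j h hh l).trans ?_
        gcongr
        have : l.natAbs ≤ 2 * 2 ^ k := by
          rw [Finset.mem_Icc, pow_succ] at hl
          omega
        exact_mod_cast this
    _ ≤ 125 * ((2 ^ k)⁻¹ * (5 * 2 ^ k * (4 * ((2 ^ j)⁻¹ * (2 * 2 ^ k) * ∑' x, ‖h x‖ₑ ^ 2)))) := by
        rw [Finset.sum_const, nsmul_eq_mul]
        gcongr
    _ = 5000 * ((2 ^ k * (2 ^ k)⁻¹) * (2 ^ k * (2 ^ j)⁻¹ * ∑' x, ‖h x‖ₑ ^ 2)) := by ring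
    _ = _ := by rw [two_pow_mul_inv, one_mul]

/-! #### Functions with vanishing means on fine dyadic blocks -/

/-- The restriction of `h` to the dyadic block with number `m` at level `i`. -/
noncomputable def blockPart (i : ℕ) (h : ℤ → ℂ) (m : ℤ) (y : ℤ) : ℂ := if y / 2 ^ i = m then h y else 0

/-- A window that does not end in the dyadic block number `m` contains it or misses it. -/
lemma sum_window_blockPart {k : ℕ} (φ : ℤ → ℂ) {m x : ℤ} {L : ℕ} (h1 : m ≠ (x + L) / 2 ^ k)
    (h2 : m ≠ (x - L) / 2 ^ k) :
    ∑ y ∈ Finset.Icc (x - L) (x + L), blockPart k φ m y =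
      if (x - L) / 2 ^ k < m ∧ m < (x + L) / 2 ^ k then ∑ y ∈ dyBlock k (m * 2 ^ k), φ y else 0 := by
  have hp : (0 : ℤ) < 2 ^ k := by positivity
  split_ifs with hm
  · have hdiv : m * 2 ^ k / 2 ^ k = m := Int.mul_ediv_cancel _ hp.ne'
    unfold blockPart
    rw [← Finset.sum_filter]
    refine Finset.sum_congr ?_ fun _ _ => rfl
    ext y
    rw [Finset.mem_filter, mem_dyBlock, hdiv, Finset.mem_Icc]
    refine ⟨fun h => h.2, fun h => ⟨⟨?_, ?_⟩, h⟩⟩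
    · by_contra hcon
      have := Int.ediv_le_ediv hp (show y ≤ x - L by omega)
      omega
    · by_contra hcon
      have := Int.ediv_le_ediv hp (show x + L ≤ y by omega)
      omega
  · refine Finset.sum_eq_zero fun y hy => ?_
    rw [Finset.mem_Icc] at hy
    have h3 := Int.ediv_le_ediv hp hy.1
    have h4 := Int.ediv_le_ediv hp hy.2
    exact if_neg (by omega)

lemma zAvg_blockPart_eq_zero {i : ℕ} {h : ℤ → ℂ} (hh : ∀ x, ∑ y ∈ dyBlock i x, h y = 0) {m x : ℤ}
    {L : ℕ} (h1 : m ≠ (x + L) / 2 ^ i) (h2 : m ≠ (x - L) / 2 ^ i) :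
    zAvg L (blockPart i h m) x = 0 := by
  rw [zAvg, sum_window_blockPart h h1 h2, hh, ite_self, mul_zero]

/-- Blocks inside or outside the window contribute nothing, by cancellation. For each radius only
the two blocks containing the window's end points survive, so almost orthogonality applies; a single
block of length 2^i averaged at scale 2^k gains 2^(i-k). -/
lemma tsum_sqVar_block_fine_le {i k : ℕ} (hik : i ≤ k) (h : ℤ → ℂ)
    (hh : ∀ x, ∑ y ∈ dyBlock i x, h y = 0) :
    ∑' x, sqVar (fun L => if Nat.log 2 L = k then zAvg L h x else 0) ≤
      900 * (2 ^ i * (2 ^ k)⁻¹ * ∑' x, ‖h x‖ₑ ^ 2) := by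
  classical
  have hp : (0 : ℤ) < 2 ^ i := by positivity
  have hik2 : 2 ^ i ≤ 2 ^ k := Nat.pow_le_pow_right (by norm_num) hik
  have hpt : ∀ x, sqVar (fun L => if Nat.log 2 L = k then zAvg L h x else 0) ≤
      100 * (2 ^ i * ((2 ^ k)⁻¹) ^ 2) * ∑ l ∈ Finset.Icc (-((2 ^ (k + 2) : ℕ) : ℤ)) ((2 ^ (k + 2) : ℕ) : ℤ),
        ‖h (x + l)‖ₑ ^ 2 := by
    intro x
    set s : Finset ℤ := Finset.Icc ((x - (2 ^ (k + 1) : ℕ)) / 2 ^ i) ((x + (2 ^ (k + 1) : ℕ)) / 2 ^ i)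
      with hs
    set a : ℤ → ℕ → ℂ := fun m L => if Nat.log 2 L = k then zAvg L (blockPart i h m) x else 0 with ha
    have heq : (fun L => if Nat.log 2 L = k then zAvg L h x else 0) = fun L => ∑ m ∈ s, a m L := by
      funext L
      simp only [ha]
      split_ifs with hL
      · have hL2 : L < 2 ^ (k + 1) := (log_two_eq_iff.1 hL).2
        rw [← zAvg_sum]
        refine zAvg_congr fun y h1 h2 => ?_
        simp only [blockPart]
        rw [Finset.sum_ite_eq, if_pos]
        rw [hs, Finset.mem_Icc]
        exact ⟨Int.ediv_le_ediv hp (by omega), Int.ediv_le_ediv hp (by omega)⟩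
      · simp
    have hover : ∀ L, (s.filter fun m => a m L ≠ 0).card ≤ 2 := by
      intro L
      refine (Finset.card_le_card (t := {(x + L) / 2 ^ i, (x - L) / 2 ^ i}) ?_).trans
        (Finset.card_le_two)
      intro m hm
      rw [Finset.mem_filter] at hm
      rw [Finset.mem_insert, Finset.mem_singleton]
      by_contra hcon
      push Not at hcon
      apply hm.2
      simp only [ha]
      rw [zAvg_blockPart_eq_zero hh hcon.1 hcon.2, ite_self]
    have hpart : ∀ m, sqVar (a m) ≤ 25 * (2 ^ i * ((2 ^ k)⁻¹) ^ 2) * ∑' y, ‖blockPart i h m y‖ₑ ^ 2 := by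
      intro m
      refine (sqVar_block_zAvg_le _ x k).trans ?_
      have h1 := sq_tsum_enorm_le_card (dyBlock i (m * 2 ^ i)) (blockPart i h m) (fun y hy => by
        rw [mem_dyBlock, Int.mul_ediv_cancel _ hp.ne'] at hy
        exact if_neg hy)
      rw [card_dyBlock] at h1
      push_cast at h1
      calc 25 * ((2 ^ k)⁻¹ * ∑' y, ‖blockPart i h m y‖ₑ) ^ 2
          ≤ 25 * (((2 ^ k)⁻¹) ^ 2 * (2 ^ i * ∑' y, ‖blockPart i h m y‖ₑ ^ 2)) := by
            rw [mul_pow]; gcongr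
        _ = _ := by ring
    rw [heq]
    refine (sqVar_sum_le_of_overlap s a 2 hover).trans ?_
    calc 2 * ((2 : ℕ) : ℝ≥0∞) * ∑ m ∈ s, sqVar (a m)
        ≤ 2 * ((2 : ℕ) : ℝ≥0∞) * ∑ m ∈ s, 25 * (2 ^ i * ((2 ^ k)⁻¹) ^ 2) * ∑' y, ‖blockPart i h m y‖ₑ ^ 2 := by
          gcongr with m _
          exact hpart m
      _ = 100 * (2 ^ i * ((2 ^ k)⁻¹) ^ 2) * ∑' y, ∑ m ∈ s, ‖blockPart i h m y‖ₑ ^ 2 := by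
          rw [← Finset.mul_sum, Summable.tsum_finsetSum fun _ _ => ENNReal.summable]
          push_cast
          ring
      _ ≤ 100 * (2 ^ i * ((2 ^ k)⁻¹) ^ 2) * ∑' y, (if x - (2 ^ (k + 2) : ℕ) ≤ y ∧ y ≤ x + (2 ^ (k + 2) : ℕ)
            then ‖h y‖ₑ ^ 2 else 0) := by
          gcongr with y
          have h1 : ∑ m ∈ s, ‖blockPart i h m y‖ₑ ^ 2 = if y / 2 ^ i ∈ s then ‖h y‖ₑ ^ 2 else 0 := by
            rw [← Finset.sum_ite_eq s (y / 2 ^ i) fun _ => ‖h y‖ₑ ^ 2]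
            refine Finset.sum_congr rfl fun m _ => ?_
            unfold blockPart
            split_ifs <;> simp
          rw [h1]
          split_ifs with h2 h3
          · exact le_rfl
          · exfalso
            apply h3
            rw [hs, Finset.mem_Icc] at h2
            have h4 := Int.lt_ediv_add_one_mul_self y hp
            have h5 := Int.ediv_mul_le y hp.ne'
            have h6 := Int.lt_ediv_add_one_mul_self (x - (2 ^ (k + 1) : ℕ)) hp
            have h7 := Int.ediv_mul_le (x + (2 ^ (k + 1) : ℕ)) hp.ne'
            have h8 := mul_le_mul_of_nonneg_right h2.1 hp.le
            have h9 := mul_le_mul_of_nonneg_right h2.2 hp.le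
            have h10 : (2 : ℤ) ^ i ≤ 2 ^ k := by exact_mod_cast hik2
            have hk1 : ((2 ^ (k + 1) : ℕ) : ℤ) = 2 * 2 ^ k := by push_cast; ring
            have hk2 : ((2 ^ (k + 2) : ℕ) : ℤ) = 4 * 2 ^ k := by push_cast; ring
            rw [hk1] at h6 h7 h8 h9
            rw [hk2]
            constructor <;> linarith
          · exact zero_le
          · exact le_rfl
      _ = _ := by
          rw [tsum_window x (2 ^ (k + 2)) _ fun y hy => if_neg hy]
          congr 1
          refine Finset.sum_congr rfl fun l hl => ?_
          rw [Finset.mem_Icc] at hl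
          rw [if_pos (by omega)]
  have hcard : ((Finset.Icc (-((2 ^ (k + 2) : ℕ) : ℤ)) ((2 ^ (k + 2) : ℕ) : ℤ)).card : ℝ≥0∞) ≤ 9 * 2 ^ k := by
    have : (Finset.Icc (-((2 ^ (k + 2) : ℕ) : ℤ)) ((2 ^ (k + 2) : ℕ) : ℤ)).card ≤ 9 * 2 ^ k := by
      rw [Int.card_Icc]
      have : 0 < 2 ^ k := by positivity
      rw [pow_add]
      omega
    exact_mod_cast this
  calc _ ≤ ∑' x, 100 * (2 ^ i * ((2 ^ k)⁻¹) ^ 2) *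
        ∑ l ∈ Finset.Icc (-((2 ^ (k + 2) : ℕ) : ℤ)) ((2 ^ (k + 2) : ℕ) : ℤ), ‖h (x + l)‖ₑ ^ 2 :=
        ENNReal.tsum_le_tsum hpt
    _ = 100 * (2 ^ i * ((2 ^ k)⁻¹) ^ 2) *
        (((Finset.Icc (-((2 ^ (k + 2) : ℕ) : ℤ)) ((2 ^ (k + 2) : ℕ) : ℤ)).card : ℝ≥0∞) * ∑' x, ‖h x‖ₑ ^ 2) := by
        rw [ENNReal.tsum_mul_left, Summable.tsum_finsetSum fun _ _ => ENNReal.summable]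
        simp_rw [tsum_shift _ fun x => ‖h x‖ₑ ^ 2]
        rw [Finset.sum_const, nsmul_eq_mul]
    _ ≤ 100 * (2 ^ i * ((2 ^ k)⁻¹) ^ 2) * (9 * 2 ^ k * ∑' x, ‖h x‖ₑ ^ 2) := by gcongr
    _ = 900 * (2 ^ i * ((2 ^ k)⁻¹ ^ 2 * 2 ^ k) * ∑' x, ‖h x‖ₑ ^ 2) := by ring
    _ = _ := by rw [two_pow_inv_sq_mul]

/-! ### The `ℓ²` inequality for averages -/

/-- Martingale differences up to level `J`, with the last average as final term. -/
noncomputable def dyDiff (J : ℕ) (φ : ℤ → ℂ) (j : ℕ) (x : ℤ) : ℂ :=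
  if j < J then dyE j φ x - dyE (j + 1) φ x else dyE J φ x

lemma sum_Ico_dyDiff (φ : ℤ → ℂ) (x : ℤ) {k J : ℕ} (hk : k ≤ J) :
    ∑ j ∈ Finset.Ico k (J + 1), dyDiff J φ j x = dyE k φ x := by
  have h1 : ∑ j ∈ Finset.Ico k J, dyDiff J φ j x =
      ∑ j ∈ Finset.Ico k J, (dyE j φ x - dyE (j + 1) φ x) :=
    Finset.sum_congr rfl fun j hj => if_pos (Finset.mem_Ico.1 hj).2
  rw [Finset.sum_Ico_succ_top hk, h1, dyDiff, if_neg (lt_irrefl J)]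
  have h := Finset.sum_Ico_sub (fun j => -dyE j φ x) hk
  simp only [neg_sub_neg] at h
  rw [h]
  ring

lemma sum_dyDiff (J : ℕ) (φ : ℤ → ℂ) (x : ℤ) :
    ∑ j ∈ Finset.range (J + 1), dyDiff J φ j x = φ x := by
  rw [Finset.range_eq_Ico, sum_Ico_dyDiff φ x (Nat.zero_le J), dyE_zero]

lemma sum_tsum_dyDiff_sq (J : ℕ) (φ : ℤ → ℂ) :
    ∑ j ∈ Finset.range (J + 1), ∑' x, ‖dyDiff J φ j x‖ₑ ^ 2 = ∑' x, ‖φ x‖ₑ ^ 2 := by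
  rw [← sum_tsum_dyE_sub_sq φ J, Finset.sum_range_succ]
  congr 1
  · refine Finset.sum_congr rfl fun j hj => ?_
    simp [dyDiff, Finset.mem_range.1 hj]
  · simp [dyDiff]

lemma dyDiff_congr {J j : ℕ} (hj : j ≤ J) (φ : ℤ → ℂ) {x y : ℤ} (h : y / 2 ^ j = x / 2 ^ j) :
    dyDiff J φ j y = dyDiff J φ j x := by
  unfold dyDiff
  split_ifs with h1
  · rw [dyE_congr h, dyE_congr (ediv_two_pow_congr (Nat.le_succ j) h)]
  · rw [dyE_congr (ediv_two_pow_congr hj h)]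

lemma sum_dyBlock_of_congr (k : ℕ) (u : ℤ → ℂ) (hu : ∀ x y, y / 2 ^ k = x / 2 ^ k → u y = u x)
    (x : ℤ) : ∑ y ∈ dyBlock k x, u y = 2 ^ k * u x := by
  rw [Finset.sum_congr rfl fun y hy => hu x y (mem_dyBlock.1 hy), Finset.sum_const, card_dyBlock,
    nsmul_eq_mul]
  push_cast
  rfl

lemma sum_dyBlock_dyDiff {J j : ℕ} (hj : j < J) (φ : ℤ → ℂ) (x : ℤ) :
    ∑ y ∈ dyBlock (j + 1) x, dyDiff J φ j y = 0 := by
  simp only [dyDiff, if_pos hj]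
  rw [Finset.sum_sub_distrib, sum_dyBlock_of_congr (j + 1) _ fun x y h => dyE_congr h φ,
    dyBlock_succ, Finset.sum_union (disjoint_dyBlock j x),
    sum_dyBlock_of_congr j _ fun x y h => dyE_congr h φ,
    sum_dyBlock_of_congr j _ fun x y h => dyE_congr h φ, dyE_succ, pow_succ]
  ring

/-- Off-diagonal decay; with truncated subtraction the exponent is |k - j|. For j ≥ k the difference
is constant on blocks of length 2^j; for j < k it has mean zero on blocks of length 2^(j+1). The
terms subtracted for j ≥ k add up to `dyE k φ`. -/
lemma tsum_sqVar_block_dyDiff_le {J j k : ℕ} (hj : j ≤ J) (hk : k < J) (φ : ℤ → ℂ) :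
    ∑' x, sqVar (fun L => if Nat.log 2 L = k then
      zAvg L (dyDiff J φ j) x - (if k ≤ j then dyDiff J φ j x else 0) else 0) ≤
      5000 * (2⁻¹ ^ ((k - j) + (j - k)) * ∑' x, ‖dyDiff J φ j x‖ₑ ^ 2) := by
  rcases le_or_gt k j with h | h
  · simp only [if_pos h]
    refine (tsum_sqVar_block_coarse_le (j := j) _ fun x y hxy => dyDiff_congr hj φ hxy).trans
      (le_of_eq ?_)
    congr 2
    obtain ⟨d, rfl⟩ := Nat.exists_eq_add_of_le h
    rw [show k - (k + d) + (k + d - k) = d by omega, pow_add, ← ENNReal.inv_pow,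
      ENNReal.mul_inv (by simp) (by simp), ← mul_assoc, two_pow_mul_inv, one_mul]
  · simp only [if_neg (not_le.2 h), sub_zero]
    refine (tsum_sqVar_block_fine_le (i := j + 1) h _ fun x =>
      sum_dyBlock_dyDiff (by omega) φ x).trans ?_
    obtain ⟨d, rfl⟩ := Nat.exists_eq_add_of_le h.le
    rw [show j + d - j + (j - (j + d)) = d by omega]
    have : (2 ^ (j + 1) * (2 ^ (j + d))⁻¹ : ℝ≥0∞) = 2 * 2⁻¹ ^ d := by
      rw [pow_succ, pow_add, ENNReal.mul_inv (by simp) (by simp), ← ENNReal.inv_pow]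
      calc (2 ^ j * 2 * ((2 ^ j)⁻¹ * (2 ^ d)⁻¹) : ℝ≥0∞)
          = (2 ^ j * (2 ^ j)⁻¹) * (2 * (2 ^ d)⁻¹) := by ring
        _ = _ := by rw [two_pow_mul_inv, one_mul]
    rw [this, mul_assoc 2, ← mul_assoc]
    gcongr
    norm_num

lemma sum_geometric_dist_le (q : ℝ≥0∞) (k n : ℕ) :
    ∑ j ∈ Finset.range n, q ^ ((k - j) + (j - k)) ≤ 2 * (1 - q)⁻¹ + q * (1 - q)⁻¹ := by
  calc ∑ j ∈ Finset.range n, q ^ ((k - j) + (j - k))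
      ≤ ∑ j ∈ Finset.range (k + n), q ^ ((k - j) + (j - k)) :=
        Finset.sum_le_sum_of_subset (Finset.range_subset_range.2 (by omega))
    _ = ∑ j ∈ Finset.range k, q ^ (j + 1) + ∑ i ∈ Finset.range n, q ^ i := by
        rw [Finset.sum_range_add]
        congr 1
        · rw [← Finset.sum_range_reflect]
          refine Finset.sum_congr rfl fun j hj => ?_
          have := Finset.mem_range.1 hj
          congr 1
          omega
        · refine Finset.sum_congr rfl fun j hj => ?_
          congr 1
          omega
    _ ≤ q * (1 - q)⁻¹ + (1 - q)⁻¹ := by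
        simp_rw [pow_succ']
        rw [← Finset.mul_sum, ← ENNReal.tsum_geometric]
        gcongr <;> exact ENNReal.sum_le_tsum _
    _ ≤ _ := by
        rw [add_comm, two_mul]
        gcongr
        exact le_self_add

lemma sum_dist_pow_le {q : ℝ≥0} (hq : q < 1) : ∃ C : ℝ≥0, ∀ k n : ℕ,
    ∑ j ∈ Finset.range n, (q : ℝ≥0∞) ^ ((k - j) + (j - k)) ≤ C := by
  have hS : (1 - (q : ℝ≥0∞))⁻¹ ≠ ∞ :=
    ENNReal.inv_ne_top.2 (tsub_pos_of_lt (by exact_mod_cast hq)).ne'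
  refine ⟨2 * (1 - (q : ℝ≥0∞))⁻¹.toNNReal + q * (1 - (q : ℝ≥0∞))⁻¹.toNNReal, fun k n => ?_⟩
  push_cast
  rw [ENNReal.coe_toNNReal hS]
  exact sum_geometric_dist_le q k n

/-- The differences between averages and dyadic martingale, on the scales up to `2 ^ J`. -/
lemma tsum_sqVar_zAvg_sub_dyE_le : ∃ C : ℝ≥0, ∀ (φ : ℤ → ℂ) (J : ℕ),
    ∑' x, sqVar (fun L => if Nat.log 2 L < J then zAvg L φ x - dyE (Nat.log 2 L) φ x else 0) ≤
      C * ∑' x, ‖φ x‖ₑ ^ 2 := by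
  -- The decay rate 1/2 is split as (2/3) · (3/4): powers of 2/3 are the Cauchy–Schwarz weights, and
  -- powers of 3/4 remain summable.
  obtain ⟨A, hA⟩ := sum_dist_pow_le (q := 2 / 3) (by
    rw [div_lt_one (by norm_num)]; norm_num)
  obtain ⟨B, hB⟩ := sum_dist_pow_le (q := 3 / 4) (by
    rw [div_lt_one (by norm_num)]; norm_num)
  refine ⟨2 * (A * (5000 * B)), fun φ J => ?_⟩
  set T := ∑' x, ‖φ x‖ₑ ^ 2 with hT
  let e : ℤ → ℕ → ℕ → ℂ := fun x k L =>
    if Nat.log 2 L = k then zAvg L φ x - dyE k φ x else 0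
  let a : ℤ → ℕ → ℕ → ℕ → ℂ := fun x k j L => if Nat.log 2 L = k then
      zAvg L (dyDiff J φ j) x - (if k ≤ j then dyDiff J φ j x else 0) else 0
  have he : ∀ x, ∀ k < J, e x k = fun L => ∑ j ∈ Finset.range (J + 1), a x k j L := by
    intro x k hk
    funext L
    simp only [e, a]
    split_ifs with hL
    · rw [Finset.sum_sub_distrib, ← zAvg_sum]
      simp_rw [sum_dyDiff]
      congr 1
      -- The differences of level at least `k` telescope to the expectation of level `k`.
      rw [← sum_Ico_dyDiff φ x hk.le, ← Finset.sum_filter]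
      refine Finset.sum_congr ?_ fun _ _ => rfl
      ext j
      simp only [Finset.mem_Ico, Finset.mem_filter, Finset.mem_range]
      tauto
    · simp
  have hsplit : ∀ x, sqVar (fun L => if Nat.log 2 L < J then
      zAvg L φ x - dyE (Nat.log 2 L) φ x else 0) ≤ 2 * ∑ k ∈ Finset.range J, sqVar (e x k) := by
    intro x
    have h1 : (fun L => if Nat.log 2 L < J then zAvg L φ x - dyE (Nat.log 2 L) φ x else 0) =
        fun L => ∑ k ∈ Finset.range J, e x k L := by
      funext L
      simp only [e]
      rw [Finset.sum_ite_eq]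
      simp only [Finset.mem_range]
    rw [h1]
    have h2 := sqVar_sum_le_of_overlap (Finset.range J) (e x) 1 fun L => by
      refine (Finset.card_le_card (t := {Nat.log 2 L}) fun k hk => ?_).trans (by simp)
      rw [Finset.mem_filter] at hk
      rw [Finset.mem_singleton]
      by_contra hcon
      exact hk.2 (if_neg fun h => hcon h.symm)
    simpa using h2
  have hq : ∀ d : ℕ, ((((2 / 3 : ℝ≥0) ^ d)⁻¹ : ℝ≥0) : ℝ≥0∞) * 2⁻¹ ^ d = ((3 / 4 : ℝ≥0) : ℝ≥0∞) ^ d := by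
    intro d
    have h2 : (2⁻¹ : ℝ≥0∞) = ((2⁻¹ : ℝ≥0) : ℝ≥0∞) := by simp
    rw [h2, ← ENNReal.coe_pow, ← ENNReal.coe_pow, ← ENNReal.coe_mul]
    congr 1
    rw [← inv_pow, ← mul_pow]
    congr 1
    norm_num
  have hblock : ∀ k < J, ∑' x, sqVar (e x k) ≤ A * ∑ j ∈ Finset.range (J + 1),
      5000 * (((3 / 4 : ℝ≥0) : ℝ≥0∞) ^ ((k - j) + (j - k)) * ∑' x, ‖dyDiff J φ j x‖ₑ ^ 2) := by
    intro k hk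
    calc ∑' x, sqVar (e x k)
        ≤ ∑' x, A * ∑ j ∈ Finset.range (J + 1),
            ((((2 / 3 : ℝ≥0) ^ ((k - j) + (j - k)))⁻¹ : ℝ≥0) : ℝ≥0∞) * sqVar (a x k j) := by
          refine ENNReal.tsum_le_tsum fun x => ?_
          rw [he x k hk]
          refine (sqVar_sum_le_weighted _ (fun j => (2 / 3 : ℝ≥0) ^ ((k - j) + (j - k)))
            (fun j _ => by positivity) _).trans ?_
          gcongr
          refine le_trans (le_of_eq ?_) (hA k (J + 1))
          push_cast
          rfl
      _ = A * ∑ j ∈ Finset.range (J + 1),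
            ((((2 / 3 : ℝ≥0) ^ ((k - j) + (j - k)))⁻¹ : ℝ≥0) : ℝ≥0∞) * ∑' x, sqVar (a x k j) := by
          rw [ENNReal.tsum_mul_left, Summable.tsum_finsetSum fun _ _ => ENNReal.summable]
          simp_rw [ENNReal.tsum_mul_left]
      _ ≤ _ := by
          refine mul_le_mul_right (Finset.sum_le_sum fun j hj => ?_) _
          refine (mul_le_mul_right (tsum_sqVar_block_dyDiff_le
            (Nat.lt_succ_iff.1 (Finset.mem_range.1 hj)) hk φ) _).trans (le_of_eq ?_)
          rw [← hq]
          ring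
  calc _ ≤ ∑' x, 2 * ∑ k ∈ Finset.range J, sqVar (e x k) := ENNReal.tsum_le_tsum hsplit
    _ = 2 * ∑ k ∈ Finset.range J, ∑' x, sqVar (e x k) := by
        rw [ENNReal.tsum_mul_left, Summable.tsum_finsetSum fun _ _ => ENNReal.summable]
    _ ≤ 2 * ∑ k ∈ Finset.range J, A * ∑ j ∈ Finset.range (J + 1),
      5000 * (((3 / 4 : ℝ≥0) : ℝ≥0∞) ^ ((k - j) + (j - k)) * ∑' x, ‖dyDiff J φ j x‖ₑ ^ 2) := by
        gcongr with k hk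
        exact hblock k (Finset.mem_range.1 hk)
    _ = 2 * (A * (5000 * ∑ j ∈ Finset.range (J + 1), (∑ k ∈ Finset.range J,
      ((3 / 4 : ℝ≥0) : ℝ≥0∞) ^ ((j - k) + (k - j))) * ∑' x, ‖dyDiff J φ j x‖ₑ ^ 2)) := by
        rw [← Finset.mul_sum, Finset.sum_comm]
        congr 2
        rw [Finset.mul_sum]
        refine Finset.sum_congr rfl fun j _ => ?_
        rw [Finset.sum_mul, Finset.mul_sum]
        refine Finset.sum_congr rfl fun k _ => ?_
        rw [add_comm (k - j)]
    _ ≤ 2 * (A * (5000 * ∑ j ∈ Finset.range (J + 1), B * ∑' x, ‖dyDiff J φ j x‖ₑ ^ 2)) := by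
        gcongr with j _
        exact hB j J
    _ = _ := by
        rw [← Finset.mul_sum, sum_tsum_dyDiff_sq]
        push_cast
        ring

lemma add_sq_le_two_mul (a b : ℝ≥0∞) : (a + b) ^ 2 ≤ 2 * (a ^ 2 + b ^ 2) := by
  have h := ENNReal.rpow_add_le_mul_rpow_add_rpow a b (p := 2) (by norm_num)
  rw [show (2 : ℝ) - 1 = 1 by norm_num, ENNReal.rpow_one] at h
  simpa only [ENNReal.rpow_two] using h

/-- The variation of the averages of `φ`. -/
noncomputable def zVar (ρ : ℝ) (φ : ℤ → ℂ) (x : ℤ) : ℝ≥0∞ := seqVariation ρ fun L => zAvg L φ x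

lemma tsum_iSup_le {F : ℕ → ℤ → ℝ≥0∞} (hF : ∀ x, Monotone fun N => F N x) {B : ℝ≥0∞}
    (h : ∀ N, ∑' x, F N x ≤ B) : ∑' x, ⨆ N, F N x ≤ B := by
  have h1 := lintegral_iSup (μ := (Measure.count : Measure ℤ)) (f := F)
    (fun N => measurable_of_countable _) (fun i j hij x => hF x hij)
  simp only [lintegral_count] at h1
  rw [h1]
  exact iSup_le h

/-- The variational inequality in `ℓ²`. -/
theorem tsum_zVar_sq_le {ρ : ℝ} (hρ : 2 < ρ) : ∃ C : ℝ≥0, ∀ φ : ℤ → ℂ,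
    ∑' x, zVar ρ φ x ^ 2 ≤ C * ∑' x, ‖φ x‖ₑ ^ 2 := by
  obtain ⟨C₁, h₁⟩ := tsum_seqVariation_dyE_sq_le hρ
  obtain ⟨C₂, h₂⟩ := tsum_sqVar_zAvg_sub_dyE_le
  have hρ0 : 0 < ρ := by linarith
  refine ⟨2 * (C₁ + C₂), fun φ => ?_⟩
  -- Radii are truncated at `N`, so the martingale can be stopped at level N + 1; all constants are
  -- independent of `N`.
  have hsup : ∀ x, zVar ρ φ x ^ 2 = ⨆ N, seqVariation ρ (fun L => zAvg (min L N) φ x) ^ 2 := by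
    intro x
    rw [zVar, ← iSup_seqVariation_min hρ0]
    exact Monotone.map_iSup_of_continuousAt (f := fun t : ℝ≥0∞ => t ^ 2)
      (ENNReal.continuous_pow 2).continuousAt (fun a b h => pow_le_pow_left' h 2) (by simp)
  simp_rw [hsup]
  refine tsum_iSup_le (fun x i j hij => pow_le_pow_left'
    (seqVariation_min_mono hρ0 (fun L => zAvg L φ x) hij) 2) fun N => ?_
  have hlog : ∀ L, Nat.log 2 (min L N) < N + 1 := fun L =>
    Nat.lt_succ_of_le ((Nat.log_le_self 2 _).trans (min_le_right L N))
  have hmono : Monotone fun L => min L N := fun i j h => min_le_min_right N h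
  calc ∑' x, seqVariation ρ (fun L => zAvg (min L N) φ x) ^ 2
      ≤ ∑' x, 2 * (seqVariation ρ (fun L => dyE (Nat.log 2 (min L N)) φ x) ^ 2 +
          sqVar (fun L => if Nat.log 2 L < N + 1 then
            zAvg L φ x - dyE (Nat.log 2 L) φ x else 0)) := by
        refine ENNReal.tsum_le_tsum fun x => ?_
        set e : ℕ → ℂ := fun L => if Nat.log 2 L < N + 1 then
            zAvg L φ x - dyE (Nat.log 2 L) φ x else 0 with he
        have h1 : (fun L => zAvg (min L N) φ x) =
            fun L => dyE (Nat.log 2 (min L N)) φ x + e (min L N) := by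
          funext L
          rw [he]
          dsimp only
          rw [if_pos (hlog L)]
          ring
        rw [h1]
        calc _ ≤ (seqVariation ρ (fun L => dyE (Nat.log 2 (min L N)) φ x) + seqVariation ρ e) ^ 2 := by
              refine pow_le_pow_left' ((seqVariation_add_le (by linarith) _ _).trans ?_) 2
              gcongr
              exact seqVariation_comp_le hρ0 e hmono
          _ ≤ _ := add_sq_le_two_mul _ _
          _ ≤ _ := by
              gcongr
              exact seqVariation_sq_le_sqVar hρ.le e
    _ ≤ 2 * (C₁ * ∑' x, ‖φ x‖ₑ ^ 2 + C₂ * ∑' x, ‖φ x‖ₑ ^ 2) := by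
        rw [ENNReal.tsum_mul_left, ENNReal.tsum_add]
        gcongr
        · exact h₁ φ (N + 1) (fun L => Nat.log 2 (min L N))
            (fun i j h => Nat.log_mono_right (hmono h)) (fun L => (hlog L).le)
        · exact h₂ φ (N + 1)
    _ = _ := by push_cast; ring

/-! ### Calderón–Zygmund decomposition and exponents below two -/

/-- The tail kernel `ℓ / d ^ 2` restricted to `ℓ ≤ |d|`. -/
noncomputable def tailKernel (l : ℕ) (d : ℤ) : ℝ≥0∞ :=
  if l ≤ d.natAbs then l * ((d.natAbs : ℝ≥0∞)⁻¹) ^ 2 else 0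

lemma tsum_tail_inv_sq_le {l : ℕ} (hl : 1 ≤ l) :
    ∑' n : ℕ, (if l ≤ n then ((n : ℝ≥0∞)⁻¹) ^ 2 else 0) ≤ 2 * (l : ℝ≥0∞)⁻¹ := by
  have hl0 : (0 : ℝ) < l := by exact_mod_cast hl
  have hanti : ∀ n : ℕ, l ≤ n → 0 ≤ 2 * (n : ℝ)⁻¹ - 2 * ((n + 1 : ℕ) : ℝ)⁻¹ ∧
      ((n : ℝ)⁻¹) ^ 2 ≤ 2 * (n : ℝ)⁻¹ - 2 * ((n + 1 : ℕ) : ℝ)⁻¹ := by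
    intro n hn
    have hn0 : (1 : ℝ) ≤ n := by exact_mod_cast hl.trans hn
    have h : 2 * (n : ℝ)⁻¹ - 2 * ((n + 1 : ℕ) : ℝ)⁻¹ - ((n : ℝ)⁻¹) ^ 2 =
        (n - 1) / (n ^ 2 * (n + 1)) := by
      push_cast
      field_simp
      ring
    have h2 : 0 ≤ (n - 1 : ℝ) / (n ^ 2 * (n + 1)) := div_nonneg (by linarith) (by positivity)
    have h3 : 0 ≤ ((n : ℝ)⁻¹) ^ 2 := by positivity
    constructor <;> linarith
  rw [ENNReal.tsum_eq_iSup_nat]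
  refine iSup_le fun K => ?_
  rw [← Finset.sum_filter]
  have hsub : (Finset.range K).filter (fun n => l ≤ n) ⊆ Finset.Ico l (l + K) := by
    intro n hn
    simp only [Finset.mem_filter, Finset.mem_range, Finset.mem_Ico] at hn ⊢
    omega
  refine (Finset.sum_le_sum_of_subset hsub).trans ?_
  calc ∑ n ∈ Finset.Ico l (l + K), ((n : ℝ≥0∞)⁻¹) ^ 2
      ≤ ∑ n ∈ Finset.Ico l (l + K), ENNReal.ofReal (2 * (n : ℝ)⁻¹ - 2 * ((n + 1 : ℕ) : ℝ)⁻¹) := by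
        refine Finset.sum_le_sum fun n hn => ?_
        have hn1 := (Finset.mem_Ico.1 hn).1
        have hn0 : (0 : ℝ) < n := by exact_mod_cast hl.trans hn1
        rw [← ENNReal.ofReal_natCast, ← ENNReal.ofReal_inv_of_pos hn0,
          ← ENNReal.ofReal_pow (by positivity)]
        exact ENNReal.ofReal_le_ofReal (hanti n hn1).2
    _ = ENNReal.ofReal (2 * (l : ℝ)⁻¹ - 2 * ((l + K : ℕ) : ℝ)⁻¹) := by
        rw [← ENNReal.ofReal_sum_of_nonneg fun n hn => (hanti n (Finset.mem_Ico.1 hn).1).1]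
        congr 1
        have := Finset.sum_Ico_sub (fun n : ℕ => -(2 * (n : ℝ)⁻¹)) (Nat.le_add_right l K)
        simp only [neg_sub_neg] at this
        exact this
    _ ≤ ENNReal.ofReal (2 * (l : ℝ)⁻¹) :=
        ENNReal.ofReal_le_ofReal (sub_le_self _ (by positivity))
    _ = _ := by
        rw [ENNReal.ofReal_mul (by norm_num), ENNReal.ofReal_inv_of_pos hl0,
          ENNReal.ofReal_natCast, ENNReal.ofReal_ofNat]

/-- Each half line contributes l · 2/l. The bound is free of `l`, so atoms of every length have
tails proportional to their size. -/
lemma tsum_tailKernel_le {l : ℕ} (hl : 1 ≤ l) : ∑' d, tailKernel l d ≤ 4 := by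
  have hl0 : (l : ℝ≥0∞) ≠ 0 := by
    have : l ≠ 0 := by omega
    exact_mod_cast this
  have h0 : ∀ d : ℤ, tailKernel l d =
      l * (fun n : ℕ => if l ≤ n then ((n : ℝ≥0∞)⁻¹) ^ 2 else 0) d.natAbs := by
    intro d
    simp only [tailKernel]
    split_ifs <;> simp
  simp_rw [h0]
  rw [ENNReal.tsum_mul_left, tsum_of_nat_of_neg_add_one ENNReal.summable ENNReal.summable]
  have h1 := tsum_tail_inv_sq_le hl
  have h2 : ∑' n : ℕ, (fun n : ℕ => if l ≤ n then ((n : ℝ≥0∞)⁻¹) ^ 2 else 0) (-((n : ℤ) + 1)).natAbs ≤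
      2 * (l : ℝ≥0∞)⁻¹ := by
    refine le_trans ?_ h1
    exact ENNReal.tsum_comp_le_tsum_of_injective (f := fun n : ℕ => (-((n : ℤ) + 1)).natAbs)
      (fun a b h => by simp only at h; omega) (fun n : ℕ => if l ≤ n then ((n : ℝ≥0∞)⁻¹) ^ 2 else 0)
  calc _ ≤ (l : ℝ≥0∞) * (2 * (l : ℝ≥0∞)⁻¹ + 2 * (l : ℝ≥0∞)⁻¹) := by
        gcongr
        exact h1
    _ = 4 * ((l : ℝ≥0∞) * (l : ℝ≥0∞)⁻¹) := by ring
    _ = 4 := by rw [ENNReal.mul_inv_cancel hl0 (by simp), mul_one]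

/-- The left end point of the block of level `κ y` containing `y`. -/
def blockRep (κ : ℤ → ℕ) (y : ℤ) : ℤ := 2 ^ κ y * (y / 2 ^ κ y)

lemma blockRep_mem (κ : ℤ → ℕ) (y : ℤ) : blockRep κ y ∈ dyBlock (κ y) y := by
  have h2 : (0 : ℤ) < 2 ^ κ y := by positivity
  rw [dyBlock, Finset.mem_Ico, blockRep]
  constructor <;> linarith

/-- The `2`-variation of the averages of a sum of atoms, away from their supports. -/
lemma sqVar_zAvg_atoms_le {Ω : Set ℤ} (hΩ : Ω.Finite) {κ : ℤ → ℕ}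
    (hκ : ∀ y ∈ Ω, ∀ z ∈ dyBlock (κ y) y, z ∈ Ω ∧ κ z = κ y) {b : ℤ → ℂ} (hb : ∀ y ∉ Ω, b y = 0)
    (hmean : ∀ y ∈ Ω, ∑ z ∈ dyBlock (κ y) y, b z = 0) {A : ℝ≥0∞}
    (hA : ∀ y ∈ Ω, ∑ z ∈ dyBlock (κ y) y, ‖b z‖ₑ ≤ A * 2 ^ κ y) {x : ℤ} (hx : x ∉ Ω)
    (hx' : ∀ y ∈ Ω, x ≠ y + 2 ^ κ y ∧ x ≠ y - 2 ^ κ y) :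
    sqVar (fun L => zAvg L b x) ≤
      100 * A ^ 2 * ∑' y, Ω.indicator (fun y => tailKernel (2 ^ κ y) (x - y)) y := by
  classical
  -- The atoms are indexed by the left end points of their blocks.
  set s : Finset ℤ := hΩ.toFinset.filter fun r => blockRep κ r = r with hs
  have hsmem : ∀ {r}, r ∈ s ↔ r ∈ Ω ∧ blockRep κ r = r := by
    intro r; rw [hs, Finset.mem_filter, Set.Finite.mem_toFinset]
  have hblock : ∀ r ∈ s, dyBlock (κ r) r = Finset.Ico r (r + 2 ^ κ r) := by
    intro r hr
    have := (hsmem.1 hr).2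
    unfold blockRep at this
    rw [dyBlock, this]
  have hrep : ∀ r ∈ s, ∀ y ∈ dyBlock (κ r) r, y ∈ Ω ∧ κ y = κ r ∧ blockRep κ y = r := by
    intro r hr y hy
    obtain ⟨hrΩ, hr2⟩ := hsmem.1 hr
    obtain ⟨h1, h2⟩ := hκ r hrΩ y hy
    refine ⟨h1, h2, ?_⟩
    conv_rhs => rw [← hr2]
    rw [blockRep, blockRep, h2, mem_dyBlock.1 hy]
  have hrep_mem : ∀ y ∈ Ω, blockRep κ y ∈ s ∧ y ∈ dyBlock (κ (blockRep κ y)) (blockRep κ y) := by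
    intro y hy
    have h0 := blockRep_mem κ y
    obtain ⟨h1, h2⟩ := hκ y hy _ h0
    refine ⟨hsmem.2 ⟨h1, ?_⟩, ?_⟩
    · rw [blockRep, h2, mem_dyBlock.1 h0]; rfl
    · rw [h2, mem_dyBlock, mem_dyBlock.1 h0]
  let ψ : ℤ → ℤ → ℂ := fun r y => if y ∈ dyBlock (κ r) r then b y else 0
  have hbsum : b = fun y => ∑ r ∈ s, ψ r y := by
    funext y
    by_cases hy : y ∈ Ω
    · obtain ⟨h1, h2⟩ := hrep_mem y hy
      rw [Finset.sum_eq_single_of_mem _ h1]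
      · simp only [ψ]; rw [if_pos h2]
      · intro r hr hne
        simp only [ψ]
        exact if_neg fun h => hne (hrep r hr y h).2.2.symm
    · rw [hb y hy]
      symm
      refine Finset.sum_eq_zero fun r hr => ?_
      simp only [ψ]
      exact if_neg fun h => hy (hrep r hr y h).1
  -- distance from `x` to the block of `r`
  have hdist : ∀ r ∈ s, ∃ L₀ : ℕ, 2 ^ κ r ≤ L₀ ∧
      (∀ y ∈ dyBlock (κ r) r, (2 ^ κ r ≤ (x - y).natAbs) ∧ (x - y).natAbs ≤ 2 * L₀ + 1) ∧
      ((x + L₀ = r ∧ x < r) ∨ (x - L₀ = r + 2 ^ κ r - 1 ∧ r + 2 ^ κ r ≤ x)) := by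
    intro r hr
    have hpos : (0 : ℤ) < 2 ^ κ r := by positivity
    have hcast : ((2 ^ κ r : ℕ) : ℤ) = 2 ^ κ r := by push_cast; rfl
    -- If `x` lay in the block or in one of its two neighbours, it or its translate by the block
    -- length would be in Ω, against `hx` or `hx'`.
    have hout : x < r - 2 ^ κ r ∨ r + 2 * 2 ^ κ r ≤ x := by
      by_contra hcon
      push Not at hcon
      by_cases h1 : x < r
      · have hmem : x + 2 ^ κ r ∈ dyBlock (κ r) r := by
          rw [hblock r hr, Finset.mem_Ico]; constructor <;> linarith
        obtain ⟨h2, h3, -⟩ := hrep r hr _ hmem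
        apply (hx' _ h2).2
        rw [h3]; ring
      · by_cases h4 : x < r + 2 ^ κ r
        · have hmem : x ∈ dyBlock (κ r) r := by
            rw [hblock r hr, Finset.mem_Ico]; constructor <;> linarith
          exact hx (hrep r hr _ hmem).1
        · have hmem : x - 2 ^ κ r ∈ dyBlock (κ r) r := by
            rw [hblock r hr, Finset.mem_Ico]; constructor <;> linarith
          obtain ⟨h2, h3, -⟩ := hrep r hr _ hmem
          apply (hx' _ h2).1
          rw [h3]; ring
    rw [hblock r hr]
    rcases hout with h | h
    · refine ⟨(r - x).toNat, by omega, fun y hy => ?_, Or.inl (by omega)⟩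
      rw [Finset.mem_Ico] at hy
      omega
    · refine ⟨(x - (r + 2 ^ κ r - 1)).toNat, by omega, fun y hy => ?_, Or.inr (by omega)⟩
      rw [Finset.mem_Ico] at hy
      omega
  choose! L₀ hL₀ hL₁ hL₂ using hdist
  have hψ0 : ∀ r y, y ∉ dyBlock (κ r) r → ψ r y = 0 := fun r y hy => if_neg hy
  -- The window first touches the atom at radius `L₀ r` and has swallowed it, with its zero mean,
  -- before radius `L₀ r + 2 ^ κ r`.
  have hsupp : ∀ r ∈ s, ∀ L, ¬(L₀ r ≤ L ∧ L < L₀ r + 2 ^ κ r) → zAvg L (ψ r) x = 0 := by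
    intro r hr L hL
    have hcast : ((2 ^ κ r : ℕ) : ℤ) = 2 ^ κ r := by push_cast; rfl
    rw [zAvg]
    convert mul_zero _
    by_cases h1 : L₀ r ≤ L
    · rw [← hmean r (hsmem.1 hr).1]
      simp only [ψ]
      rw [← Finset.sum_filter]
      refine Finset.sum_congr ?_ fun _ _ => rfl
      ext y
      rw [Finset.mem_filter, Finset.mem_Icc, and_iff_right_iff_imp, hblock r hr, Finset.mem_Ico]
      intro hy
      rcases hL₂ r hr with h2 | h2 <;> omega
    · refine Finset.sum_eq_zero fun y hy => hψ0 r y ?_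
      rw [Finset.mem_Icc] at hy
      rw [hblock r hr, Finset.mem_Ico]
      rcases hL₂ r hr with h2 | h2 <;> omega
  -- A contributing atom must contain x + L or x - L.
  have hover : ∀ L, (s.filter fun r => zAvg L (ψ r) x ≠ 0).card ≤ 2 := by
    intro L
    refine (Finset.card_le_card (t := {blockRep κ (x + L), blockRep κ (x - L)}) ?_).trans
      Finset.card_le_two
    intro r hr
    rw [Finset.mem_filter] at hr
    obtain ⟨hr, hne⟩ := hr
    have hcast : ((2 ^ κ r : ℕ) : ℤ) = 2 ^ κ r := by push_cast; rfl
    have hL : L₀ r ≤ L ∧ L < L₀ r + 2 ^ κ r := by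
      by_contra hcon
      exact hne (hsupp r hr L hcon)
    rw [Finset.mem_insert, Finset.mem_singleton]
    rcases hL₂ r hr with h2 | h2
    · left
      refine (hrep r hr (x + L) ?_).2.2.symm
      rw [hblock r hr, Finset.mem_Ico]; omega
    · right
      refine (hrep r hr (x - L) ?_).2.2.symm
      rw [hblock r hr, Finset.mem_Ico]; omega
  have hpart : ∀ r ∈ s, sqVar (fun L => zAvg L (ψ r) x) ≤
      25 * A ^ 2 * ∑ y ∈ dyBlock (κ r) r, tailKernel (2 ^ κ y) (x - y) := by
    intro r hr
    have h1 : (fun L => zAvg L (ψ r) x) =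
        fun L => if L₀ r ≤ L ∧ L < L₀ r + 2 ^ κ r then zAvg L (ψ r) x else 0 := by
      funext L
      split_ifs with h
      · rfl
      · exact hsupp r hr L h
    rw [h1]
    refine (sqVar_restrict_zAvg_le _ x _ _).trans ?_
    have h2 : ∑' y, ‖ψ r y‖ₑ ≤ A * 2 ^ κ r := by
      rw [tsum_eq_sum (s := dyBlock (κ r) r) fun y hy => by rw [hψ0 r y hy, enorm_zero]]
      refine le_trans (Finset.sum_le_sum fun y hy => ?_) (hA r (hsmem.1 hr).1)
      simp only [ψ, if_pos hy, le_refl]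
    set W := ENNReal.ofReal (2 * (L₀ r : ℝ) + 1)⁻¹ with hW
    have h3 : ∀ y ∈ dyBlock (κ r) r, 2 ^ κ r * W ^ 2 ≤ tailKernel (2 ^ κ y) (x - y) := by
      intro y hy
      obtain ⟨h4, h5⟩ := hL₁ r hr y hy
      rw [tailKernel, (hrep r hr y hy).2.1, if_pos h4]
      push_cast
      gcongr
      rw [hW, ENNReal.ofReal_inv_of_pos (by positivity)]
      gcongr
      rw [show (2 * (L₀ r : ℝ) + 1) = ((2 * L₀ r + 1 : ℕ) : ℝ) by push_cast; ring,
        ENNReal.ofReal_natCast]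
      exact_mod_cast h5
    calc 25 * (W * ∑' y, ‖ψ r y‖ₑ) ^ 2 ≤ 25 * (W * (A * 2 ^ κ r)) ^ 2 := by gcongr
      _ = 25 * A ^ 2 * (2 ^ κ r * (2 ^ κ r * W ^ 2)) := by ring
      _ = 25 * A ^ 2 * ∑ y ∈ dyBlock (κ r) r, 2 ^ κ r * W ^ 2 := by
          rw [Finset.sum_const, card_dyBlock, nsmul_eq_mul]
          push_cast
          rfl
      _ ≤ _ := by
          gcongr with y hy
          exact h3 y hy
  have hb2 : (fun L => zAvg L b x) = fun L => ∑ r ∈ s, zAvg L (ψ r) x := by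
    funext L
    rw [← zAvg_sum, ← hbsum]
  rw [hb2]
  refine (sqVar_sum_le_of_overlap s (fun r L => zAvg L (ψ r) x) 2 hover).trans ?_
  calc 2 * ((2 : ℕ) : ℝ≥0∞) * ∑ r ∈ s, sqVar (fun L => zAvg L (ψ r) x)
      ≤ 2 * ((2 : ℕ) : ℝ≥0∞) * ∑ r ∈ s,
          25 * A ^ 2 * ∑ y ∈ dyBlock (κ r) r, tailKernel (2 ^ κ y) (x - y) := by
        gcongr with r hr
        exact hpart r hr
    _ = 100 * A ^ 2 * ∑ y ∈ s.biUnion (fun r => dyBlock (κ r) r), tailKernel (2 ^ κ y) (x - y) := by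
        rw [Finset.sum_biUnion]
        · rw [← Finset.mul_sum]; push_cast; ring
        · intro r hr r' hr' hne
          rw [Function.onFun, Finset.disjoint_left]
          intro y hy hy'
          exact hne ((hrep r hr y hy).2.2.symm.trans (hrep r' hr' y hy').2.2)
    _ ≤ _ := by
        gcongr
        refine le_trans (le_of_eq (Finset.sum_congr rfl fun y hy => ?_)) (ENNReal.sum_le_tsum _)
        · obtain ⟨r, hr, hy⟩ := Finset.mem_biUnion.1 hy
          rw [Set.indicator_of_mem (hrep r hr y hy).1]

lemma zVar_add_le {ρ : ℝ} (hρ : 1 ≤ ρ) (φ ψ : ℤ → ℂ) (x : ℤ) :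
    zVar ρ (fun y => φ y + ψ y) x ≤ zVar ρ φ x + zVar ρ ψ x := by
  unfold zVar
  simp_rw [zAvg_add]
  exact seqVariation_add_le hρ _ _

lemma sq_mul_indicator_lt_le (S : Set ℤ) (F G : ℤ → ℝ≥0∞) (t : ℝ≥0∞) (x : ℤ)
    (h : x ∈ S → F x ^ 2 ≤ G x) :
    t ^ 2 * (S ∩ {x | t < F x}).indicator 1 x ≤ S.indicator G x := by
  by_cases hx : x ∈ S ∩ {x | t < F x}
  · rw [Set.indicator_of_mem hx, Set.indicator_of_mem hx.1, Pi.one_apply, mul_one]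
    exact (pow_le_pow_left' (le_of_lt hx.2) 2).trans (h hx.1)
  · rw [Set.indicator_of_notMem hx, mul_zero]
    exact zero_le

lemma sq_mul_distr_le (F : ℤ → ℝ≥0∞) (t : ℝ≥0∞) : t ^ 2 * distr F t ≤ ∑' x, F x ^ 2 := by
  rw [distr, ← ENNReal.tsum_mul_left]
  refine ENNReal.tsum_le_tsum fun x => ?_
  simpa using sq_mul_indicator_lt_le Set.univ F (fun x => F x ^ 2) t x (fun _ => le_rfl)

lemma tsum_indicator_image_le (Ω : Set ℤ) (f : ℤ → ℤ) :
    ∑' x, (f '' Ω).indicator (1 : ℤ → ℝ≥0∞) x ≤ ∑' y, Ω.indicator (1 : ℤ → ℝ≥0∞) y := by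
  classical
  calc ∑' x, (f '' Ω).indicator (1 : ℤ → ℝ≥0∞) x
      ≤ ∑' x, ∑' y, if x = f y then Ω.indicator (1 : ℤ → ℝ≥0∞) y else 0 := by
        refine ENNReal.tsum_le_tsum fun x => ?_
        by_cases hx : x ∈ f '' Ω
        · obtain ⟨y, hy, rfl⟩ := hx
          refine le_trans ?_ (ENNReal.le_tsum y)
          simpa [hy] using Set.indicator_le_self' (f := (1 : ℤ → ℝ≥0∞)) (fun _ _ => zero_le) (f y)
        · simp [hx]
    _ = _ := by
        rw [ENNReal.tsum_comm]
        simp only [tsum_ite_eq]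

lemma indicator_one_union_le (S T : Set ℤ) (x : ℤ) :
    (S ∪ T).indicator (1 : ℤ → ℝ≥0∞) x ≤ S.indicator 1 x + T.indicator 1 x := by
  by_cases h1 : x ∈ S <;> by_cases h2 : x ∈ T <;> simp [h1, h2]

/-- The level set estimate behind the strong type bounds below `2`. -/
lemma sq_mul_distr_zVar_le {ρ : ℝ} (hρ : 2 < ρ) : ∃ C : ℝ≥0, ∀ φ : ℤ → ℂ, ∑' x, ‖φ x‖ₑ ≠ ∞ →
    ∀ t : ℝ≥0∞, t ≠ 0 → t ≠ ∞ →
      t ^ 2 * distr (zVar ρ φ) (2 * t) ≤ C * (t ^ 2 * distr (dyMax fun y => ‖φ y‖ₑ) t +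
        ∑' x, {x | dyMax (fun y => ‖φ y‖ₑ) x ≤ t}.indicator (fun x => ‖φ x‖ₑ ^ 2) x) := by
  classical
  obtain ⟨C, hC⟩ := tsum_zVar_sq_le hρ
  refine ⟨4 * C + 3 + 6400, fun φ hφ t ht ht' => ?_⟩
  set h : ℤ → ℝ≥0∞ := fun y => ‖φ y‖ₑ with hh
  obtain ⟨K, hK⟩ := dyA_eventually_le hφ ht
  obtain ⟨κ, hκ⟩ := exists_stopping h t fun x => ⟨K, hK x⟩
  set Ω : Set ℤ := {x | t < dyMax h x} with hΩdef
  have hΩc : {x | dyMax h x ≤ t} = Ωᶜ := by ext x; simp [hΩdef]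
  have hcons : ∀ y ∈ Ω, ∀ z ∈ dyBlock (κ y) y, z ∈ Ω ∧ κ z = κ y := fun y hy => (hκ y hy).2.2
  set D := distr (dyMax h) t with hD
  have hDeq : ∑' x, Ω.indicator (1 : ℤ → ℝ≥0∞) x = D := rfl
  have hDfin : D ≠ ∞ := by
    intro hcon
    have := mul_distr_dyMax_le h t
    rw [← hD, hcon, ENNReal.mul_top ht] at this
    exact hφ (top_le_iff.1 this)
  have hΩfin : Ω.Finite := by
    have := ENNReal.finite_const_le_of_tsum_ne_top (hDeq.trans_ne hDfin) (one_ne_zero)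
    refine this.subset fun x hx => ?_
    simp [hx]
  set N := ∑' x, Ωᶜ.indicator (fun x => ‖φ x‖ₑ ^ 2) x with hN
  -- Calderón–Zygmund decomposition at height `t`: `g` averages over the maximal blocks, and `b` is
  -- a sum of atoms of mean zero.
  let g : ℤ → ℂ := fun x => if x ∈ Ω then dyE (κ x) φ x else φ x
  let b : ℤ → ℂ := fun x => φ x - g x
  -- By maximality the parent block has average at most `t`, and it is twice as long.
  have hA2 : ∀ x ∈ Ω, dyA (κ x) h x ≤ 2 * t := fun x hx =>
    (dyA_le_two_mul_succ _ h x).trans (by gcongr; exact (hκ x hx).2.1 _ (Nat.lt_succ_self _))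
  have hg : ∀ x ∈ Ω, ‖g x‖ₑ ≤ 2 * t := fun x hx => by
    simp only [g, if_pos hx]
    exact (enorm_dyE_le _ φ x).trans (hA2 x hx)
  have hgconst : ∀ y ∈ Ω, ∀ z ∈ dyBlock (κ y) y, g z = dyE (κ y) φ y := fun y hy z hz => by
    obtain ⟨h1, h2⟩ := hcons y hy z hz
    simp only [g, if_pos h1, h2]
    exact dyE_congr (mem_dyBlock.1 hz) φ
  have hgsq : ∑' x, ‖g x‖ₑ ^ 2 ≤ N + 4 * (t ^ 2 * D) := by
    calc ∑' x, ‖g x‖ₑ ^ 2 ≤ ∑' x, (Ωᶜ.indicator (fun x => ‖φ x‖ₑ ^ 2) x +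
          4 * t ^ 2 * Ω.indicator (1 : ℤ → ℝ≥0∞) x) := by
          refine ENNReal.tsum_le_tsum fun x => ?_
          by_cases hx : x ∈ Ω
          · have := pow_le_pow_left' (hg x hx) 2
            rw [mul_pow] at this
            simp only [Set.indicator_of_mem hx, Pi.one_apply, mul_one]
            refine this.trans (le_add_left (le_of_eq ?_))
            norm_num
          · simp [hx, g]
      _ = _ := by rw [ENNReal.tsum_add, ENNReal.tsum_mul_left, hDeq, mul_assoc]
  have hb0 : ∀ y ∉ Ω, b y = 0 := fun y hy => by simp [b, g, hy]
  have hpk : ∀ k : ℕ, ((2 : ℂ) ^ k) ≠ 0 := fun k => pow_ne_zero _ two_ne_zero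
  have hmean : ∀ y ∈ Ω, ∑ z ∈ dyBlock (κ y) y, b z = 0 := fun y hy => by
    simp only [b]
    rw [Finset.sum_sub_distrib, Finset.sum_congr rfl (hgconst y hy), Finset.sum_const, card_dyBlock,
      nsmul_eq_mul, dyE]
    push_cast
    rw [← mul_assoc, mul_inv_cancel₀ (hpk _), one_mul, sub_self]
  have hbA : ∀ y ∈ Ω, ∑ z ∈ dyBlock (κ y) y, ‖b z‖ₑ ≤ 4 * t * 2 ^ κ y := fun y hy => by
    calc ∑ z ∈ dyBlock (κ y) y, ‖b z‖ₑ ≤ ∑ z ∈ dyBlock (κ y) y, (h z + 2 * t) := by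
          refine Finset.sum_le_sum fun z hz => enorm_sub_le.trans ?_
          gcongr
          exact hg z (hcons y hy z hz).1
      _ = 2 ^ κ y * dyA (κ y) h y + 2 ^ κ y * (2 * t) := by
          rw [Finset.sum_add_distrib, two_pow_mul_dyA, Finset.sum_const, card_dyBlock, nsmul_eq_mul]
          push_cast
          rfl
      _ ≤ 2 ^ κ y * (2 * t) + 2 ^ κ y * (2 * t) := by
          gcongr
          exact hA2 y hy
      _ = _ := by ring
  -- The maximal blocks with their two neighbours: at most three times as many points, and off `E`
  -- the atoms are seen from a distance.
  set E : Set ℤ := Ω ∪ ((fun y => y + 2 ^ κ y) '' Ω ∪ (fun y => y - 2 ^ κ y) '' Ω) with hE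
  have hEcount : ∑' x, E.indicator (1 : ℤ → ℝ≥0∞) x ≤ 3 * D := by
    calc ∑' x, E.indicator (1 : ℤ → ℝ≥0∞) x
        ≤ ∑' x, (Ω.indicator (1 : ℤ → ℝ≥0∞) x + (((fun y => y + 2 ^ κ y) '' Ω).indicator 1 x +
            ((fun y => y - 2 ^ κ y) '' Ω).indicator 1 x)) := by
          refine ENNReal.tsum_le_tsum fun x => ?_
          exact (indicator_one_union_le _ _ x).trans (add_le_add_right (indicator_one_union_le _ _ x) _)
      _ ≤ D + (D + D) := by
          rw [ENNReal.tsum_add, ENNReal.tsum_add]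
          gcongr
          · exact hDeq.le
          · exact tsum_indicator_image_le Ω _
          · exact tsum_indicator_image_le Ω _
      _ = 3 * D := by ring
  have hbad : t ^ 2 * ∑' x, (Eᶜ ∩ {x | t < zVar ρ b x}).indicator (1 : ℤ → ℝ≥0∞) x ≤
      6400 * (t ^ 2 * D) := by
    rw [← ENNReal.tsum_mul_left]
    calc ∑' x, t ^ 2 * (Eᶜ ∩ {x | t < zVar ρ b x}).indicator (1 : ℤ → ℝ≥0∞) x
        ≤ ∑' x, 100 * (4 * t) ^ 2 *
            ∑' y, Ω.indicator (fun y => tailKernel (2 ^ κ y) (x - y)) y := by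
          refine ENNReal.tsum_le_tsum fun x => ?_
          refine (sq_mul_indicator_lt_le Eᶜ (zVar ρ b) (fun x => 100 * (4 * t) ^ 2 *
            ∑' y, Ω.indicator (fun y => tailKernel (2 ^ κ y) (x - y)) y) t x fun hx => ?_).trans
            (Set.indicator_le_self' (fun _ _ => zero_le) x)
          refine (seqVariation_sq_le_sqVar hρ.le _).trans ?_
          simp only [hE, Set.compl_union, Set.mem_inter_iff, Set.mem_compl_iff, Set.mem_image,
            not_exists, not_and] at hx
          exact sqVar_zAvg_atoms_le hΩfin hcons hb0 hmean hbA hx.1 fun y hy =>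
            ⟨fun h => hx.2.1 y hy h.symm, fun h => hx.2.2 y hy h.symm⟩
      _ = 1600 * t ^ 2 * ∑' y, Ω.indicator (fun y => ∑' x, tailKernel (2 ^ κ y) (x - y)) y := by
          rw [ENNReal.tsum_mul_left, ENNReal.tsum_comm]
          congr 1
          · ring
          · refine tsum_congr fun y => ?_
            by_cases hy : y ∈ Ω <;> simp [hy]
      _ ≤ 1600 * t ^ 2 * ∑' y, 4 * Ω.indicator (1 : ℤ → ℝ≥0∞) y := by
          gcongr with y
          by_cases hy : y ∈ Ω
          · rw [Set.indicator_of_mem hy, Set.indicator_of_mem hy, Pi.one_apply, mul_one]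
            simp_rw [sub_eq_add_neg]
            rw [tsum_shift (-y) (tailKernel (2 ^ κ y))]
            exact tsum_tailKernel_le Nat.one_le_two_pow
          · simp [hy]
      _ = _ := by rw [ENNReal.tsum_mul_left, hDeq]; ring
  have hdistr : distr (zVar ρ φ) (2 * t) ≤ distr (zVar ρ g) t +
      (∑' x, E.indicator (1 : ℤ → ℝ≥0∞) x +
        ∑' x, (Eᶜ ∩ {x | t < zVar ρ b x}).indicator (1 : ℤ → ℝ≥0∞) x) := by
    unfold distr
    rw [← ENNReal.tsum_add, ← ENNReal.tsum_add]
    refine ENNReal.tsum_le_tsum fun x => ?_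
    by_cases hx : 2 * t < zVar ρ φ x
    · have hle : zVar ρ φ x ≤ zVar ρ g x + zVar ρ b x := by
        refine le_of_eq_of_le ?_ (zVar_add_le (by linarith) g b x)
        congr 1
        funext y
        simp [b]
      have hone : ({x | 2 * t < zVar ρ φ x} : Set ℤ).indicator (1 : ℤ → ℝ≥0∞) x = 1 :=
        Set.indicator_of_mem (show x ∈ {x | 2 * t < zVar ρ φ x} from hx) _
      rw [hone]
      by_cases h1 : t < zVar ρ g x
      · rw [Set.indicator_of_mem (show x ∈ {x | t < zVar ρ g x} from h1)]
        exact le_self_add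
      · by_cases h2 : x ∈ E
        · rw [Set.indicator_of_mem h2]
          exact le_add_left le_self_add
        · have h3 : t < zVar ρ b x := by
            by_contra h3
            rw [two_mul] at hx
            exact absurd (hx.trans_le hle) (not_lt.2 (add_le_add (not_lt.1 h1) (not_lt.1 h3)))
          rw [Set.indicator_of_mem (show x ∈ Eᶜ ∩ {x | t < zVar ρ b x} from ⟨h2, h3⟩)]
          exact le_add_left le_add_self
    · rw [Set.indicator_of_notMem (show x ∉ {x | 2 * t < zVar ρ φ x} from hx)]
      exact zero_le
  rw [hΩc, ← hN]
  calc t ^ 2 * distr (zVar ρ φ) (2 * t)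
      ≤ t ^ 2 * (distr (zVar ρ g) t + (∑' x, E.indicator (1 : ℤ → ℝ≥0∞) x +
        ∑' x, (Eᶜ ∩ {x | t < zVar ρ b x}).indicator (1 : ℤ → ℝ≥0∞) x)) := by gcongr
    _ = t ^ 2 * distr (zVar ρ g) t + (t ^ 2 * ∑' x, E.indicator (1 : ℤ → ℝ≥0∞) x +
        t ^ 2 * ∑' x, (Eᶜ ∩ {x | t < zVar ρ b x}).indicator (1 : ℤ → ℝ≥0∞) x) := by ring
    -- Chebyshev and ℓ² for the good part, counting for `E`, kernel tails for the atoms; 6400 = 100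
    -- · 4² · 4.
    _ ≤ C * (N + 4 * (t ^ 2 * D)) + (t ^ 2 * (3 * D) + 6400 * (t ^ 2 * D)) := by
        refine add_le_add ?_ (add_le_add ?_ hbad)
        · exact (sq_mul_distr_le _ t).trans ((hC g).trans (by gcongr))
        · gcongr
    _ = (4 * C + 3 + 6400) * (t ^ 2 * D) + C * N := by ring
    _ ≤ (4 * C + 3 + 6400) * (t ^ 2 * D) + (4 * C + 3 + 6400) * N := by
        gcongr
        calc (C : ℝ≥0∞) ≤ 4 * C := le_mul_of_one_le_left zero_le (by norm_num)
          _ ≤ _ := by rw [add_assoc]; exact le_self_add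
    _ = _ := by push_cast; ring

/-- The integrand is p c² t^(p-3) on t ≥ M, integrable at infinity precisely because p < 2. It is
applied with `M` the dyadic maximal function and `c` the modulus of φ. -/
lemma lintegral_layer_tail_le {p : ℝ} (hp : 0 < p) (hp2 : p < 2) {M c : ℝ≥0∞} (hc : c ≤ M) :
    ∫⁻ t in Set.Ioi (0 : ℝ), ENNReal.ofReal (p * t ^ (p - 1)) * ((ENNReal.ofReal t ^ 2)⁻¹ *
      (if M ≤ ENNReal.ofReal t then c ^ 2 else 0)) ≤ ENNReal.ofReal (p / (2 - p)) * M ^ p := by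
  rcases eq_or_ne M 0 with rfl | hM0
  · simp [le_zero_iff.1 hc]
  rcases eq_or_ne M ∞ with rfl | hM
  · simp
  lift M to ℝ≥0 using hM
  have hMpos : (0 : ℝ) < M := by
    have : M ≠ 0 := by simpa using hM0
    exact_mod_cast pos_iff_ne_zero.2 this
  have hpp : p - 3 < -1 := by linarith
  have hint := integrableOn_Ioi_rpow_of_lt hpp hMpos
  calc ∫⁻ t in Set.Ioi (0 : ℝ), ENNReal.ofReal (p * t ^ (p - 1)) * ((ENNReal.ofReal t ^ 2)⁻¹ *
      (if (M : ℝ≥0∞) ≤ ENNReal.ofReal t then c ^ 2 else 0))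
      ≤ ∫⁻ t in Set.Ioi (0 : ℝ), (Set.Ici (M : ℝ)).indicator
          (fun t => ENNReal.ofReal (p * M ^ 2) * ENNReal.ofReal (t ^ (p - 3))) t := by
        refine setLIntegral_mono_ae' measurableSet_Ioi (ae_of_all _ fun t ht => ?_)
        have ht' : (0 : ℝ) < t := ht
        by_cases h : (M : ℝ≥0∞) ≤ ENNReal.ofReal t
        · have h2 : t ∈ Set.Ici (M : ℝ) := by
            rw [← ENNReal.ofReal_coe_nnreal] at h
            exact (ENNReal.ofReal_le_ofReal_iff ht'.le).1 h
          rw [if_pos h, Set.indicator_of_mem h2, ← ENNReal.ofReal_pow ht'.le,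
            ← ENNReal.ofReal_inv_of_pos (by positivity)]
          calc _ ≤ ENNReal.ofReal (p * t ^ (p - 1)) * (ENNReal.ofReal (t ^ 2)⁻¹ * (M : ℝ≥0∞) ^ 2) := by
                gcongr
            _ = _ := by
                rw [← ENNReal.ofReal_coe_nnreal, ← ENNReal.ofReal_pow (NNReal.coe_nonneg M),
                  ← ENNReal.ofReal_mul (by positivity), ← ENNReal.ofReal_mul (by positivity),
                  ← ENNReal.ofReal_mul (by positivity)]
                congr 1
                rw [show p - 3 = p - 1 - (2 : ℕ) by push_cast; ring, Real.rpow_sub_natCast ht'.ne']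
                field_simp
        · simp [h]
    _ ≤ ∫⁻ t, (Set.Ici (M : ℝ)).indicator
          (fun t => ENNReal.ofReal (p * M ^ 2) * ENNReal.ofReal (t ^ (p - 3))) t :=
        setLIntegral_le_lintegral _ _
    _ = ENNReal.ofReal (p * M ^ 2) * ENNReal.ofReal (∫ t in Set.Ioi (M : ℝ), t ^ (p - 3)) := by
        rw [lintegral_indicator measurableSet_Ici, ← setLIntegral_congr Ioi_ae_eq_Ici,
          lintegral_const_mul' _ _ (by simp), ofReal_integral_eq_lintegral_ofReal hint]
        refine (ae_restrict_iff' measurableSet_Ioi).2 (ae_of_all _ fun t ht => ?_)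
        exact Real.rpow_nonneg (hMpos.le.trans (le_of_lt ht)) _
    _ = _ := by
        rw [integral_Ioi_rpow_of_lt hpp hMpos, ← ENNReal.ofReal_coe_nnreal,
          ENNReal.ofReal_rpow_of_nonneg (NNReal.coe_nonneg M) hp.le,
          ← ENNReal.ofReal_mul (by positivity),
          ← ENNReal.ofReal_mul (div_nonneg hp.le (by linarith))]
        congr 1
        rw [show p = (p - 3 + 1) + (2 : ℕ) by push_cast; ring, Real.rpow_add_natCast hMpos.ne']
        have h1 : p - 3 + 1 ≠ 0 := by linarith
        have h2 : 2 - (p - 3 + 1 + (2 : ℕ)) = -(p - 3 + 1) := by push_cast; ring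
        rw [h2, show p - 3 + 1 + ((2 : ℕ) : ℝ) - 3 + 1 = p - 3 + 1 by push_cast; ring]
        field_simp

/-- The variational inequality for exponents below two. -/
theorem tsum_zVar_rpow_le_of_lt_two {ρ : ℝ} (hρ : 2 < ρ) {p : ℝ} (hp : 1 < p) (hp2 : p < 2) :
    ∃ C : ℝ≥0, ∀ φ : ℤ → ℂ, ∑' x, ‖φ x‖ₑ ≠ ∞ →
      ∑' x, zVar ρ φ x ^ p ≤ C * ∑' x, ‖φ x‖ₑ ^ p := by
  obtain ⟨C, hC⟩ := sq_mul_distr_zVar_le hρ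
  have hp0 : 0 < p := by linarith
  refine ⟨2 ^ p * (C * ((1 + (p / (2 - p)).toNNReal) * (2 ^ p * (p / (p - 1)).toNNReal))),
    fun φ hφ => ?_⟩
  set h : ℤ → ℝ≥0∞ := fun y => ‖φ y‖ₑ with hh
  have hpt : ∀ t : ℝ, 0 < t → distr (zVar ρ φ) (2 * ENNReal.ofReal t) ≤
      C * (distr (dyMax h) (ENNReal.ofReal t) + ∑' x, (ENNReal.ofReal t ^ 2)⁻¹ *
        (if dyMax h x ≤ ENNReal.ofReal t then h x ^ 2 else 0)) := by
    intro t ht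
    have h0 : ENNReal.ofReal t ≠ 0 := by simpa using ht
    have h1 := hC φ hφ (ENNReal.ofReal t) h0 (by simp)
    have h2 : (ENNReal.ofReal t ^ 2)⁻¹ * ENNReal.ofReal t ^ 2 = 1 :=
      ENNReal.inv_mul_cancel (pow_ne_zero _ h0) (by simp)
    calc distr (zVar ρ φ) (2 * ENNReal.ofReal t)
        = (ENNReal.ofReal t ^ 2)⁻¹ * (ENNReal.ofReal t ^ 2 *
            distr (zVar ρ φ) (2 * ENNReal.ofReal t)) := by rw [← mul_assoc, h2, one_mul]
      _ ≤ (ENNReal.ofReal t ^ 2)⁻¹ * (C * (ENNReal.ofReal t ^ 2 * distr (dyMax h) (ENNReal.ofReal t) +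
            ∑' x, {x | dyMax h x ≤ ENNReal.ofReal t}.indicator (fun x => h x ^ 2) x)) := by gcongr
      _ = C * (((ENNReal.ofReal t ^ 2)⁻¹ * ENNReal.ofReal t ^ 2) * distr (dyMax h) (ENNReal.ofReal t) +
            (ENNReal.ofReal t ^ 2)⁻¹ *
            ∑' x, {x | dyMax h x ≤ ENNReal.ofReal t}.indicator (fun x => h x ^ 2) x) := by ring
      _ = _ := by
          rw [h2, one_mul, ENNReal.tsum_mul_left]
          simp only [Set.indicator_apply, Set.mem_ofPred_eq]
  have hmeas : ∀ x, Measurable fun t : ℝ => ENNReal.ofReal (p * t ^ (p - 1)) *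
      ((ENNReal.ofReal t ^ 2)⁻¹ * (if dyMax h x ≤ ENNReal.ofReal t then h x ^ 2 else 0)) := by
    intro x
    refine Measurable.mul (by fun_prop) (Measurable.mul (by fun_prop)
      (Measurable.ite ?_ measurable_const measurable_const))
    exact measurableSet_le measurable_const (by fun_prop)
  have htail : ∫⁻ t in Set.Ioi (0 : ℝ), ENNReal.ofReal (p * t ^ (p - 1)) *
      (∑' x, (ENNReal.ofReal t ^ 2)⁻¹ *
        (if dyMax h x ≤ ENNReal.ofReal t then h x ^ 2 else 0)) ≤
      ENNReal.ofReal (p / (2 - p)) * ∑' x, dyMax h x ^ p := by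
    simp_rw [← ENNReal.tsum_mul_left]
    rw [lintegral_tsum fun x => (hmeas x).aemeasurable]
    exact ENNReal.tsum_le_tsum fun x => lintegral_layer_tail_le hp0 hp2 (self_le_dyMax h x)
  have hdistr_meas : Measurable fun t : ℝ => ENNReal.ofReal (p * t ^ (p - 1)) *
      (∑' x, (ENNReal.ofReal t ^ 2)⁻¹ *
        (if dyMax h x ≤ ENNReal.ofReal t then h x ^ 2 else 0)) := by
    simp_rw [← ENNReal.tsum_mul_left]
    exact Measurable.tsum hmeas
  calc ∑' x, zVar ρ φ x ^ p
      = 2 ^ p * ∫⁻ t in Set.Ioi (0 : ℝ), ENNReal.ofReal (p * t ^ (p - 1)) *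
          distr (zVar ρ φ) (2 * ENNReal.ofReal t) := by
        have := tsum_rpow_eq_lintegral_mul hp0 (two_ne_zero : (2 : ℝ≥0) ≠ 0) (zVar ρ φ)
        exact_mod_cast this
    _ ≤ 2 ^ p * ∫⁻ t in Set.Ioi (0 : ℝ), C * (ENNReal.ofReal (p * t ^ (p - 1)) *
          distr (dyMax h) (ENNReal.ofReal t) + ENNReal.ofReal (p * t ^ (p - 1)) *
          (∑' x, (ENNReal.ofReal t ^ 2)⁻¹ *
            (if dyMax h x ≤ ENNReal.ofReal t then h x ^ 2 else 0))) := by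
        refine mul_le_mul_right (setLIntegral_mono_ae' measurableSet_Ioi
          (ae_of_all _ fun t ht => ?_)) _
        refine (mul_le_mul_right (hpt t ht) _).trans (le_of_eq ?_)
        ring
    _ = 2 ^ p * (C * (∑' x, dyMax h x ^ p + ∫⁻ t in Set.Ioi (0 : ℝ), ENNReal.ofReal (p * t ^ (p - 1)) *
          (∑' x, (ENNReal.ofReal t ^ 2)⁻¹ *
            (if dyMax h x ≤ ENNReal.ofReal t then h x ^ 2 else 0)))) := by
        rw [lintegral_const_mul' _ _ (by simp), lintegral_add_right _ hdistr_meas,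
          ← tsum_rpow_eq_lintegral hp0]
    _ ≤ 2 ^ p * (C * (∑' x, dyMax h x ^ p + ENNReal.ofReal (p / (2 - p)) * ∑' x, dyMax h x ^ p)) := by
        gcongr
    _ = 2 ^ p * (C * ((1 + ENNReal.ofReal (p / (2 - p))) * ∑' x, dyMax h x ^ p)) := by ring
    _ ≤ 2 ^ p * (C * ((1 + ENNReal.ofReal (p / (2 - p))) *
          (2 ^ p * ENNReal.ofReal (p / (p - 1)) * ∑' x, h x ^ p))) := by
        gcongr
        exact tsum_dyMax_rpow_le hp h
    _ = _ := by
        have h2p : (((2 : ℝ≥0) ^ p : ℝ≥0) : ℝ≥0∞) = 2 ^ p := by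
          rw [ENNReal.coe_rpow_of_nonneg _ hp0.le]; norm_num
        push_cast
        rw [h2p]
        simp only [ENNReal.ofReal]
        ring

/-! ### Exponents above two -/

lemma dyA_sq_le (k : ℕ) (h : ℤ → ℝ≥0∞) (x : ℤ) : dyA k h x ^ 2 ≤ dyA k (fun y => h y ^ 2) x := by
  have h1 := ENNReal.rpow_sum_le_const_mul_sum_rpow (dyBlock k x) h (p := 2) (by norm_num)
  rw [show (2 : ℝ) - 1 = 1 by norm_num, ENNReal.rpow_one, card_dyBlock] at h1
  simp only [ENNReal.rpow_two] at h1
  push_cast at h1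
  calc dyA k h x ^ 2 = ((2 ^ k)⁻¹) ^ 2 * (∑ y ∈ dyBlock k x, h y) ^ 2 := by rw [dyA, mul_pow]
    _ ≤ ((2 ^ k)⁻¹) ^ 2 * (2 ^ k * ∑ y ∈ dyBlock k x, h y ^ 2) := by gcongr
    _ = (((2 ^ k)⁻¹) ^ 2 * 2 ^ k) * ∑ y ∈ dyBlock k x, h y ^ 2 := by ring
    _ = _ := by rw [two_pow_inv_sq_mul, dyA]

/-- The `d` terms with d ≤ L < 2d already suffice. It writes the kernel 1/d² as a superposition of
windows, so that bounds for window sums apply. -/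
lemma inv_sq_le_tsum_inv_cube {d : ℕ} (hd : 1 ≤ d) :
    ((d : ℝ≥0∞)⁻¹) ^ 2 ≤ 8 * ∑' L : ℕ, (if d ≤ L then ((L : ℝ≥0∞)⁻¹) ^ 3 else 0) := by
  have hd0 : (d : ℝ≥0∞) ≠ 0 := by
    have : d ≠ 0 := by omega
    exact_mod_cast this
  calc ((d : ℝ≥0∞)⁻¹) ^ 2 = 8 * ∑ L ∈ Finset.Ico d (2 * d), (2⁻¹ * (d : ℝ≥0∞)⁻¹) ^ 3 := by
        rw [Finset.sum_const, Nat.card_Ico, nsmul_eq_mul, show 2 * d - d = d by omega]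
        have h2 : (8 : ℝ≥0∞) * 2⁻¹ ^ 3 = 1 := by
          rw [show (8 : ℝ≥0∞) = 2 ^ 3 by norm_num, ← mul_pow, ENNReal.mul_inv_cancel (by simp) (by simp),
            one_pow]
        calc ((d : ℝ≥0∞)⁻¹) ^ 2 = (8 * 2⁻¹ ^ 3) * ((d : ℝ≥0∞) * (d : ℝ≥0∞)⁻¹) * ((d : ℝ≥0∞)⁻¹) ^ 2 := by
              rw [h2, ENNReal.mul_inv_cancel hd0 (by simp), one_mul, one_mul]
          _ = _ := by ring
    _ ≤ 8 * ∑ L ∈ Finset.Ico d (2 * d), (if d ≤ L then ((L : ℝ≥0∞)⁻¹) ^ 3 else 0) := by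
        gcongr with L hL
        rw [Finset.mem_Ico] at hL
        rw [if_pos hL.1, ← ENNReal.mul_inv (by simp) (by simp)]
        gcongr
        exact_mod_cast hL.2.le
    _ ≤ _ := by
        gcongr
        exact ENNReal.sum_le_tsum _

/-- The tail kernel is dominated by averages over windows. -/
lemma tsum_tailKernel_mul_le {l : ℕ} (hl : 1 ≤ l) (h : ℤ → ℝ≥0∞) (y : ℤ) {U : ℝ≥0∞}
    (hU : ∀ L : ℕ, ∑ z ∈ Finset.Icc (y - L) (y + L), h z ≤ (2 * L + 1) * U) :
    ∑' z, tailKernel l (z - y) * h z ≤ 48 * U := by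
  have hl0 : (l : ℝ≥0∞) ≠ 0 := by
    have : l ≠ 0 := by omega
    exact_mod_cast this
  calc ∑' z, tailKernel l (z - y) * h z
      ≤ ∑' z, ∑' L : ℕ, 8 * l * ((if l ≤ L then ((L : ℝ≥0∞)⁻¹) ^ 3 else 0) *
          (if (z - y).natAbs ≤ L then h z else 0)) := by
        refine ENNReal.tsum_le_tsum fun z => ?_
        rw [tailKernel]
        split_ifs with h1
        · calc (l : ℝ≥0∞) * (((z - y).natAbs : ℝ≥0∞)⁻¹) ^ 2 * h z
              ≤ l * (8 * ∑' L : ℕ, (if (z - y).natAbs ≤ L then ((L : ℝ≥0∞)⁻¹) ^ 3 else 0)) * h z := by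
                gcongr
                exact inv_sq_le_tsum_inv_cube (hl.trans h1)
            _ = ∑' L : ℕ, 8 * l * ((if (z - y).natAbs ≤ L then ((L : ℝ≥0∞)⁻¹) ^ 3 else 0) * h z) := by
                rw [ENNReal.tsum_mul_left, ENNReal.tsum_mul_right]; ring
            _ ≤ _ := by
                refine ENNReal.tsum_le_tsum fun L => ?_
                by_cases h2 : (z - y).natAbs ≤ L
                · rw [if_pos h2, if_pos h2, if_pos (h1.trans h2)]
                · simp [h2]
        · simp
    _ = 8 * l * ∑' L : ℕ, (if l ≤ L then ((L : ℝ≥0∞)⁻¹) ^ 3 else 0) *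
          ∑ z ∈ Finset.Icc (y - L) (y + L), h z := by
        rw [ENNReal.tsum_comm]
        simp_rw [ENNReal.tsum_mul_left]
        congr 1
        refine tsum_congr fun L => ?_
        congr 1
        rw [tsum_eq_sum (s := Finset.Icc (y - L) (y + L)) fun z hz => if_neg fun h2 => hz (by
          rw [Finset.mem_Icc]; omega)]
        refine Finset.sum_congr rfl fun z hz => if_pos ?_
        rw [Finset.mem_Icc] at hz
        omega
    _ ≤ 8 * l * ∑' L : ℕ, 3 * U * (if l ≤ L then ((L : ℝ≥0∞)⁻¹) ^ 2 else 0) := by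
        refine mul_le_mul_right (ENNReal.tsum_le_tsum fun L => ?_) _
        split_ifs with h1
        · have hL0 : (L : ℝ≥0∞) ≠ 0 := by
            have : L ≠ 0 := by omega
            exact_mod_cast this
          have hL1 : (1 : ℝ≥0∞) ≤ L := by
            have : 1 ≤ L := by omega
            exact_mod_cast this
          calc ((L : ℝ≥0∞)⁻¹) ^ 3 * ∑ z ∈ Finset.Icc (y - L) (y + L), h z
              ≤ ((L : ℝ≥0∞)⁻¹) ^ 3 * ((2 * L + L) * U) := by
                gcongr
                exact (hU L).trans (by gcongr)
            _ = 3 * U * ((L : ℝ≥0∞)⁻¹) ^ 2 * ((L : ℝ≥0∞) * (L : ℝ≥0∞)⁻¹) := by ring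
            _ = _ := by rw [ENNReal.mul_inv_cancel hL0 (by simp), mul_one]
        · simp
    _ ≤ 8 * l * (3 * U * (2 * (l : ℝ≥0∞)⁻¹)) := by
        rw [ENNReal.tsum_mul_left]
        gcongr
        exact tsum_tail_inv_sq_le hl
    _ = 48 * U * ((l : ℝ≥0∞) * (l : ℝ≥0∞)⁻¹) := by ring
    _ = 48 * U := by rw [ENNReal.mul_inv_cancel hl0 (by simp), mul_one]

lemma sqVar_sub_le (a b : ℕ → ℂ) : sqVar (fun L => a L - b L) ≤ 2 * (sqVar a + sqVar b) := by
  refine iSup₂_le fun n hn => ?_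
  calc ∑' i, ‖a (n i) - b (n i) - (a (n (i + 1)) - b (n (i + 1)))‖ₑ ^ 2
      ≤ ∑' i, 2 * (‖a (n i) - a (n (i + 1))‖ₑ ^ 2 + ‖b (n i) - b (n (i + 1))‖ₑ ^ 2) := by
        refine ENNReal.tsum_le_tsum fun i => ?_
        have h := enorm_add_sq_le (a (n i) - a (n (i + 1))) (-(b (n i) - b (n (i + 1))))
        rw [enorm_neg] at h
        refine le_of_eq_of_le ?_ h
        congr 2
        ring
    _ ≤ _ := by
        rw [ENNReal.tsum_mul_left, ENNReal.tsum_add]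
        gcongr
        · exact le_sqVar a hn
        · exact le_sqVar b hn

/-- The averages of the part of `φ` far from a dyadic block hardly vary within the block. -/
lemma sqVar_zAvg_far_sub_le {k : ℕ} (φ : ℤ → ℂ) {q x x₀ y : ℤ} (hx : x / 2 ^ k = q)
    (hx₀ : x₀ / 2 ^ k = q) (hy : y / 2 ^ k = q) (s : Finset ℤ)
    (hs : ∀ m ∈ s, m ≤ q - 2 ∨ q + 2 ≤ m) :
    sqVar (fun L => ∑ m ∈ s, (zAvg L (blockPart k φ m) x - zAvg L (blockPart k φ m) x₀)) ≤
      3200 * ∑' z, tailKernel (2 ^ k) (z - y) * ‖φ z‖ₑ ^ 2 := by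
  classical
  have hp : (0 : ℤ) < 2 ^ k := by positivity
  have hcast : ((2 ^ k : ℕ) : ℤ) = 2 ^ k := by push_cast; rfl
  have hbd : ∀ {w m : ℤ}, w / 2 ^ k = m → m * 2 ^ k ≤ w ∧ w < m * 2 ^ k + 2 ^ k := by
    intro w m hw
    have h1 := (Int.ediv_eq_iff_of_pos hp).1 hw
    constructor <;> linarith [h1.1, h1.2]
  obtain ⟨hx1, hx2⟩ := hbd hx
  obtain ⟨hx3, hx4⟩ := hbd hx₀
  obtain ⟨hy1, hy2⟩ := hbd hy
  -- vanishing unless one of the windows ends in the block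
  have hzero : ∀ m ∈ s, ∀ L : ℕ, m ≠ (x + L) / 2 ^ k → m ≠ (x - L) / 2 ^ k →
      m ≠ (x₀ + L) / 2 ^ k → m ≠ (x₀ - L) / 2 ^ k →
      zAvg L (blockPart k φ m) x - zAvg L (blockPart k φ m) x₀ = 0 := by
    intro m hm L h1 h2 h3 h4
    rw [zAvg, zAvg, sum_window_blockPart φ h1 h2, sum_window_blockPart φ h3 h4, sub_eq_zero]
    congr 2
    -- Moving the centre by less than a block length moves each window end by at most one block. As
    -- no end lies in block `m`, both windows contain it or both miss it.
    have hclose : ∀ {v w : ℤ}, v < w + 2 ^ k → v / 2 ^ k ≤ w / 2 ^ k + 1 := by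
      intro v w hvw
      have h5 := Int.ediv_le_ediv hp hvw.le
      have h6 : (w + 2 ^ k) / 2 ^ k = w / 2 ^ k + 1 := by
        simpa using Int.add_mul_ediv_right w 1 hp.ne'
      omega
    have e1 := @hclose (x + L) (x₀ + L) (by linarith)
    have e2 := @hclose (x₀ + L) (x + L) (by linarith)
    have e3 := @hclose (x - L) (x₀ - L) (by linarith)
    have e4 := @hclose (x₀ - L) (x - L) (by linarith)
    apply propext
    omega
  have hover : ∀ L : ℕ, (s.filter fun m =>
      zAvg L (blockPart k φ m) x - zAvg L (blockPart k φ m) x₀ ≠ 0).card ≤ 4 := by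
    intro L
    refine (Finset.card_le_card (t := {(x + L) / 2 ^ k, (x - L) / 2 ^ k, (x₀ + L) / 2 ^ k,
      (x₀ - L) / 2 ^ k}) ?_).trans Finset.card_le_four
    intro m hm
    rw [Finset.mem_filter] at hm
    simp only [Finset.mem_insert, Finset.mem_singleton]
    by_contra hcon
    push Not at hcon
    exact hm.2 (hzero m hm.1 L hcon.1 hcon.2.1 hcon.2.2.1 hcon.2.2.2)
  have hpart : ∀ m ∈ s, sqVar (fun L => zAvg L (blockPart k φ m) x - zAvg L (blockPart k φ m) x₀) ≤
      400 * ∑ z ∈ dyBlock k (m * 2 ^ k), tailKernel (2 ^ k) (z - y) * ‖φ z‖ₑ ^ 2 := by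
    intro m hm
    obtain ⟨D, hD1, hD⟩ : ∃ D : ℕ, 1 ≤ D ∧ (m = q + (D + 1) ∨ m = q - (D + 1)) := by
      rcases hs m hm with h | h
      · exact ⟨(q - m - 1).toNat, by omega, by omega⟩
      · exact ⟨(m - q - 1).toNat, by omega, by omega⟩
    -- `D` is the number of blocks strictly between blocks `q` and `m`. A window centred in block
    -- `q` can end in block `m` only for radii between `L₀` and `L₁`.
    set L₀ : ℕ := D * 2 ^ k with hL₀
    set L₁ : ℕ := (D + 3) * 2 ^ k with hL₁
    have hL₀c : (L₀ : ℤ) = D * 2 ^ k := by rw [hL₀]; push_cast; ring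
    have hL₁c : (L₁ : ℤ) = D * 2 ^ k + 3 * 2 ^ k := by rw [hL₁]; push_cast; ring
    clear_value L₀ L₁
    have hmk : m * 2 ^ k = q * 2 ^ k + D * 2 ^ k + 2 ^ k ∨ m * 2 ^ k = q * 2 ^ k - D * 2 ^ k - 2 ^ k := by
      rcases hD with h | h
      · left; rw [h]; ring
      · right; rw [h]; ring
    have hDk : (2 : ℤ) ^ k ≤ D * 2 ^ k := by
      have : (1 : ℤ) ≤ D := by exact_mod_cast hD1
      nlinarith
    have hout : ∀ L : ℕ, ¬(L₀ ≤ L ∧ L < L₁) → ∀ w : ℤ, q * 2 ^ k ≤ w → w < q * 2 ^ k + 2 ^ k →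
        m ≠ (w + L) / 2 ^ k ∧ m ≠ (w - L) / 2 ^ k := by
      intro L hL w hw1 hw2
      constructor
      · intro h
        obtain ⟨h1, h2⟩ := hbd h.symm
        rcases hmk with h3 | h3 <;> omega
      · intro h
        obtain ⟨h1, h2⟩ := hbd h.symm
        rcases hmk with h3 | h3 <;> omega
    have hrestrict : (fun L => zAvg L (blockPart k φ m) x - zAvg L (blockPart k φ m) x₀) =
        fun L => (if L₀ ≤ L ∧ L < L₁ then zAvg L (blockPart k φ m) x else 0) -
          (if L₀ ≤ L ∧ L < L₁ then zAvg L (blockPart k φ m) x₀ else 0) := by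
      funext L
      split_ifs with h
      · rfl
      · rw [sub_zero]
        obtain ⟨h1, h2⟩ := hout L h x hx1 hx2
        obtain ⟨h3, h4⟩ := hout L h x₀ hx3 hx4
        exact hzero m hm L h1 h2 h3 h4
    rw [hrestrict]
    refine (sqVar_sub_le _ _).trans ?_
    set W := ENNReal.ofReal (2 * (L₀ : ℝ) + 1)⁻¹ with hW
    have hdivm : m * 2 ^ k / 2 ^ k = m := Int.mul_ediv_cancel _ hp.ne'
    have hsupp : ∀ z ∉ dyBlock k (m * 2 ^ k), blockPart k φ m z = 0 := fun z hz => by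
      rw [mem_dyBlock, hdivm] at hz
      exact if_neg hz
    have hCS : (∑' z, ‖blockPart k φ m z‖ₑ) ^ 2 ≤ 2 ^ k * ∑ z ∈ dyBlock k (m * 2 ^ k), ‖φ z‖ₑ ^ 2 := by
      refine (sq_tsum_enorm_le_card _ _ hsupp).trans ?_
      rw [card_dyBlock, tsum_eq_sum (s := dyBlock k (m * 2 ^ k)) fun z hz => by simp [hsupp z hz]]
      push_cast
      gcongr with z hz
      unfold blockPart
      split_ifs <;> simp
    -- As `D ≥ 1`, the distance from `y` to any point of block `m` is comparable to `L₀`.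
    have hker : ∀ z ∈ dyBlock k (m * 2 ^ k), 2 ^ k * W ^ 2 ≤ 4 * tailKernel (2 ^ k) (z - y) := by
      intro z hz
      rw [mem_dyBlock, hdivm] at hz
      obtain ⟨hz1, hz2⟩ := hbd hz
      have hfar : 2 ^ k ≤ (z - y).natAbs ∧ (z - y).natAbs ≤ 2 * (2 * L₀ + 1) := by
        rcases hmk with h3 | h3 <;> omega
      rw [tailKernel, if_pos hfar.1]
      push_cast
      have h5 : W ≤ 2 * ((z - y).natAbs : ℝ≥0∞)⁻¹ := by
        have hinv : ((2 * (2 * L₀ + 1) : ℕ) : ℝ≥0∞)⁻¹ ≤ ((z - y).natAbs : ℝ≥0∞)⁻¹ := by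
          rw [ENNReal.inv_le_inv]
          exact_mod_cast hfar.2
        calc W = 2 * ((2 * (2 * L₀ + 1) : ℕ) : ℝ≥0∞)⁻¹ := by
              rw [hW, ENNReal.ofReal_inv_of_pos (by positivity),
                show (2 * (L₀ : ℝ) + 1) = ((2 * L₀ + 1 : ℕ) : ℝ) by push_cast; ring,
                ENNReal.ofReal_natCast, Nat.cast_mul,
                ENNReal.mul_inv (by simp) (by simp), ← mul_assoc, Nat.cast_ofNat,
                ENNReal.mul_inv_cancel (by simp) (by simp), one_mul]
          _ ≤ _ := by gcongr
      calc (2 : ℝ≥0∞) ^ k * W ^ 2 ≤ 2 ^ k * (2 * ((z - y).natAbs : ℝ≥0∞)⁻¹) ^ 2 := by gcongr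
        _ = _ := by ring
    calc 2 * (sqVar (fun L => if L₀ ≤ L ∧ L < L₁ then zAvg L (blockPart k φ m) x else 0) +
          sqVar (fun L => if L₀ ≤ L ∧ L < L₁ then zAvg L (blockPart k φ m) x₀ else 0))
        ≤ 2 * (25 * (W * ∑' z, ‖blockPart k φ m z‖ₑ) ^ 2 +
            25 * (W * ∑' z, ‖blockPart k φ m z‖ₑ) ^ 2) := by
          gcongr
          · exact sqVar_restrict_zAvg_le _ _ _ _
          · exact sqVar_restrict_zAvg_le _ _ _ _
      _ = 100 * (W ^ 2 * (∑' z, ‖blockPart k φ m z‖ₑ) ^ 2) := by ring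
      _ ≤ 100 * (W ^ 2 * (2 ^ k * ∑ z ∈ dyBlock k (m * 2 ^ k), ‖φ z‖ₑ ^ 2)) := by gcongr
      _ = 100 * ∑ z ∈ dyBlock k (m * 2 ^ k), (2 ^ k * W ^ 2) * ‖φ z‖ₑ ^ 2 := by
          rw [← Finset.mul_sum]; ring
      _ ≤ 100 * ∑ z ∈ dyBlock k (m * 2 ^ k), (4 * tailKernel (2 ^ k) (z - y)) * ‖φ z‖ₑ ^ 2 := by
          exact mul_le_mul_right (Finset.sum_le_sum fun z hz => mul_le_mul_left (hker z hz) _) _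
      _ = _ := by
          simp_rw [mul_assoc (4 : ℝ≥0∞)]
          rw [← Finset.mul_sum]; ring
  refine (sqVar_sum_le_of_overlap s (fun m L => zAvg L (blockPart k φ m) x -
    zAvg L (blockPart k φ m) x₀) 4 hover).trans ?_
  calc 2 * ((4 : ℕ) : ℝ≥0∞) * ∑ m ∈ s,
        sqVar (fun L => zAvg L (blockPart k φ m) x - zAvg L (blockPart k φ m) x₀)
      ≤ 2 * ((4 : ℕ) : ℝ≥0∞) * ∑ m ∈ s,
          400 * ∑ z ∈ dyBlock k (m * 2 ^ k), tailKernel (2 ^ k) (z - y) * ‖φ z‖ₑ ^ 2 := by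
        gcongr with m hm
        exact hpart m hm
    _ = 3200 * ∑ z ∈ s.biUnion (fun m => dyBlock k (m * 2 ^ k)),
          tailKernel (2 ^ k) (z - y) * ‖φ z‖ₑ ^ 2 := by
        rw [Finset.sum_biUnion]
        · rw [← Finset.mul_sum]; push_cast; ring
        · intro m hm m' hm' hne
          rw [Function.onFun, Finset.disjoint_left]
          intro z hz hz'
          rw [mem_dyBlock, Int.mul_ediv_cancel _ hp.ne'] at hz hz'
          exact hne (hz.symm.trans hz')
    _ ≤ _ := by
        gcongr
        exact ENNReal.sum_le_tsum _

lemma seqVariation_neg (ρ : ℝ) (a : ℕ → ℂ) : seqVariation ρ (fun L => -a L) = seqVariation ρ a := by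
  unfold seqVariation
  simp_rw [← neg_sub', enorm_neg]

lemma zVar_neg (ρ : ℝ) (φ : ℤ → ℂ) (x : ℤ) : zVar ρ (-φ) x = zVar ρ φ x := by
  unfold zVar
  rw [← seqVariation_neg ρ fun L => zAvg L φ x]
  simp [zAvg]

/-- On a dyadic block the variation of the averages of `φ` is constant up to an error that is
controlled in mean square. -/
lemma exists_zVar_osc_le {ρ : ℝ} (hρ : 2 < ρ) : ∃ C : ℝ≥0, ∀ φ : ℤ → ℂ, φ.support.Finite →
    ∀ (k : ℕ) (x₀ : ℤ), ∃ (c : ℝ≥0∞) (Θ : ℤ → ℝ≥0∞),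
      (∀ x ∈ dyBlock k x₀, zVar ρ φ x ≤ c + Θ x ∧ c ≤ zVar ρ φ x + Θ x) ∧
      ∀ y ∈ dyBlock k x₀, ∀ U : ℝ≥0∞,
        (∀ L : ℕ, ∑ z ∈ Finset.Icc (y - L) (y + L), ‖φ z‖ₑ ^ 2 ≤ (2 * L + 1) * U) →
        ∑ x ∈ dyBlock k x₀, Θ x ^ 2 ≤ C * 2 ^ k * U := by
  classical
  obtain ⟨C, hC⟩ := tsum_zVar_sq_le hρ
  refine ⟨2 * (5 * C + 153600), fun φ hφ k x₀ => ?_⟩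
  have hp : (0 : ℤ) < 2 ^ k := by positivity
  have hρ1 : 1 ≤ ρ := by linarith
  set q := x₀ / 2 ^ k with hq
  -- Far blocks meeting the support; `f₁` keeps the values on the block and its two neighbours.
  set s : Finset ℤ := (hφ.toFinset.image (· / 2 ^ k)).filter fun m => m ≤ q - 2 ∨ q + 2 ≤ m with hs
  set f₂ : ℤ → ℂ := fun z => ∑ m ∈ s, blockPart k φ m z with hf₂
  set f₁ : ℤ → ℂ := φ - f₂ with hf₁
  have hf₂z : ∀ z, z / 2 ^ k ≤ q - 2 ∨ q + 2 ≤ z / 2 ^ k → f₂ z = φ z := by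
    intro z hz
    simp only [hf₂, blockPart]
    rw [Finset.sum_ite_eq]
    split_ifs with h
    · rfl
    · by_contra hcon
      refine h (Finset.mem_filter.2 ⟨Finset.mem_image.2 ⟨z, ?_, rfl⟩, hz⟩)
      rw [Set.Finite.mem_toFinset]
      exact fun h0 => hcon h0.symm
  have hf₂z' : ∀ z, ¬(z / 2 ^ k ≤ q - 2 ∨ q + 2 ≤ z / 2 ^ k) → f₂ z = 0 := by
    intro z hz
    simp only [hf₂, blockPart]
    rw [Finset.sum_ite_eq]
    refine if_neg fun h => hz ?_
    rw [hs, Finset.mem_filter] at h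
    exact h.2
  set D : ℤ → ℕ → ℂ := fun x L => zAvg L f₂ x - zAvg L f₂ x₀ with hD
  have hD' : ∀ x, D x = fun L => ∑ m ∈ s, (zAvg L (blockPart k φ m) x - zAvg L (blockPart k φ m) x₀) := by
    intro x
    funext L
    rw [hD, Finset.sum_sub_distrib]
    simp only [hf₂, zAvg_sum]
  -- The constant is the variation of the far part at the base point. The error collects the near
  -- part, handled in ℓ², and the change of the far part between `x₀` and `x`.
  refine ⟨zVar ρ f₂ x₀, fun x => zVar ρ f₁ x + seqVariation ρ (D x), fun x hx => ⟨?_, ?_⟩, ?_⟩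
  · have h1 : zVar ρ φ x ≤ zVar ρ f₁ x + zVar ρ f₂ x := by
      have := zVar_add_le hρ1 f₁ f₂ x
      simpa [hf₁] using this
    have h2 : zVar ρ f₂ x ≤ zVar ρ f₂ x₀ + seqVariation ρ (D x) := by
      have := seqVariation_add_le hρ1 (fun L => zAvg L f₂ x₀) (D x)
      simpa [hD, zVar] using this
    calc zVar ρ φ x ≤ zVar ρ f₁ x + (zVar ρ f₂ x₀ + seqVariation ρ (D x)) := h1.trans (by gcongr)
      _ = _ := by ring
  · have h1 : zVar ρ f₂ x ≤ zVar ρ φ x + zVar ρ f₁ x := by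
      have := zVar_add_le hρ1 φ (-f₁) x
      rw [zVar_neg] at this
      simpa [hf₁] using this
    have h2 : zVar ρ f₂ x₀ ≤ zVar ρ f₂ x + seqVariation ρ (D x) := by
      have := seqVariation_add_le hρ1 (fun L => zAvg L f₂ x) (fun L => -D x L)
      rw [seqVariation_neg] at this
      simpa [hD, zVar] using this
    calc zVar ρ f₂ x₀ ≤ zVar ρ φ x + zVar ρ f₁ x + seqVariation ρ (D x) := h2.trans (by gcongr)
      _ = _ := by ring
  · intro y hy U hU
    rw [mem_dyBlock] at hy
    have hfar : ∀ x ∈ dyBlock k x₀, seqVariation ρ (D x) ^ 2 ≤ 153600 * U := by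
      intro x hx
      rw [mem_dyBlock] at hx
      refine (seqVariation_sq_le_sqVar hρ.le _).trans ?_
      rw [hD']
      refine (sqVar_zAvg_far_sub_le φ hx rfl hy s fun m hm => (Finset.mem_filter.1 hm).2).trans ?_
      calc 3200 * ∑' z, tailKernel (2 ^ k) (z - y) * ‖φ z‖ₑ ^ 2 ≤ 3200 * (48 * U) := by
            gcongr
            exact tsum_tailKernel_mul_le Nat.one_le_two_pow _ y hU
        _ = _ := by ring
    have hnear : ∑ x ∈ dyBlock k x₀, zVar ρ f₁ x ^ 2 ≤ C * (5 * 2 ^ k * U) := by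
      refine (ENNReal.sum_le_tsum _).trans ((hC f₁).trans ?_)
      gcongr
      calc ∑' z, ‖f₁ z‖ₑ ^ 2
          ≤ ∑ z ∈ Finset.Icc (y - (2 * 2 ^ k : ℕ)) (y + (2 * 2 ^ k : ℕ)), ‖φ z‖ₑ ^ 2 := by
            rw [tsum_eq_sum (s := Finset.Icc (y - (2 * 2 ^ k : ℕ)) (y + (2 * 2 ^ k : ℕ)))]
            · refine Finset.sum_le_sum fun z _ => ?_
              by_cases hz : z / 2 ^ k ≤ q - 2 ∨ q + 2 ≤ z / 2 ^ k
              · simp [hf₁, hf₂z z hz]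
              · simp [hf₁, hf₂z' z hz]
            · intro z hz
              have : f₂ z = φ z := hf₂z z (by
                by_contra hcon
                refine hz ?_
                rw [Finset.mem_Icc]
                push_cast
                have h1 := (Int.ediv_eq_iff_of_pos hp).1 hy
                have h2 := (Int.ediv_eq_iff_of_pos hp).1 (rfl : z / 2 ^ k = z / 2 ^ k)
                have h3 : z / 2 ^ k = q - 1 ∨ z / 2 ^ k = q ∨ z / 2 ^ k = q + 1 := by omega
                rcases h3 with h3 | h3 | h3 <;> rw [h3] at h2 <;> constructor <;>
                  linarith [h1.1, h1.2, h2.1, h2.2])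
              simp [hf₁, this]
        _ ≤ (2 * (2 * 2 ^ k : ℕ) + 1) * U := hU _
        _ ≤ 5 * 2 ^ k * U := by
            gcongr
            have : 2 * (2 * 2 ^ k) + 1 ≤ 5 * 2 ^ k := by
              have := Nat.one_le_two_pow (n := k)
              omega
            exact_mod_cast this
    calc ∑ x ∈ dyBlock k x₀, (zVar ρ f₁ x + seqVariation ρ (D x)) ^ 2
        ≤ ∑ x ∈ dyBlock k x₀, 2 * (zVar ρ f₁ x ^ 2 + 153600 * U) := by
          refine Finset.sum_le_sum fun x hx => (add_sq_le_two_mul _ _).trans ?_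
          gcongr
          exact hfar x hx
      _ = 2 * (∑ x ∈ dyBlock k x₀, zVar ρ f₁ x ^ 2 + 2 ^ k * (153600 * U)) := by
          rw [← Finset.mul_sum, Finset.sum_add_distrib, Finset.sum_const, card_dyBlock, nsmul_eq_mul]
          push_cast
          rfl
      _ ≤ 2 * (C * (5 * 2 ^ k * U) + 2 ^ k * (153600 * U)) := by gcongr
      _ = _ := by push_cast; ring

/-! ### The good-λ inequality and the passage from p / 2 to p. -/

lemma dyBlock_subset {j k : ℕ} (hjk : j ≤ k) (x : ℤ) : dyBlock j x ⊆ dyBlock k x := fun _ hy =>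
  mem_dyBlock.2 (ediv_two_pow_congr hjk (mem_dyBlock.1 hy))

/-- A good-`λ` inequality for the dyadic maximal function of a function that is nearly constant
on dyadic blocks. -/
lemma distr_dyMax_four_mul_le {G U : ℤ → ℝ≥0∞} {K η : ℝ≥0} (hG : ∑' x, G x ^ 2 ≠ ∞)
    (hosc : ∀ (k : ℕ) (x₀ : ℤ), ∃ (c : ℝ≥0∞) (Θ : ℤ → ℝ≥0∞),
      (∀ x ∈ dyBlock k x₀, G x ≤ c + Θ x ∧ c ≤ G x + Θ x) ∧
      ∀ y ∈ dyBlock k x₀, ∑ x ∈ dyBlock k x₀, Θ x ^ 2 ≤ K * 2 ^ k * U y)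
    (hη : K * η ≤ 1) {t : ℝ≥0∞} (ht : t ≠ 0) (ht' : t ≠ ∞) :
    distr (dyMax G) (4 * t) ≤ distr U (η * t ^ 2) + 4 * K * η * distr (dyMax G) t := by
  classical
  have hsq : ∀ {a b : ℝ≥0∞}, a ^ 2 ≤ b ^ 2 → a ≤ b := fun h =>
    (ENNReal.pow_le_pow_left_iff two_ne_zero).1 h
  -- `G` is only square summable; Jensen's inequality makes its coarse averages small.
  obtain ⟨κ, hκ⟩ := exists_stopping G t fun x => by
    obtain ⟨N, hN⟩ := dyA_eventually_le hG (pow_ne_zero 2 ht)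
    exact ⟨N, fun k hk => hsq ((dyA_sq_le k G x).trans (hN x k hk))⟩
  set Ω : Set ℤ := {x | t < dyMax G x} with hΩ
  set E : Set ℤ := {x | 4 * t < dyMax G x ∧ U x ≤ η * t ^ 2} with hE
  have hEΩ : ∀ x ∈ E, x ∈ Ω := fun x hx => by
    refine lt_of_le_of_lt ?_ hx.1
    calc t = 1 * t := (one_mul t).symm
      _ ≤ 4 * t := by gcongr; norm_num
  -- the exceptional set has small density in each maximal block
  have hblock : ∀ x₀ ∈ Ω, dyA (κ x₀) (E.indicator 1) x₀ ≤ 4 * K * η := by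
    intro x₀ hx₀
    obtain ⟨-, hlarge, hsame⟩ := hκ x₀ hx₀
    set k := κ x₀ with hk
    by_cases hne : ∃ y ∈ dyBlock k x₀, y ∈ E
    swap
    · push Not at hne
      have : dyA k (E.indicator 1) x₀ = 0 := by
        rw [dyA, Finset.sum_eq_zero fun y hy => Set.indicator_of_notMem (hne y hy) _, mul_zero]
      rw [this]
      exact zero_le
    obtain ⟨y, hy, hyE⟩ := hne
    -- The oscillation is taken on the parent block, where the average of `G` is at most `t`; this
    -- forces c ≤ 2t. One point `y` of `E` suffices to make Θ small in mean square on the whole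
    -- block.
    obtain ⟨c, Θ, hc, hΘ⟩ := hosc (k + 1) x₀
    have hsub := dyBlock_subset (Nat.le_succ k) x₀
    have hΘy : ∑ x ∈ dyBlock (k + 1) x₀, Θ x ^ 2 ≤ K * 2 ^ (k + 1) * (η * t ^ 2) :=
      (hΘ y (hsub hy)).trans (by gcongr; exact hyE.2)
    have hΘavg : dyA (k + 1) Θ x₀ ≤ t := by
      refine hsq ((dyA_sq_le _ _ _).trans ?_)
      calc dyA (k + 1) (fun x => Θ x ^ 2) x₀
          ≤ (2 ^ (k + 1))⁻¹ * (K * 2 ^ (k + 1) * (η * t ^ 2)) := by rw [dyA]; gcongr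
        _ = (2 ^ (k + 1) * (2 ^ (k + 1))⁻¹) * ((K * η : ℝ≥0) * t ^ 2) := by push_cast; ring
        _ ≤ 1 * (1 * t ^ 2) := by
            rw [two_pow_mul_inv]
            gcongr
            exact_mod_cast hη
        _ = t ^ 2 := by rw [one_mul, one_mul]
    have hc2 : c ≤ 2 * t := by
      calc c = dyA (k + 1) (fun _ => c) x₀ := (dyA_const _ _ _).symm
        _ ≤ dyA (k + 1) (fun x => G x + Θ x) x₀ := dyA_mono fun x hx => (hc x hx).2
        _ = dyA (k + 1) G x₀ + dyA (k + 1) Θ x₀ := dyA_add _ _ _ _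
        _ ≤ t + t := add_le_add (hlarge _ (Nat.lt_succ_self k)) hΘavg
        _ = 2 * t := (two_mul t).symm
    set Θ' : ℤ → ℝ≥0∞ := fun x => if x ∈ dyBlock (k + 1) x₀ then Θ x else 0 with hΘ'
    -- An average of `G` above 4t can occur only inside the maximal block, and there at most 2t of
    -- it comes from the constant. The remainder is counted by the ℓ² maximal inequality.
    have hmax : ∀ x ∈ dyBlock k x₀, x ∈ E → 2 * t ≤ dyMax Θ' x := by
      intro x hx hxE
      obtain ⟨j, hj⟩ := lt_iSup_iff.1 hxE.1
      have hxκ := (hsame x hx).2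
      have hjk : j ≤ k := by
        by_contra hcon
        have h1 := (hκ x (hEΩ x hxE)).2.1 j (by omega)
        exact absurd (hj.trans_le h1) (not_lt.2 (by
          calc t = 1 * t := (one_mul t).symm
            _ ≤ 4 * t := by gcongr; norm_num))
      have h2 : dyA j G x ≤ 2 * t + dyMax Θ' x := by
        calc dyA j G x ≤ dyA j (fun z => c + Θ' z) x := dyA_mono fun z hz => by
              have hz1 : z ∈ dyBlock (k + 1) x₀ := by
                have := dyBlock_subset (hjk.trans (Nat.le_succ k)) x hz
                rwa [dyBlock_congr (mem_dyBlock.1 (hsub hx))] at this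
              simpa [hΘ', hz1] using (hc z hz1).1
          _ = c + dyA j Θ' x := by rw [dyA_add, dyA_const]
          _ ≤ _ := add_le_add hc2 (le_dyMax j Θ' x)
      by_contra hcon
      push Not at hcon
      refine absurd (hj.trans_le h2) (not_lt.2 ?_)
      calc 2 * t + dyMax Θ' x ≤ 2 * t + 2 * t := by gcongr
        _ = 4 * t := by ring
    have hΘ'sq : ∑' x, Θ' x ^ 2 = ∑ x ∈ dyBlock (k + 1) x₀, Θ x ^ 2 := by
      rw [tsum_eq_sum (s := dyBlock (k + 1) x₀) fun x hx => by simp [hΘ', hx]]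
      exact Finset.sum_congr rfl fun x hx => by simp [hΘ', hx]
    have hcount : (4 * t ^ 2) * ∑ x ∈ dyBlock k x₀, E.indicator 1 x ≤
        (4 * t ^ 2) * (2 ^ k * (4 * K * η)) := by
      calc (4 * t ^ 2) * ∑ x ∈ dyBlock k x₀, E.indicator 1 x
          ≤ ∑ x ∈ dyBlock k x₀, dyMax Θ' x ^ 2 := by
            rw [Finset.mul_sum]
            refine Finset.sum_le_sum fun x hx => ?_
            by_cases hxE : x ∈ E
            · rw [Set.indicator_of_mem hxE, Pi.one_apply, mul_one]
              calc 4 * t ^ 2 = (2 * t) ^ 2 := by ring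
                _ ≤ _ := pow_le_pow_left' (hmax x hx hxE) 2
            · rw [Set.indicator_of_notMem hxE, mul_zero]
              exact zero_le
        _ ≤ 8 * ∑' x, Θ' x ^ 2 := (ENNReal.sum_le_tsum _).trans (tsum_dyMax_sq_le Θ')
        _ ≤ 8 * (K * 2 ^ (k + 1) * (η * t ^ 2)) := by rw [hΘ'sq]; gcongr
        _ = _ := by ring
    rw [ENNReal.mul_le_mul_iff_right (mul_ne_zero (by simp) (pow_ne_zero 2 ht))
      (ENNReal.mul_ne_top (by simp) (ENNReal.pow_ne_top ht'))] at hcount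
    calc dyA k (E.indicator 1) x₀ ≤ (2 ^ k)⁻¹ * (2 ^ k * (4 * K * η)) := by rw [dyA]; gcongr
      _ = (2 ^ k * (2 ^ k)⁻¹) * (4 * K * η) := by ring
      _ = _ := by rw [two_pow_mul_inv, one_mul]
  have hEsum : ∑' x, E.indicator (1 : ℤ → ℝ≥0∞) x ≤ 4 * K * η * distr (dyMax G) t := by
    calc ∑' x, E.indicator (1 : ℤ → ℝ≥0∞) x = ∑' x, Ω.indicator (E.indicator 1) x := by
          refine tsum_congr fun x => ?_
          by_cases hx : x ∈ E
          · rw [Set.indicator_of_mem (hEΩ x hx)]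
          · simp [Set.indicator_apply, hx]
      _ = ∑' x, Ω.indicator (fun x => dyA (κ x) (E.indicator 1) x) x :=
          (tsum_indicator_dyA Ω κ (fun x hx => (hκ x hx).2.2) _).symm
      _ ≤ ∑' x, 4 * (K : ℝ≥0∞) * η * Ω.indicator 1 x := by
          refine ENNReal.tsum_le_tsum fun x => ?_
          by_cases hx : x ∈ Ω
          · rw [Set.indicator_of_mem hx, Set.indicator_of_mem hx, Pi.one_apply, mul_one]
            exact hblock x hx
          · simp [hx]
      _ = _ := by rw [ENNReal.tsum_mul_left, distr]
  refine le_trans ?_ (add_le_add_right hEsum _)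
  rw [distr, distr, ← ENNReal.tsum_add]
  refine ENNReal.tsum_le_tsum fun x => ?_
  refine le_trans (Set.indicator_le_indicator_of_subset (t := {x | η * t ^ 2 < U x} ∪ E) ?_
    (fun _ => zero_le) x) (indicator_one_union_le _ _ x)
  intro x hx
  by_cases h : (η : ℝ≥0∞) * t ^ 2 < U x
  · exact Or.inl h
  · exact Or.inr ⟨hx, not_lt.1 h⟩

lemma measurable_layer_distr (p : ℝ) (F : ℤ → ℝ≥0∞) : Measurable fun t : ℝ =>
    ENNReal.ofReal (p * t ^ (p - 1)) * distr F (ENNReal.ofReal t) := by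
  have h : (fun t : ℝ => ENNReal.ofReal (p * t ^ (p - 1)) * distr F (ENNReal.ofReal t)) =
      fun t : ℝ => ∑' x, ENNReal.ofReal (p * t ^ (p - 1)) *
        (if ENNReal.ofReal t < F x then 1 else 0) := by
    funext t
    rw [ENNReal.tsum_mul_left, distr]
    simp [Set.indicator_apply]
  rw [h]
  exact Measurable.tsum fun x => measurable_layer p (F x)

/-- A good-`λ` inequality gives a norm inequality. -/
lemma tsum_rpow_le_of_distr_le {p : ℝ} (hp : 0 < p) {u U : ℤ → ℝ≥0∞} (hu : ∑' x, u x ^ p ≠ ∞)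
    {η δ : ℝ≥0} (hη : η ≠ 0) (hδ : 4 ^ p * δ ≤ 2⁻¹)
    (h : ∀ t : ℝ≥0∞, t ≠ 0 → t ≠ ∞ → distr u (4 * t) ≤ distr U (η * t ^ 2) + δ * distr u t) :
    ∑' x, u x ^ p ≤ 2 * 4 ^ p * ((η : ℝ≥0∞)⁻¹ ^ (p / 2) * ∑' x, U x ^ (p / 2)) := by
  have hη' : (η : ℝ≥0∞) ≠ 0 := by simpa using hη
  -- Rescaled so that `V` exceeds t exactly when `U` exceeds η t².
  set V : ℤ → ℝ≥0∞ := fun x => ((η : ℝ≥0∞)⁻¹ * U x) ^ (2⁻¹ : ℝ) with hV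
  have hVt : ∀ t : ℝ≥0∞, distr U (η * t ^ 2) = distr V t := by
    intro t
    unfold distr
    refine tsum_congr fun x => ?_
    have : η * t ^ 2 < U x ↔ t < V x := by
      rw [hV, ENNReal.lt_rpow_inv_iff (by norm_num), ENNReal.rpow_two,
        ← ENNReal.div_eq_inv_mul, ENNReal.lt_div_iff_mul_lt (Or.inl hη') (Or.inl (by simp)), mul_comm]
    simp [Set.indicator_apply, this]
  have hVsum : ∑' x, V x ^ p = (η : ℝ≥0∞)⁻¹ ^ (p / 2) * ∑' x, U x ^ (p / 2) := by
    rw [← ENNReal.tsum_mul_left]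
    refine tsum_congr fun x => ?_
    rw [hV, ← ENNReal.rpow_mul, show 2⁻¹ * p = p / 2 by ring,
      ENNReal.mul_rpow_of_nonneg _ _ (by linarith)]
  have h4 : (((4 : ℝ≥0) ^ p : ℝ≥0) : ℝ≥0∞) = 4 ^ p := by
    rw [ENNReal.coe_rpow_of_nonneg _ hp.le]; norm_num
  have hmain : ∑' x, u x ^ p ≤ 4 ^ p * ∑' x, V x ^ p + 2⁻¹ * ∑' x, u x ^ p := by
    calc ∑' x, u x ^ p = 4 ^ p * ∫⁻ t in Set.Ioi (0 : ℝ), ENNReal.ofReal (p * t ^ (p - 1)) *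
            distr u (4 * ENNReal.ofReal t) := by
          have := tsum_rpow_eq_lintegral_mul hp (four_ne_zero : (4 : ℝ≥0) ≠ 0) u
          exact_mod_cast this
      _ ≤ 4 ^ p * ∫⁻ t in Set.Ioi (0 : ℝ), (ENNReal.ofReal (p * t ^ (p - 1)) *
            distr V (ENNReal.ofReal t) + δ * (ENNReal.ofReal (p * t ^ (p - 1)) *
            distr u (ENNReal.ofReal t))) := by
          refine mul_le_mul_right (setLIntegral_mono_ae' measurableSet_Ioi
            (ae_of_all _ fun t ht => ?_)) _
          have ht' : (0 : ℝ) < t := ht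
          refine (mul_le_mul_right (h (ENNReal.ofReal t) (by simpa using ht') (by simp)) _).trans
            (le_of_eq ?_)
          rw [hVt]
          ring
      _ = 4 ^ p * (∑' x, V x ^ p + δ * ∑' x, u x ^ p) := by
          rw [lintegral_add_left (measurable_layer_distr p V), lintegral_const_mul' _ _ (by simp),
            ← tsum_rpow_eq_lintegral hp, ← tsum_rpow_eq_lintegral hp]
      _ = 4 ^ p * ∑' x, V x ^ p + ((4 ^ p * δ : ℝ≥0) : ℝ≥0∞) * ∑' x, u x ^ p := by
          push_cast
          rw [h4]
          ring
      _ ≤ _ := by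
          gcongr
          calc ((4 ^ p * δ : ℝ≥0) : ℝ≥0∞) ≤ ((2⁻¹ : ℝ≥0) : ℝ≥0∞) := by exact_mod_cast hδ
            _ = 2⁻¹ := by rw [ENNReal.coe_inv two_ne_zero]; norm_num
  rw [hVsum] at hmain
  set A := ∑' x, u x ^ p with hA
  set B := 4 ^ p * ((η : ℝ≥0∞)⁻¹ ^ (p / 2) * ∑' x, U x ^ (p / 2)) with hB
  -- Half of the left side is absorbed; this needs the a priori finiteness `hu`.
  have h1 : 2⁻¹ * A ≤ B := by
    refine (ENNReal.add_le_add_iff_right (a := 2⁻¹ * A) (ENNReal.mul_ne_top (by simp) hu)).1 ?_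
    rwa [← add_mul, ENNReal.inv_two_add_inv_two, one_mul]
  calc A = 2 * (2⁻¹ * A) := by
        rw [← mul_assoc, ENNReal.mul_inv_cancel (by simp) (by simp), one_mul]
    _ ≤ 2 * B := by gcongr
    _ = _ := by rw [hB]; ring

/-- The averages of |φ|² start at |φ y|² and stray from it by at most their variation, which here
replaces the Hardy–Littlewood maximal function. -/
lemma sum_enorm_sq_le_window {ρ : ℝ} (hρ : 0 < ρ) (φ : ℤ → ℂ) (y : ℤ) (L : ℕ) :
    ∑ z ∈ Finset.Icc (y - L) (y + L), ‖φ z‖ₑ ^ 2 ≤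
      (2 * L + 1) * (‖φ y‖ₑ ^ 2 + zVar ρ (fun z => ((‖φ z‖ ^ 2 : ℝ) : ℂ)) y) := by
  set ψ : ℤ → ℂ := fun z => ((‖φ z‖ ^ 2 : ℝ) : ℂ) with hψ
  have h0 : (2 * (L : ℂ) + 1) ≠ 0 := by exact_mod_cast Nat.succ_ne_zero (2 * L)
  have hψe : ∀ z, ‖ψ z‖ₑ = ‖φ z‖ₑ ^ 2 := by
    intro z
    rw [hψ, ← ofReal_norm, Complex.norm_real, Real.norm_of_nonneg (by positivity),
      ENNReal.ofReal_pow (norm_nonneg _), ofReal_norm]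
  have hsum : ∑ z ∈ Finset.Icc (y - L) (y + L), ‖φ z‖ₑ ^ 2 = ‖(2 * (L : ℂ) + 1) * zAvg L ψ y‖ₑ := by
    rw [zAvg, ← mul_assoc, mul_inv_cancel₀ h0, one_mul, hψ, ← Complex.ofReal_sum, ← ofReal_norm,
      Complex.norm_real, Real.norm_of_nonneg (Finset.sum_nonneg fun _ _ => by positivity),
      ENNReal.ofReal_sum_of_nonneg fun _ _ => by positivity]
    refine Finset.sum_congr rfl fun z _ => ?_
    rw [ENNReal.ofReal_pow (norm_nonneg _), ofReal_norm]
  have h1 := enorm_le_add_seqVariation hρ (fun L => zAvg L ψ y) L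
  simp only [zAvg_zero_left, hψe] at h1
  have h2 : ‖2 * (L : ℂ) + 1‖ₑ = 2 * L + 1 := by
    rw [show 2 * (L : ℂ) + 1 = ((2 * L + 1 : ℕ) : ℂ) by push_cast; rfl, ← ofReal_norm,
      Complex.norm_natCast, ENNReal.ofReal_natCast]
    push_cast
    rfl
  rw [hsum, enorm_mul, h2]
  gcongr
  exact h1

/-- Passing from the exponent `p / 2` to the exponent `p`. -/
lemma tsum_zVar_rpow_le_of_half {ρ : ℝ} (hρ : 2 < ρ) {p : ℝ} (hp : 2 < p)
    (hhalf : ∃ C : ℝ≥0, ∀ φ : ℤ → ℂ, φ.support.Finite →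
      ∑' x, zVar ρ φ x ^ (p / 2) ≤ C * ∑' x, ‖φ x‖ₑ ^ (p / 2)) :
    ∃ C : ℝ≥0, ∀ φ : ℤ → ℂ, φ.support.Finite →
      ∑' x, zVar ρ φ x ^ p ≤ C * ∑' x, ‖φ x‖ₑ ^ p := by
  obtain ⟨A, hA⟩ := hhalf
  obtain ⟨B, hB⟩ := tsum_zVar_sq_le hρ
  obtain ⟨K, hK⟩ := exists_zVar_osc_le hρ
  have hp0 : 0 < p := by linarith
  have hρ0 : 0 < ρ := by linarith
  -- Small enough both for the good-λ inequality (K η ≤ 1) and for absorption (4^p · 4 K η ≤ 1/2).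
  set η : ℝ≥0 := (8 * (4 ^ p * (K + 1)))⁻¹ with hη
  have h4p : (1 : ℝ≥0) ≤ 4 ^ p := NNReal.one_le_rpow (by norm_num) hp0.le
  have hη0 : η ≠ 0 := inv_ne_zero (by positivity)
  have hηmul : (8 * (4 ^ p * (K + 1))) * η = 1 := mul_inv_cancel₀ (by positivity)
  have hη1 : K * η ≤ 1 := by
    rw [← hηmul]
    gcongr
    calc K ≤ 1 * (1 * (K + 1)) := by rw [one_mul, one_mul]; exact le_self_add
      _ ≤ 8 * (4 ^ p * (K + 1)) := by gcongr; norm_num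
  have hη2 : 4 ^ p * (4 * K * η) ≤ 2⁻¹ := by
    have h1 : 2 * (4 ^ p * (4 * K * η)) ≤ 1 := by
      calc 2 * (4 ^ p * (4 * K * η)) = (8 * (4 ^ p * K)) * η := by ring
        _ ≤ (8 * (4 ^ p * (K + 1))) * η := by gcongr; exact le_self_add
        _ = 1 := hηmul
    calc 4 ^ p * (4 * K * η) = 2⁻¹ * (2 * (4 ^ p * (4 * K * η))) := by
          rw [← mul_assoc 2⁻¹, inv_mul_cancel₀ two_ne_zero, one_mul]
      _ ≤ 2⁻¹ * 1 := by gcongr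
      _ = 2⁻¹ := mul_one _
  refine ⟨2 * 4 ^ p * (η⁻¹ ^ (p / 2) * (2 ^ (p / 2 - 1) * (1 + A))), fun φ hφ => ?_⟩
  set ψ : ℤ → ℂ := fun z => ((‖φ z‖ ^ 2 : ℝ) : ℂ) with hψ
  have hψe : ∀ z, ‖ψ z‖ₑ = ‖φ z‖ₑ ^ 2 := by
    intro z
    rw [hψ, ← ofReal_norm, Complex.norm_real, Real.norm_of_nonneg (by positivity),
      ENNReal.ofReal_pow (norm_nonneg _), ofReal_norm]
  have hψf : ψ.support.Finite := hφ.subset fun z hz h0 => hz (by simp [hψ, h0])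
  set U : ℤ → ℝ≥0∞ := fun y => ‖φ y‖ₑ ^ 2 + zVar ρ ψ y with hU
  -- Finite support gives square summability, hence p-summability since p > 2: the finiteness needed
  -- for absorption.
  have hfin2 : ∑' x, zVar ρ φ x ^ 2 ≠ ∞ := by
    refine ne_top_of_le_ne_top (ENNReal.mul_ne_top (by simp) ?_) (hB φ)
    rw [tsum_eq_sum (s := hφ.toFinset) fun z hz => by simpa using hz]
    exact ENNReal.sum_ne_top.2 fun z _ => ENNReal.pow_ne_top (by simp)
  have hfinp : ∑' x, dyMax (zVar ρ φ) x ^ p ≠ ∞ := by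
    refine ne_top_of_le_ne_top ?_ (tsum_dyMax_rpow_le (by linarith) _)
    refine ENNReal.mul_ne_top (ENNReal.mul_ne_top (by simp) (by simp)) ?_
    refine ne_top_of_le_ne_top ?_ (tsum_rpow_le_tsum_sq_rpow hp.le _)
    exact ENNReal.rpow_ne_top_of_nonneg (by linarith) hfin2
  have hgood : ∀ t : ℝ≥0∞, t ≠ 0 → t ≠ ∞ → distr (dyMax (zVar ρ φ)) (4 * t) ≤
      distr U (η * t ^ 2) + (4 * K * η : ℝ≥0) * distr (dyMax (zVar ρ φ)) t := by
    intro t ht ht'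
    have := distr_dyMax_four_mul_le (U := U) hfin2 (fun k x₀ => by
      obtain ⟨c, Θ, h1, h2⟩ := hK φ hφ k x₀
      exact ⟨c, Θ, h1, fun y hy => h2 y hy (U y) fun L => sum_enorm_sq_le_window hρ0 φ y L⟩) hη1 ht ht'
    exact_mod_cast this
  -- The inequality for exponent p / 2 is applied to |φ|².
  have hUsum : ∑' x, U x ^ (p / 2) ≤ 2 ^ (p / 2 - 1) * ((1 + A) * ∑' x, ‖φ x‖ₑ ^ p) := by
    have hpow : ∀ x, (‖φ x‖ₑ ^ 2) ^ (p / 2) = ‖φ x‖ₑ ^ p := fun x => by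
      rw [← ENNReal.rpow_two, ← ENNReal.rpow_mul, mul_div_cancel₀ _ two_ne_zero]
    calc ∑' x, U x ^ (p / 2)
        ≤ ∑' x, 2 ^ (p / 2 - 1) * ((‖φ x‖ₑ ^ 2) ^ (p / 2) + zVar ρ ψ x ^ (p / 2)) :=
          ENNReal.tsum_le_tsum fun x => ENNReal.rpow_add_le_mul_rpow_add_rpow _ _ (by linarith)
      _ = 2 ^ (p / 2 - 1) * (∑' x, ‖φ x‖ₑ ^ p + ∑' x, zVar ρ ψ x ^ (p / 2)) := by
          rw [ENNReal.tsum_mul_left, ENNReal.tsum_add]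
          simp only [hpow]
      _ ≤ 2 ^ (p / 2 - 1) * (∑' x, ‖φ x‖ₑ ^ p + A * ∑' x, ‖φ x‖ₑ ^ p) := by
          gcongr
          refine (hA ψ hψf).trans (le_of_eq ?_)
          simp only [hψe, hpow]
      _ = _ := by ring
  have c4 : (((4 : ℝ≥0) ^ p : ℝ≥0) : ℝ≥0∞) = 4 ^ p := by
    rw [ENNReal.coe_rpow_of_nonneg _ hp0.le]; norm_num
  have c2 : (((2 : ℝ≥0) ^ (p / 2 - 1) : ℝ≥0) : ℝ≥0∞) = 2 ^ (p / 2 - 1) := by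
    rw [ENNReal.coe_rpow_of_nonneg _ (by linarith)]; norm_num
  have cη : ((η⁻¹ ^ (p / 2) : ℝ≥0) : ℝ≥0∞) = (η : ℝ≥0∞)⁻¹ ^ (p / 2) := by
    rw [ENNReal.coe_rpow_of_nonneg _ (by linarith), ENNReal.coe_inv hη0]
  calc ∑' x, zVar ρ φ x ^ p ≤ ∑' x, dyMax (zVar ρ φ) x ^ p :=
        ENNReal.tsum_le_tsum fun x => ENNReal.rpow_le_rpow (self_le_dyMax _ x) hp0.le
    _ ≤ 2 * 4 ^ p * ((η : ℝ≥0∞)⁻¹ ^ (p / 2) * ∑' x, U x ^ (p / 2)) :=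
        tsum_rpow_le_of_distr_le hp0 hfinp hη0 hη2 hgood
    _ ≤ 2 * 4 ^ p * ((η : ℝ≥0∞)⁻¹ ^ (p / 2) *
          (2 ^ (p / 2 - 1) * ((1 + A) * ∑' x, ‖φ x‖ₑ ^ p))) := by gcongr
    _ = _ := by
        push_cast
        rw [c4, c2, cη]
        ring

/-- The variational inequality in `ℓᵖ` for finitely supported functions. -/
theorem tsum_zVar_rpow_le {ρ : ℝ} (hρ : 2 < ρ) {p : ℝ} (hp : 1 < p) :
    ∃ C : ℝ≥0, ∀ φ : ℤ → ℂ, φ.support.Finite →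
      ∑' x, zVar ρ φ x ^ p ≤ C * ∑' x, ‖φ x‖ₑ ^ p := by
  -- The induction is on `n` with p ≤ 2^n: halving an exponent above 2 keeps it above 1.
  obtain ⟨n, hn⟩ := exists_nat_gt p
  have hn' : p ≤ 2 ^ n := hn.le.trans (by exact_mod_cast Nat.lt_two_pow_self.le)
  clear hn
  induction n generalizing p with
  | zero => norm_num at hn'; linarith
  | succ n ih =>
    rcases lt_trichotomy p 2 with h | rfl | h
    · obtain ⟨C, hC⟩ := tsum_zVar_rpow_le_of_lt_two hρ hp h
      refine ⟨C, fun φ hφ => hC φ ?_⟩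
      rw [tsum_eq_sum (s := hφ.toFinset) fun z hz => by simpa using hz]
      exact ENNReal.sum_ne_top.2 fun z _ => by simp
    · obtain ⟨C, hC⟩ := tsum_zVar_sq_le hρ
      refine ⟨C, fun φ _ => ?_⟩
      simpa only [ENNReal.rpow_two] using hC φ
    · refine tsum_zVar_rpow_le_of_half hρ h (ih (by linarith) ?_)
      rw [pow_succ] at hn'
      linarith

/-! ### Further properties of the variation -/

/-- Leibniz rule: ab - a'b' = a(b - b') + b'(a - a'), followed by Minkowski's inequality. -/
lemma seqVariation_mul_le {ρ : ℝ} (hρ : 1 ≤ ρ) (a b : ℕ → ℂ) {A B : ℝ≥0∞} (hA : ∀ L, ‖a L‖ₑ ≤ A)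
    (hB : ∀ L, ‖b L‖ₑ ≤ B) :
    seqVariation ρ (fun L => a L * b L) ≤ A * seqVariation ρ b + B * seqVariation ρ a := by
  have hρ0 : 0 < ρ := by linarith
  have hscale : ∀ (c : ℝ≥0∞) (F : ℕ → ℝ≥0∞),
      (∑' i, (c * F i) ^ ρ) ^ (1 / ρ) = c * (∑' i, F i ^ ρ) ^ (1 / ρ) := by
    intro c F
    simp_rw [ENNReal.mul_rpow_of_nonneg _ _ hρ0.le]
    rw [ENNReal.tsum_mul_left, ENNReal.mul_rpow_of_nonneg _ _ (by positivity), ← ENNReal.rpow_mul,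
      mul_one_div_cancel hρ0.ne', ENNReal.rpow_one]
  refine iSup₂_le fun n hn => ?_
  calc (∑' i : ℕ, ‖a (n i) * b (n i) - a (n (i + 1)) * b (n (i + 1))‖ₑ ^ ρ) ^ (1 / ρ)
      ≤ (∑' i : ℕ, (A * ‖b (n i) - b (n (i + 1))‖ₑ + B * ‖a (n i) - a (n (i + 1))‖ₑ) ^ ρ) ^ (1 / ρ) := by
        refine ENNReal.rpow_le_rpow (ENNReal.tsum_le_tsum fun i =>
          ENNReal.rpow_le_rpow ?_ hρ0.le) (by positivity)
        calc ‖a (n i) * b (n i) - a (n (i + 1)) * b (n (i + 1))‖ₑ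
            = ‖a (n i) * (b (n i) - b (n (i + 1))) + b (n (i + 1)) * (a (n i) - a (n (i + 1)))‖ₑ := by
              congr 1; ring
          _ ≤ ‖a (n i)‖ₑ * ‖b (n i) - b (n (i + 1))‖ₑ +
                ‖b (n (i + 1))‖ₑ * ‖a (n i) - a (n (i + 1))‖ₑ := by
              rw [← enorm_mul, ← enorm_mul]
              exact enorm_add_le _ _
          _ ≤ _ := by
              gcongr
              · exact hA _
              · exact hB _
    _ ≤ _ := tsum_Lp_add_le hρ _ _
    _ ≤ _ := by
        rw [hscale, hscale]
        gcongr
        · exact le_seqVariation ρ b hn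
        · exact le_seqVariation ρ a hn

lemma seqVariation_mul_le_two_mul {ρ : ℝ} (hρ : 1 ≤ ρ) (a b : ℕ → ℂ) :
    seqVariation ρ (fun L => a L * b L) ≤
      2 * ((‖a 0‖ₑ + seqVariation ρ a) * (‖b 0‖ₑ + seqVariation ρ b)) := by
  have hρ0 : 0 < ρ := by linarith
  refine (seqVariation_mul_le hρ a b (enorm_le_add_seqVariation hρ0 a)
    (enorm_le_add_seqVariation hρ0 b)).trans ?_
  rw [two_mul]
  refine add_le_add ?_ ?_
  · gcongr
    exact le_add_self
  · rw [mul_comm]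
    gcongr
    exact le_add_self

/-- Sequences with finite variation converge. -/
lemma exists_tendsto_of_seqVariation_ne_top {ρ : ℝ} (hρ : 0 < ρ) {a : ℕ → ℂ}
    (ha : seqVariation ρ a ≠ ∞) : ∃ l, Tendsto a atTop (𝓝 l) := by
  refine cauchySeq_tendsto_of_complete (Metric.cauchySeq_iff'.2 ?_)
  by_contra! hcon
  obtain ⟨ε, hε, h⟩ := hcon
  choose g hg hgε using h
  have hlt : ∀ N, N < g N := fun N => lt_of_le_of_ne (hg N) fun h0 => by
    have := hgε N
    rw [← h0, dist_self] at this
    linarith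
  -- Iterating the failure of the Cauchy condition gives a subsequence all of whose increments are
  -- at least ε.
  set n : ℕ → ℕ := fun i => g^[i] 0 with hn
  have hsucc : ∀ i, n (i + 1) = g (n i) := fun i => Function.iterate_succ_apply' g i 0
  have hmono : StrictMono n := strictMono_nat_of_lt_succ fun i => by
    rw [hsucc]
    exact hlt _
  have h1 := tsum_rpow_le_seqVariation_rpow hρ a hmono
  refine ENNReal.rpow_ne_top_of_nonneg hρ.le ha (top_le_iff.1 (le_trans ?_ h1))
  have hε' : ENNReal.ofReal ε ^ ρ ≠ 0 := by
    rw [Ne, ENNReal.rpow_eq_zero_iff_of_pos hρ]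
    simpa using hε
  rw [← ENNReal.tsum_const_eq_top_of_ne_zero (α := ℕ) hε']
  refine ENNReal.tsum_le_tsum fun i => ENNReal.rpow_le_rpow ?_ hρ.le
  rw [hsucc, ← ofReal_norm, ← dist_eq_norm, dist_comm]
  exact ENNReal.ofReal_le_ofReal (hgε _)

/-- The supremum defining the variation may be taken over a countable family of sequences. -/
lemma seqVariation_eq_iSup_countable {ρ : ℝ} (hρ : 0 < ρ) (a : ℕ → ℂ) :
    seqVariation ρ a = ⨆ g : {g : ℕ × List ℕ // StrictMono fun i => g.2.getD (min i g.1) 0 + (i - g.1)},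
      (∑' i : ℕ, ‖a (g.1.2.getD (min i g.1.1) 0 + (i - g.1.1)) -
        a (g.1.2.getD (min (i + 1) g.1.1) 0 + (i + 1 - g.1.1))‖ₑ ^ ρ) ^ (1 / ρ) := by
  apply le_antisymm
  · refine seqVariation_le_of_tsum_le hρ fun n hn => ?_
    rw [ENNReal.tsum_eq_iSup_nat]
    refine iSup_le fun K => ?_
    -- A code (K, list) follows the list up to index `K` and then proceeds by unit steps; a partial
    -- sum of `K` terms sees only the list.
    have hval : ∀ i, ((List.range (K + 1)).map n).getD (min i K) 0 = n (min i K) := fun i => by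
      rw [List.getD_eq_getElem _ _ (by simp)]
      simp
    have hgm : StrictMono fun i => ((List.range (K + 1)).map n).getD (min i K) 0 + (i - K) := by
      intro i j hij
      simp only [hval]
      rcases lt_or_ge i K with h | h
      · have := hn (show min i K < min j K by omega)
        omega
      · rw [min_eq_right h, min_eq_right (h.trans hij.le)]
        omega
    rw [← ENNReal.rpow_inv_le_iff hρ, ← one_div]
    refine le_trans ?_ (le_iSup _ ⟨(K, (List.range (K + 1)).map n), hgm⟩)
    gcongr
    refine le_trans (Finset.sum_le_sum fun i hi => le_of_eq ?_) (ENNReal.sum_le_tsum (Finset.range K))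
    have hi' := Finset.mem_range.1 hi
    simp only [hval]
    rw [min_eq_left hi'.le, min_eq_left (by omega : i + 1 ≤ K), Nat.sub_eq_zero_of_le hi'.le,
      Nat.sub_eq_zero_of_le (by omega : i + 1 ≤ K), add_zero, add_zero]
  · exact iSup_le fun g => le_seqVariation ρ a g.2

lemma aemeasurable_seqVariation {X : Type*} [MeasurableSpace X] {m : Measure X} {ρ : ℝ} (hρ : 0 < ρ)
    {a : ℕ → X → ℂ} (ha : ∀ L, AEMeasurable (a L) m) :
    AEMeasurable (fun x => seqVariation ρ fun L => a L x) m := by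
  simp_rw [seqVariation_eq_iSup_countable hρ]
  refine AEMeasurable.iSup fun g => (AEMeasurable.tsum fun i => ?_).pow_const _
  exact ((ha _).sub (ha _)).enorm.pow_const _

/-! ### Transference to dynamical systems -/

section Transference

variable {X : Type*} [MeasurableSpace X] {m : Measure X} {S : X ≃ᵐ X}

lemma measurePreserving_zpow (hS : MeasurePreserving S m m) (n : ℤ) :
    MeasurePreserving (fun x => ((S.toEquiv : Equiv.Perm X) ^ n) x) m m := by
  induction n with
  | zero => simpa using! MeasurePreserving.id m
  | succ n ih =>
    have := ih.comp hS
    convert this using 1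
    funext x
    rw [zpow_add_one]
    rfl
  | pred n ih =>
    have := ih.comp (hS.symm S)
    convert this using 1
    funext x
    rw [zpow_sub_one]
    rfl

/-- The values of `f` along the orbit of `x`. -/
def orbitValues (S : X ≃ᵐ X) (f : X → ℂ) (x : X) (n : ℤ) : ℂ :=
  f (((S.toEquiv : Equiv.Perm X) ^ n) x)

/-- Moving the base point along the orbit amounts to moving the centre of the window: the identity
behind transference. -/
lemma zAvg_orbitValues_zpow (S : X ≃ᵐ X) (f : X → ℂ) (L : ℕ) (n : ℤ) (x : X) :
    zAvg L (orbitValues S f (((S.toEquiv : Equiv.Perm X) ^ n) x)) 0 = zAvg L (orbitValues S f x) n := by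
  unfold zAvg
  congr 1
  refine Finset.sum_bij (fun y _ => y + n) (fun y hy => ?_) (fun _ _ _ _ h => by simpa using h)
    (fun y hy => ⟨y - n, ?_, by ring⟩) (fun y _ => ?_)
  · rw [Finset.mem_Icc] at hy ⊢
    omega
  · rw [Finset.mem_Icc] at hy ⊢
    omega
  · rw [orbitValues, orbitValues, zpow_add, Equiv.Perm.mul_apply]

/-- Both the square and its normalisation factor, so the bilinear problem decouples into two linear
ones. -/
lemma squareAverage_eq (S : X ≃ᵐ X) (f g : X → ℂ) (L : ℕ) (x : X) :
    squareAverage S f g L x = zAvg L (orbitValues S f x) 0 * zAvg L (orbitValues S g x) 0 := by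
  simp only [squareAverage, zAvg, orbitValues, zero_sub, zero_add]
  rw [← Finset.sum_mul_sum, one_div, ← inv_pow]
  ring

lemma aemeasurable_orbitValues (hS : MeasurePreserving S m m) {f : X → ℂ} (hf : AEMeasurable f m)
    (n : ℤ) : AEMeasurable (fun x => orbitValues S f x n) m :=
  hf.comp_quasiMeasurePreserving (measurePreserving_zpow hS n).quasiMeasurePreserving

lemma aemeasurable_zAvg_orbitValues (hS : MeasurePreserving S m m) {f : X → ℂ}
    (hf : AEMeasurable f m) (L : ℕ) (n : ℤ) :
    AEMeasurable (fun x => zAvg L (orbitValues S f x) n) m :=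
  (Finset.aemeasurable_fun_sum _ fun y _ => aemeasurable_orbitValues hS hf y).const_mul _

lemma lintegral_comp_zpow (hS : MeasurePreserving S m m) {F : X → ℝ≥0∞} (hF : AEMeasurable F m)
    (n : ℤ) : ∫⁻ x, F (((S.toEquiv : Equiv.Perm X) ^ n) x) ∂m = ∫⁻ x, F x ∂m := by
  have h := measurePreserving_zpow hS n
  conv_rhs => rw [← h.map_eq]
  rw [lintegral_map' (by rwa [h.map_eq]) h.aemeasurable]

/-- The variational inequality for averages along the orbits of a measure preserving map. -/
theorem exists_lintegral_zVar_orbitValues_le {ρ : ℝ} (hρ : 2 < ρ) {p : ℝ} (hp : 1 < p) :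
    ∃ C : ℝ≥0, ∀ {X : Type u} [MeasurableSpace X] {m : Measure X} {S : X ≃ᵐ X},
      MeasurePreserving S m m → ∀ {f : X → ℂ}, AEMeasurable f m →
        ∫⁻ x, zVar ρ (orbitValues S f x) 0 ^ p ∂m ≤ C * ∫⁻ x, ‖f x‖ₑ ^ p ∂m := by
  obtain ⟨C, hC⟩ := tsum_zVar_rpow_le hρ hp
  have hρ0 : 0 < ρ := by linarith
  have hp0 : 0 < p := by linarith
  refine ⟨2 * C, fun {X} _ {m S} hS {f} hf => ?_⟩
  set W : ℕ → X → ℤ → ℝ≥0∞ := fun N x n =>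
    seqVariation ρ (fun L => zAvg (min L N) (orbitValues S f x) n) with hW
  have hWm : ∀ N n, AEMeasurable (fun x => W N x n ^ p) m := fun N n =>
    (aemeasurable_seqVariation hρ0 fun L =>
      aemeasurable_zAvg_orbitValues hS hf (min L N) n).pow_const _
  have hWshift : ∀ N n x, W N (((S.toEquiv : Equiv.Perm X) ^ n) x) 0 = W N x n := fun N n x => by
    simp only [hW, zAvg_orbitValues_zpow]
  -- Windows of radius at most `N` centred in [-N, N] stay inside [-2N, 2N], so the orbit may be cut
  -- off there. The ratio of the two lengths is at most 2, whence the constant 2C.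
  have hpt : ∀ (N : ℕ) (x : X), ∑ n ∈ Finset.Icc (-(N : ℤ)) N, W N x n ^ p ≤
      C * ∑ n ∈ Finset.Icc (-(2 * N : ℤ)) (2 * N), ‖orbitValues S f x n‖ₑ ^ p := by
    intro N x
    set φ : ℤ → ℂ := fun n => if n ∈ Finset.Icc (-(2 * N : ℤ)) (2 * N) then orbitValues S f x n else 0
      with hφ
    have hφf : φ.support.Finite := (Finset.finite_toSet (Finset.Icc (-(2 * N : ℤ)) (2 * N))).subset
      fun n hn => by
        by_contra hcon
        exact hn (if_neg hcon)
    calc ∑ n ∈ Finset.Icc (-(N : ℤ)) N, W N x n ^ p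
        ≤ ∑ n ∈ Finset.Icc (-(N : ℤ)) N, zVar ρ φ n ^ p := by
          refine Finset.sum_le_sum fun n hn => ENNReal.rpow_le_rpow ?_ hp0.le
          rw [Finset.mem_Icc] at hn
          have h1 : (fun L => zAvg (min L N) (orbitValues S f x) n) = fun L => zAvg (min L N) φ n := by
            funext L
            refine zAvg_congr fun y hy1 hy2 => ?_
            have h2 : ((min L N : ℕ) : ℤ) ≤ N := by exact_mod_cast min_le_right L N
            rw [hφ]
            exact (if_pos (by rw [Finset.mem_Icc]; omega)).symm
          simp only [hW]
          rw [h1, zVar, ← iSup_seqVariation_min hρ0 fun L => zAvg L φ n]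
          exact le_iSup (fun N => seqVariation ρ fun L => zAvg (min L N) φ n) N
      _ ≤ ∑' n, zVar ρ φ n ^ p := ENNReal.sum_le_tsum _
      _ ≤ C * ∑' n, ‖φ n‖ₑ ^ p := hC φ hφf
      _ = _ := by
          congr 1
          rw [tsum_eq_sum (s := Finset.Icc (-(2 * N : ℤ)) (2 * N)) fun n hn => by
            simp only [hφ]
            rw [if_neg hn, enorm_zero, ENNReal.zero_rpow_of_pos hp0]]
          exact Finset.sum_congr rfl fun n hn => by simp only [hφ]; rw [if_pos hn]
  have hfp : AEMeasurable (fun x => ‖f x‖ₑ ^ p) m := hf.enorm.pow_const _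
  have horb : ∀ n, ∫⁻ x, ‖orbitValues S f x n‖ₑ ^ p ∂m = ∫⁻ x, ‖f x‖ₑ ^ p ∂m :=
    fun n => lintegral_comp_zpow hS hfp n
  have hN : ∀ N, ∫⁻ x, W N x 0 ^ p ∂m ≤ (2 * C : ℝ≥0) * ∫⁻ x, ‖f x‖ₑ ^ p ∂m := by
    intro N
    have hcard : (Finset.Icc (-(N : ℤ)) N).card = 2 * N + 1 := by rw [Int.card_Icc]; omega
    have hcard' : (Finset.Icc (-(2 * N : ℤ)) (2 * N)).card = 4 * N + 1 := by rw [Int.card_Icc]; omega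
    have hWn : ∀ n, ∫⁻ x, W N x n ^ p ∂m = ∫⁻ x, W N x 0 ^ p ∂m := fun n => by
      rw [← lintegral_comp_zpow hS (hWm N 0) n]
      simp only [hWshift]
    have h1 : ((2 * N + 1 : ℕ) : ℝ≥0∞) * ∫⁻ x, W N x 0 ^ p ∂m ≤
        ((2 * N + 1 : ℕ) : ℝ≥0∞) * ((2 * C : ℝ≥0) * ∫⁻ x, ‖f x‖ₑ ^ p ∂m) := by
      calc ((2 * N + 1 : ℕ) : ℝ≥0∞) * ∫⁻ x, W N x 0 ^ p ∂m
          = ∑ n ∈ Finset.Icc (-(N : ℤ)) N, ∫⁻ x, W N x n ^ p ∂m := by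
            simp only [hWn, Finset.sum_const, hcard, nsmul_eq_mul]
        _ = ∫⁻ x, ∑ n ∈ Finset.Icc (-(N : ℤ)) N, W N x n ^ p ∂m :=
            (lintegral_finsetSum' _ fun n _ => hWm N n).symm
        _ ≤ ∫⁻ x, C * ∑ n ∈ Finset.Icc (-(2 * N : ℤ)) (2 * N), ‖orbitValues S f x n‖ₑ ^ p ∂m :=
            lintegral_mono fun x => hpt N x
        _ = C * ∑ n ∈ Finset.Icc (-(2 * N : ℤ)) (2 * N), ∫⁻ x, ‖orbitValues S f x n‖ₑ ^ p ∂m := by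
            rw [lintegral_const_mul' _ _ (by simp), lintegral_finsetSum' _ fun n _ =>
              (aemeasurable_orbitValues hS hf n).enorm.pow_const _]
        _ = C * ((4 * N + 1 : ℕ) * ∫⁻ x, ‖f x‖ₑ ^ p ∂m) := by
            simp only [horb, Finset.sum_const, hcard', nsmul_eq_mul]
        _ ≤ C * ((2 * (2 * N + 1) : ℕ) * ∫⁻ x, ‖f x‖ₑ ^ p ∂m) := by
            gcongr
            omega
        _ = _ := by push_cast; ring
    exact (ENNReal.mul_le_mul_iff_right (by simp) (ENNReal.natCast_ne_top (2 * N + 1))).1 h1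
  have hsup : ∀ x, zVar ρ (orbitValues S f x) 0 ^ p = ⨆ N, W N x 0 ^ p := by
    intro x
    rw [zVar, ← iSup_seqVariation_min hρ0]
    exact Monotone.map_iSup_of_continuousAt (f := fun t : ℝ≥0∞ => t ^ p)
      ENNReal.continuous_rpow_const.continuousAt (ENNReal.monotone_rpow_of_nonneg hp0.le)
      (by simp [hp0])
  simp_rw [hsup]
  have hmono : ∀ x, Monotone fun N => W N x 0 ^ p := fun x i j hij =>
    ENNReal.rpow_le_rpow
      (seqVariation_min_mono hρ0 (fun L => zAvg L (orbitValues S f x) 0) hij) hp0.le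
  rw [lintegral_iSup' (f := fun N x => W N x 0 ^ p) (fun N => hWm N 0) (ae_of_all _ hmono)]
  exact iSup_le hN

end Transference

/-! ### Hölder's inequality and the bilinear conclusion. -/

/-- The variation of the averages along orbits is bounded on `Lᵖ`, together with the function. -/
lemma exists_lintegral_enorm_add_zVar_le {ρ : ℝ} (hρ : 2 < ρ) {p : ℝ≥0∞} (hp : 1 < p) (hp' : p < ∞) :
    ∃ C : ℝ≥0, ∀ {X : Type u} [MeasurableSpace X] {m : Measure X} {S : X ≃ᵐ X},
      MeasurePreserving S m m → ∀ {f : X → ℂ}, AEMeasurable f m →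
        (∫⁻ x, (‖f x‖ₑ + zVar ρ (orbitValues S f x) 0) ^ p.toReal ∂m) ^ (1 / p.toReal) ≤
          C * eLpNorm f p m := by
  have hr : 1 < p.toReal := by
    rw [← ENNReal.toReal_one]
    exact (ENNReal.toReal_lt_toReal (by simp) hp'.ne).2 hp
  have hr0 : 0 < p.toReal := by linarith
  obtain ⟨C, hC⟩ := exists_lintegral_zVar_orbitValues_le.{u} hρ hr
  refine ⟨1 + C ^ (1 / p.toReal), fun {X} _ {m S} hS {f} hf => ?_⟩
  have hVm : AEMeasurable (fun x => zVar ρ (orbitValues S f x) 0) m :=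
    aemeasurable_seqVariation (by linarith) fun L => aemeasurable_zAvg_orbitValues hS hf L 0
  have hnorm : eLpNorm f p m = (∫⁻ x, ‖f x‖ₑ ^ p.toReal ∂m) ^ (1 / p.toReal) :=
    eLpNorm_eq_lintegral_rpow_enorm_toReal (zero_lt_one.trans hp).ne' hp'.ne
  have h1 := ENNReal.lintegral_Lp_add_le hf.enorm hVm hr.le
  refine h1.trans ?_
  have h2 := ENNReal.rpow_le_rpow (hC hS hf) (one_div_nonneg.2 hr0.le)
  rw [ENNReal.mul_rpow_of_nonneg _ _ (by positivity)] at h2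
  rw [hnorm]
  push_cast
  rw [ENNReal.coe_rpow_of_nonneg _ (by positivity), add_mul, one_mul]
  gcongr

lemma aemeasurable_seqVariation_squareAverage {X : Type u} [MeasurableSpace X] {m : Measure X}
    {S : X ≃ᵐ X} (hS : MeasurePreserving S m m) {ρ : ℝ} (hρ : 0 < ρ) {f g : X → ℂ}
    (hf : AEMeasurable f m) (hg : AEMeasurable g m) :
    AEMeasurable (fun x => seqVariation ρ (fun L => squareAverage S f g L x)) m := by
  simp_rw [squareAverage_eq]
  exact aemeasurable_seqVariation hρ fun L =>
    (aemeasurable_zAvg_orbitValues hS hf L 0).mul (aemeasurable_zAvg_orbitValues hS hg L 0)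

lemma seqVariation_squareAverage_le {X : Type u} [MeasurableSpace X] (S : X ≃ᵐ X) {ρ : ℝ}
    (hρ : 1 ≤ ρ) (f g : X → ℂ) (x : X) :
    seqVariation ρ (fun L => squareAverage S f g L x) ≤
      2 * ((‖f x‖ₑ + zVar ρ (orbitValues S f x) 0) * (‖g x‖ₑ + zVar ρ (orbitValues S g x) 0)) := by
  simp_rw [squareAverage_eq]
  have h := seqVariation_mul_le_two_mul hρ (fun L => zAvg L (orbitValues S f x) 0)
    (fun L => zAvg L (orbitValues S g x) 0)
  simpa [zAvg_zero_left, orbitValues, zVar] using h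

lemma ne_zero_and_ne_top_of_one_div_eq_add {p₁ p₂ p : ℝ≥0∞} (hp₁ : 1 < p₁) (hp₁' : p₁ < ∞)
    (hp₂ : 1 < p₂) (hp : 1 / p = 1 / p₁ + 1 / p₂) : p ≠ 0 ∧ p ≠ ∞ := by
  simp only [one_div] at hp
  refine ⟨?_, ?_⟩
  · rw [← ENNReal.inv_ne_top, hp]
    exact ENNReal.add_ne_top.2 ⟨ENNReal.inv_ne_top.2 (zero_lt_one.trans hp₁).ne',
      ENNReal.inv_ne_top.2 (zero_lt_one.trans hp₂).ne'⟩
  · rw [← ENNReal.inv_ne_zero, hp]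
    exact fun h => ENNReal.inv_ne_zero.2 hp₁'.ne (add_eq_zero.1 h).1

/-- Hölder's inequality applied to the pointwise product bound. Since `p` may be below 1, only
monotonicity and homogeneity are used in L^p; Minkowski's inequality enters only in the exponents
`p₁` and `p₂`. -/
theorem eLpNorm_seqVariation_squareAverage_le {p₁ p₂ p : ℝ≥0∞} (hp₁ : 1 < p₁) (hp₁' : p₁ < ∞)
    (hp₂ : 1 < p₂) (hp₂' : p₂ < ∞) (hp : 1 / p = 1 / p₁ + 1 / p₂) {ρ : ℝ} (hρ : 2 < ρ) :
    ∃ C : ℝ≥0, ∀ {X : Type u} [MeasurableSpace X] {m : Measure X} {S : X ≃ᵐ X},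
      MeasurePreserving S m m → ∀ {f g : X → ℂ}, AEMeasurable f m → AEMeasurable g m →
        eLpNorm (fun x => seqVariation ρ (fun L => squareAverage S f g L x)) p m ≤
          C * eLpNorm f p₁ m * eLpNorm g p₂ m := by
  obtain ⟨C₁, h₁⟩ := exists_lintegral_enorm_add_zVar_le.{u} hρ hp₁ hp₁'
  obtain ⟨C₂, h₂⟩ := exists_lintegral_enorm_add_zVar_le.{u} hρ hp₂ hp₂'
  have hi₁ : p₁⁻¹ ≠ ∞ := ENNReal.inv_ne_top.2 (zero_lt_one.trans hp₁).ne'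
  have hi₂ : p₂⁻¹ ≠ ∞ := ENNReal.inv_ne_top.2 (zero_lt_one.trans hp₂).ne'
  obtain ⟨hp0, hptop⟩ := ne_zero_and_ne_top_of_one_div_eq_add hp₁ hp₁' hp₂ hp
  simp only [one_div] at hp
  have hreal : 1 / p.toReal = 1 / p₁.toReal + 1 / p₂.toReal := by
    simp only [one_div]
    rw [← ENNReal.toReal_inv, ← ENNReal.toReal_inv, ← ENNReal.toReal_inv, hp,
      ENNReal.toReal_add hi₁ hi₂]
  have hr : 0 < p.toReal := ENNReal.toReal_pos hp0 hptop
  have hr₁ : 0 < p₁.toReal := ENNReal.toReal_pos (zero_lt_one.trans hp₁).ne' hp₁'.ne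
  have hr₂ : 0 < p₂.toReal := ENNReal.toReal_pos (zero_lt_one.trans hp₂).ne' hp₂'.ne
  have hlt : p.toReal < p₁.toReal := by
    refine (one_div_lt_one_div hr₁ hr).1 ?_
    rw [hreal]
    have : 0 < 1 / p₂.toReal := by positivity
    linarith
  have hρ0 : 0 < ρ := by linarith
  refine ⟨2 * C₁ * C₂, fun {X} _ {m S} hS {f g} hf hg => ?_⟩
  set F : X → ℝ≥0∞ := fun x => ‖f x‖ₑ + zVar ρ (orbitValues S f x) 0 with hF
  set G : X → ℝ≥0∞ := fun x => ‖g x‖ₑ + zVar ρ (orbitValues S g x) 0 with hG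
  have hFm : AEMeasurable F m := hf.enorm.add
    (aemeasurable_seqVariation hρ0 fun L => aemeasurable_zAvg_orbitValues hS hf L 0)
  have hGm : AEMeasurable G m := hg.enorm.add
    (aemeasurable_seqVariation hρ0 fun L => aemeasurable_zAvg_orbitValues hS hg L 0)
  calc eLpNorm (fun x => seqVariation ρ (fun L => squareAverage S f g L x)) p m
      = (∫⁻ x, seqVariation ρ (fun L => squareAverage S f g L x) ^ p.toReal ∂m) ^ (1 / p.toReal) := by
        rw [eLpNorm_eq_lintegral_rpow_enorm_toReal hp0 hptop]
        simp only [enorm_eq_self]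
    _ ≤ (∫⁻ x, (2 * (F * G) x) ^ p.toReal ∂m) ^ (1 / p.toReal) := by
        gcongr with x
        exact seqVariation_squareAverage_le S (by linarith) f g x
    _ = 2 * (∫⁻ x, (F * G) x ^ p.toReal ∂m) ^ (1 / p.toReal) := by
        simp_rw [ENNReal.mul_rpow_of_nonneg _ _ hr.le]
        rw [lintegral_const_mul' _ _ (by simp), ENNReal.mul_rpow_of_nonneg _ _ (by positivity),
          ← ENNReal.rpow_mul, mul_one_div_cancel hr.ne', ENNReal.rpow_one]
    _ ≤ 2 * ((∫⁻ x, F x ^ p₁.toReal ∂m) ^ (1 / p₁.toReal) *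
          (∫⁻ x, G x ^ p₂.toReal ∂m) ^ (1 / p₂.toReal)) := by
        gcongr
        exact ENNReal.lintegral_Lp_mul_le_Lq_mul_Lr hr hlt hreal m hFm hGm
    _ ≤ 2 * ((C₁ * eLpNorm f p₁ m) * (C₂ * eLpNorm g p₂ m)) := by
        gcongr
        · exact h₁ hS hf
        · exact h₂ hS hg
    _ = _ := by push_cast; ring

theorem corollary1p3 (p₁ p₂ p : ℝ≥0∞) (hp₁ : 1 < p₁) (hp₁' : p₁ < ∞)
    (hp₂ : 1 < p₂) (hp₂' : p₂ < ∞) (hp : 1 / p = 1 / p₁ + 1 / p₂) :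
    (∀ ρ : ℝ, 2 < ρ → ∃ C : ℝ≥0,
      ∀ (X : Type u) [MeasurableSpace X] (m : Measure X) [IsProbabilityMeasure m] (S : X ≃ᵐ X),
        MeasurePreserving S m m →
        ∀ f g : X → ℂ, MemLp f p₁ m → MemLp g p₂ m →
          AEMeasurable (fun x => seqVariation ρ (fun L => squareAverage S f g L x)) m ∧
          eLpNorm (fun x => seqVariation ρ (fun L => squareAverage S f g L x)) p m ≤
            C * eLpNorm f p₁ m * eLpNorm g p₂ m) ∧
    (∀ (X : Type u) [MeasurableSpace X] (m : Measure X) [IsProbabilityMeasure m] (S : X ≃ᵐ X),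
      MeasurePreserving S m m →
      ∀ f g : X → ℂ, MemLp f p₁ m → MemLp g p₂ m →
        ∀ᵐ x ∂m, ∃ a : ℂ, Tendsto (fun N => squareAverage S f g N x) atTop (𝓝 a)) := by
  have hpart1 := fun (ρ : ℝ) (hρ : 2 < ρ) =>
    eLpNorm_seqVariation_squareAverage_le.{u} hp₁ hp₁' hp₂ hp₂' hp hρ
  refine ⟨fun ρ hρ => ?_, fun X _ m _ S hS f g hf hg => ?_⟩
  · obtain ⟨C, hC⟩ := hpart1 ρ hρ
    refine ⟨C, fun X _ m _ S hS f g hf hg => ⟨?_, ?_⟩⟩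
    · exact aemeasurable_seqVariation_squareAverage hS (by linarith)
        hf.1.aemeasurable hg.1.aemeasurable
    · exact hC hS hf.1.aemeasurable hg.1.aemeasurable
  -- Any ρ > 2 would do: the 3-variation lies in L^p, hence is finite almost everywhere.
  · obtain ⟨C, hC⟩ := hpart1 3 (by norm_num)
    have hmeas := aemeasurable_seqVariation_squareAverage hS (ρ := 3) (by norm_num)
      hf.1.aemeasurable hg.1.aemeasurable
    have hfin : eLpNorm (fun x => seqVariation 3 (fun L => squareAverage S f g L x)) p m < ∞ :=
      (hC hS hf.1.aemeasurable hg.1.aemeasurable).trans_lt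
        (ENNReal.mul_lt_top (ENNReal.mul_lt_top (by simp) hf.2) hg.2)
    obtain ⟨hp0, hptop⟩ := ne_zero_and_ne_top_of_one_div_eq_add hp₁ hp₁' hp₂ hp
    have hr : 0 < p.toReal := ENNReal.toReal_pos hp0 hptop
    have hint := lintegral_rpow_enorm_lt_top_of_eLpNorm_lt_top hp0 hptop hfin
    simp only [enorm_eq_self] at hint
    filter_upwards [ae_lt_top' (hmeas.pow_const _) hint.ne] with x hx
    exact exists_tendsto_of_seqVariation_ne_top (ρ := 3) (by norm_num)
      ((ENNReal.rpow_lt_top_iff_of_pos hr).1 hx).ne
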